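/- Let $k$ be a field of characteristic $0$, let $a=(a_{ij})_{1\le i,j\le N}$ be a generalized Cartan matrix, let $d_1,\dots,d_N$ be positive integers with $d_ia_{ij}=d_ja_{ji}$, let $q\in k$ be nonzero and put $q_i=q^{d_i}$. *Terminology.* A braiding on a vector space $V$ is an invertible $\sigma\in\mathrm{End}(V\otimes V)$ with $\sigma_1\sigma_2\sigma_1=\sigma_2\sigma_1\sigma_2$ on $V^{\otimes 3}$, where $\sigma_1=\sigma\otimes\mathrm{id}$ and $\sigma_2=\mathrm{id}\otimes\sigma$. An algebra $A$ with product $m$ and a braiding $\sigma$ is a *YB algebra* if $\sigma(m\otimes\mathrm{id})=(\mathrm{id}\otimes m)\sigma_1\sigma_2$, $\sigma(\mathrm{id}\otimes m)=(m\otimes\mathrm{id})\sigma_2\sigma_1$, $\sigma(1\otimes x)=x\otimes 1$ and $\sigma(x\otimes 1)=1\otimes x$. A coalgebra $C$ with a braiding $\sigma$ is a *YB coalgebra* if $\sigma_1\sigma_2(\Delta\otimes\mathrm{id})=(\mathrm{id}\otimes\Delta)\sigma$, $\sigma_2\sigma_1(\mathrm{id}\otimes\Delta)=(\Delta\otimes\mathrm{id})\sigma$,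 $(\mathrm{id}\otimes\varepsilon)\sigma(x\otimes y)=\varepsilon(x)\,y$ and $(\varepsilon\otimes\mathrm{id})\sigma(x\otimes y)=\varepsilon(y)\,x$. *The algebras.* If $q$ is not a root of unity, let $U_q$ be the quantized enveloping algebra of $a$: the $k$-algebra with generators $E_i,F_i,K_i^{\pm1}$, where the $K_i$ commute, $K_iE_j=q^{d_ia_{ij}}E_jK_i$, $K_iF_j=q^{-d_ia_{ij}}F_jK_i$, $E_iF_j-F_jE_i=\delta_{ij}(K_i-K_i^{-1})/(q_i-q_i^{-1})$, and the $E_i$ and the $F_i$ satisfy the quantum Serre relations. Let $U_q^+\subseteq U_q$ be the subalgebra generated by the $E_i$ and the $K_i^{\pm1}$. If $q$ is a primitive $l$-th root of unity, $l\ge1$, let $\mathcal U\subseteq U_v$ be the restricted integral form of the quantized enveloping algebra $U_v$ over $k(v)$, i.e. the $k[v,v^{-1}]$-subalgebra generated by the $K_i^{\pm1}$ and the divided powers $E_i^{(n)},F_i^{(n)}$. Let $u_q^+$ be the subalgebra of $\mathcal U/(v-q)\,\mathcal U$ generated by the $E_i$ and the $K_i^{\pm1}$, and let $\bar u_q^+$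 be the quotient of $u_q^+$ by the two-sided ideal generated by the elements $K_i^l-1$. **Corollary 3.6.** Let $A$ be $U_q^+$ ($q$ not a root of unity), or $u_q^+$ or $\bar u_q^+$ ($q$ a primitive $l$-th root of unity). Then $A$ is a Hopf algebra with $$\Delta(K_i)=K_i\otimes K_i,\quad \Delta(E_i)=E_i\otimes1+K_i\otimes E_i,\quad \varepsilon(K_i)=1,\quad \varepsilon(E_i)=0,$$ there is a bialgebra endomorphism $p$ of $A$ with $p(K_i)=K_i$ and $p(E_i)=0$ (the projection onto the subalgebra generated by the $K_i^{\pm1}$), and $A$ is both a YB algebra and a YB coalgebra. More precisely: 1. with Woronowicz's braidings, $A$ is a YB algebra for $x\otimes y\mapsto\sum x_{(1)}\,y\,S(x_{(2)})\otimes x_{(3)}$ and a YB coalgebra for $x\otimes y\mapsto\sum x_{(1)}S(x_{(3)})\,y\otimes x_{(2)}$; 2. with braidings coming from the projection $p$, $A$ is a YB algebra for $x\otimes y\mapsto\sum p(x_{(1)})\,y\,S(p(x_{(2)}))\otimes x_{(3)}$ and a YB coalgebra for $x\otimes y\mapsto\sum p(x_{(1)})S(p(x_{(3)}))\,y\otimes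 x_{(2)}$; 3. $A$ is both a YB algebra and a YB coalgebra for the single braiding $x\otimes y\mapsto\sum \bigl(p(x_{(1)})S(p(x_{(3)}))\bigr)\cdot y\otimes x_{(2)}$, where $h\cdot y=\sum h_{(1)}\,y\,S(h_{(2)})$. -/

import Mathlib

open scoped TensorProduct

noncomputable section

namespace QuantumYB

/-! ### Braidings, Yang-Baxter algebras and Yang-Baxter coalgebras -/

section YangBaxter

variable {k : Type*} [Field k] {V : Type*} [AddCommGroup V] [Module k V]

/-- The operator `σ ⊗ id` on `V ⊗ V ⊗ V`. -/
def braid₁ (σ : V ⊗[k] V →ₗ[k] V ⊗[k] V) :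
    (V ⊗[k] V) ⊗[k] V →ₗ[k] (V ⊗[k] V) ⊗[k] V :=
  σ.rTensor V

/-- The operator `id ⊗ σ` on `V ⊗ V ⊗ V`. -/
def braid₂ (σ : V ⊗[k] V →ₗ[k] V ⊗[k] V) :
    (V ⊗[k] V) ⊗[k] V →ₗ[k] (V ⊗[k] V) ⊗[k] V :=
  (TensorProduct.assoc k V V V).symm.toLinearMap ∘ₗ σ.lTensor V ∘ₗ
    (TensorProduct.assoc k V V V).toLinearMap

/-- A braiding on `V`: an invertible endomorphism of `V ⊗ V` that satisfies the quantum
Yang-Baxter equation on `V ⊗ V ⊗ V`. -/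
structure IsBraiding (σ : V ⊗[k] V →ₗ[k] V ⊗[k] V) : Prop where
  bijective : Function.Bijective σ
  yangBaxter : braid₁ σ ∘ₗ braid₂ σ ∘ₗ braid₁ σ = braid₂ σ ∘ₗ braid₁ σ ∘ₗ braid₂ σ

/-- `(A, σ)` is a Yang-Baxter algebra: `σ` is a braiding on the algebra `A` for which the
product and the unit of `A` are compatible with `σ`. -/
structure IsYBAlgebra {A : Type*} [Ring A] [Algebra k A]
    (σ : A ⊗[k] A →ₗ[k] A ⊗[k] A) : Prop extends IsBraiding σ where
  mul_left : σ ∘ₗ (LinearMap.mul' k A).rTensor A =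
    (LinearMap.mul' k A).lTensor A ∘ₗ (TensorProduct.assoc k A A A).toLinearMap ∘ₗ
      braid₁ σ ∘ₗ braid₂ σ
  mul_right : σ ∘ₗ (LinearMap.mul' k A).lTensor A ∘ₗ (TensorProduct.assoc k A A A).toLinearMap =
    (LinearMap.mul' k A).rTensor A ∘ₗ braid₂ σ ∘ₗ braid₁ σ
  one_left : ∀ a : A, σ (1 ⊗ₜ[k] a) = a ⊗ₜ[k] 1
  one_right : ∀ a : A, σ (a ⊗ₜ[k] 1) = 1 ⊗ₜ[k] a

/-- `(C, σ)` is a Yang-Baxter coalgebra: `σ` is a braiding on the coalgebra `C` for which the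
coproduct and the counit of `C` are compatible with `σ`. -/
structure IsYBCoalgebra {C : Type*} [AddCommGroup C] [Module k C] [Coalgebra k C]
    (σ : C ⊗[k] C →ₗ[k] C ⊗[k] C) : Prop extends IsBraiding σ where
  comul_left : braid₁ σ ∘ₗ braid₂ σ ∘ₗ (Coalgebra.comul (R := k) (A := C)).rTensor C =
    (TensorProduct.assoc k C C C).symm.toLinearMap ∘ₗ
      (Coalgebra.comul (R := k) (A := C)).lTensor C ∘ₗ σ
  comul_right : braid₂ σ ∘ₗ braid₁ σ ∘ₗ (TensorProduct.assoc k C C C).symm.toLinearMap ∘ₗ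
      (Coalgebra.comul (R := k) (A := C)).lTensor C =
    (Coalgebra.comul (R := k) (A := C)).rTensor C ∘ₗ σ
  counit_left : (Coalgebra.counit (R := k) (A := C)).lTensor C ∘ₗ σ =
    (TensorProduct.comm k k C).toLinearMap ∘ₗ (Coalgebra.counit (R := k) (A := C)).rTensor C
  counit_right : (Coalgebra.counit (R := k) (A := C)).rTensor C ∘ₗ σ =
    (TensorProduct.comm k C k).toLinearMap ∘ₗ (Coalgebra.counit (R := k) (A := C)).lTensor C

end YangBaxter

/-! ### Braidings of Yetter-Drinfel'd type on a Hopf algebra -/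

section Braidings

/-- For an action `H ⊗ V → V` and a coaction `V → H ⊗ V`, the natural map
`v ⊗ w ↦ ∑ v₍₋₁₎ · w ⊗ v₍₀₎` (a braiding when `V` is a Yetter-Drinfel'd module and the
antipode of `H` is invertible). -/
def ydBraiding {k : Type*} [Field k] {H V : Type*} [AddCommGroup H] [Module k H]
    [AddCommGroup V] [Module k V]
    (act : H ⊗[k] V →ₗ[k] V) (coact : V →ₗ[k] H ⊗[k] V) : V ⊗[k] V →ₗ[k] V ⊗[k] V :=
  act.rTensor V ∘ₗ (TensorProduct.rightComm k H V V).toLinearMap ∘ₗ coact.rTensor V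

variable (k : Type*) [Field k] (A : Type*) [Ring A] [HopfAlgebra k A]

/-- The left adjoint action `h ⊗ a ↦ ∑ h₍₁₎ a S(h₍₂₎)`. -/
def adjointAction : A ⊗[k] A →ₗ[k] A :=
  LinearMap.mul' k A ∘ₗ
    TensorProduct.map (LinearMap.mul' k A) (HopfAlgebra.antipode k (A := A)) ∘ₗ
    (TensorProduct.rightComm k A A A).toLinearMap ∘ₗ
    (Coalgebra.comul (R := k) (A := A)).rTensor A

/-- The left adjoint coaction `a ↦ ∑ a₍₁₎ S(a₍₃₎) ⊗ a₍₂₎`. -/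
def adjointCoaction : A →ₗ[k] A ⊗[k] A :=
  (LinearMap.mul' k A ∘ₗ (HopfAlgebra.antipode k (A := A)).lTensor A).rTensor A ∘ₗ
    (TensorProduct.rightComm k A A A).toLinearMap ∘ₗ
    (Coalgebra.comul (R := k) (A := A)).rTensor A ∘ₗ
    Coalgebra.comul (R := k) (A := A)

/-- Woronowicz's braiding `F'(a ⊗ b) = ∑ a₍₁₎ b S(a₍₂₎) ⊗ a₍₃₎`: the Yetter-Drinfel'd braiding
of `A` over itself for the adjoint action and the regular coaction. -/
def woronowiczF' : A ⊗[k] A →ₗ[k] A ⊗[k] A :=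
  ydBraiding (adjointAction k A) (Coalgebra.comul (R := k) (A := A))

/-- Woronowicz's braiding `F(a ⊗ b) = ∑ a₍₁₎ S(a₍₃₎) b ⊗ a₍₂₎`: the Yetter-Drinfel'd braiding
of `A` over itself for the regular action and the adjoint coaction. -/
def woronowiczF : A ⊗[k] A →ₗ[k] A ⊗[k] A :=
  ydBraiding (LinearMap.mul' k A) (adjointCoaction k A)

variable {k A}

/-! Let `p = i ∘ π` be an idempotent Hopf algebra endomorphism of `A`, with image `H`. Then `A` is
the Radford biproduct `B # H` of `H` and of the algebra `B` of right `H`-coinvariants, through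
`b ⊗ h ↦ b h`. The three maps below are the natural braidings of the tensor product `B ⊗ H` of
Yetter-Drinfel'd modules over `H`, transported to `A`. The action of `H` on `B` is the left
adjoint one and its coaction is `(p ⊗ id) Δ`; the structure on the factor `H` is the adjoint
action with the regular coaction, respectively the regular action with the adjoint coaction,
respectively (for commutative and cocommutative `H`) the adjoint action with the adjoint
coaction, both of which are then trivial. -/

/-- `a ⊗ b ↦ ∑ p(a₍₁₎) b S(p(a₍₂₎)) ⊗ a₍₃₎`. -/
def biproductBraidingAlg (p : A →ₐc[k] A) : A ⊗[k] A →ₗ[k] A ⊗[k] A :=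
  ydBraiding (adjointAction k A)
    ((p : A →ₗ[k] A).rTensor A ∘ₗ Coalgebra.comul (R := k) (A := A))

/-- `a ⊗ b ↦ ∑ p(a₍₁₎) S(p(a₍₃₎)) b ⊗ a₍₂₎`. -/
def biproductBraidingCoalg (p : A →ₐc[k] A) : A ⊗[k] A →ₗ[k] A ⊗[k] A :=
  ydBraiding (LinearMap.mul' k A) ((p : A →ₗ[k] A).rTensor A ∘ₗ adjointCoaction k A)

/-- `a ⊗ b ↦ ∑ (p(a₍₁₎) S(p(a₍₃₎))) · b ⊗ a₍₂₎` with the adjoint action. -/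
def biproductBraiding (p : A →ₐc[k] A) : A ⊗[k] A →ₗ[k] A ⊗[k] A :=
  ydBraiding (adjointAction k A) ((p : A →ₗ[k] A).rTensor A ∘ₗ adjointCoaction k A)

end Braidings

/-! ### Yang-Baxter structures on the positive part of a quantum group -/

section Structures

variable (k : Type*) [Field k] {A : Type*} [Ring A] {ι : Type*}

/-- The Hopf algebra structure of `A` is the standard one of the positive part of a quantum group
with generators `E i` and `K i`. -/
structure IsStandardHopf [HopfAlgebra k A] (E K : ι → A) : Prop where
  comul_K : ∀ i, Coalgebra.comul (R := k) (K i) = K i ⊗ₜ[k] K i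
  comul_E : ∀ i, Coalgebra.comul (R := k) (E i) = E i ⊗ₜ[k] 1 + K i ⊗ₜ[k] E i
  counit_K : ∀ i, Coalgebra.counit (R := k) (K i) = 1
  counit_E : ∀ i, Coalgebra.counit (R := k) (E i) = 0

/-- Woronowicz's braidings make the Hopf algebra `A` a Yang-Baxter algebra and a Yang-Baxter
coalgebra, and so do the braidings which come from the Hopf algebra projection `p` of `A` onto the
subalgebra generated by the `K i`; the last one of these serves for both. -/
structure HasYBStructures [HopfAlgebra k A] (E K : ι → A) (p : A →ₐc[k] A) : Prop where
  proj_K : ∀ i, p (K i) = K i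
  proj_E : ∀ i, p (E i) = 0
  ybAlgebra_F' : IsYBAlgebra (woronowiczF' k A)
  ybCoalgebra_F : IsYBCoalgebra (woronowiczF k A)
  ybAlgebra_biproduct : IsYBAlgebra (biproductBraidingAlg p)
  ybCoalgebra_biproduct : IsYBCoalgebra (biproductBraidingCoalg p)
  ybAlgebra_both : IsYBAlgebra (biproductBraiding p)
  ybCoalgebra_both : IsYBCoalgebra (biproductBraiding p)

/-- The Hopf algebra `A` is the standard one on the generators `E i` and `K i ^ ±1`, and it is a
Yang-Baxter algebra and a Yang-Baxter coalgebra. -/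
def IsStandardYBHopf [HopfAlgebra k A] (E K : ι → A) : Prop :=
  IsStandardHopf k E K ∧ ∃ p : A →ₐc[k] A, HasYBStructures k E K p

/-- The algebra `A`, which is meant to be generated by the `E i` and the `K i ^ ±1`, carries the
standard Hopf algebra structure (over its given algebra structure), and it is a Yang-Baxter
algebra and a Yang-Baxter coalgebra. -/
def IsYBHopf [alg : Algebra k A] (E K : ι → A) : Prop :=
  ∃ hopf : HopfAlgebra k A, hopf.toAlgebra = alg ∧ @IsStandardYBHopf k _ A _ ι hopf E K

end Structures

/-! ### Quantized enveloping algebras -/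

/-- `a` is a generalized Cartan matrix, symmetrized by the positive integers `d i`. -/
structure IsSymmetrizedCartan {ι : Type*} (a : Matrix ι ι ℤ) (d : ι → ℕ) : Prop where
  diag : ∀ i, a i i = 2
  offDiag_nonpos : ∀ i j, i ≠ j → a i j ≤ 0
  zero_symm : ∀ i j, a i j = 0 → a j i = 0
  d_pos : ∀ i, 0 < d i
  symm : ∀ i j, (d i : ℤ) * a i j = (d j : ℤ) * a j i

/-- The quantum integer `[n] = (t ^ n - t ^ (-n)) / (t - t⁻¹)`, that is
`t ^ (n - 1) + t ^ (n - 3) + ⋯ + t ^ (1 - n)`. -/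
def qInt {F : Type*} [Field F] (t : F) (n : ℕ) : F :=
  ∑ m ∈ Finset.range n, t ^ ((n : ℤ) - 1 - 2 * m)

/-- The quantum factorial `[n]! = [1] [2] ⋯ [n]`. -/
def qFact {F : Type*} [Field F] (t : F) (n : ℕ) : F :=
  ∏ m ∈ Finset.range n, qInt t (m + 1)

/-- The quantum binomial coefficient `[n]! / ([s]! [n - s]!)`, for `s ≤ n`. -/
def qBinom {F : Type*} [Field F] (t : F) (n s : ℕ) : F :=
  qFact t n / (qFact t s * qFact t (n - s))

/-- The quantum Serre expression
`∑ (-1) ^ s [n choose s] x ^ (n - s) * y * x ^ s`, summed over `0 ≤ s ≤ n`. -/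
def qSerre {F B : Type*} [Field F] [Ring B] [Algebra F B] (t : F) (n : ℕ) (x y : B) : B :=
  ∑ s ∈ Finset.range (n + 1), ((-1) ^ s * qBinom t n s) • (x ^ (n - s) * y * x ^ s)

/-- Names of the generators of the quantized enveloping algebra. -/
inductive Gen (ι : Type*)
  | E (i : ι)
  | F (i : ι)
  | K (i : ι)
  | Kinv (i : ι)

section QuantumGroup

variable {F : Type*} [Field F] (q : F) {ι : Type*} (a : Matrix ι ι ℤ) (d : ι → ℕ)

/-- The defining relations of the quantized enveloping algebra, where `q i = q ^ d i`. -/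
inductive Rel : FreeAlgebra F (Gen ι) → FreeAlgebra F (Gen ι) → Prop
  | K_mul_Kinv (i : ι) : Rel (.ι F (.K i) * .ι F (.Kinv i)) 1
  | Kinv_mul_K (i : ι) : Rel (.ι F (.Kinv i) * .ι F (.K i)) 1
  | K_comm (i j : ι) : Rel (.ι F (.K i) * .ι F (.K j)) (.ι F (.K j) * .ι F (.K i))
  | K_E (i j : ι) : Rel (.ι F (.K i) * .ι F (.E j))
      (q ^ ((d i : ℤ) * a i j) • (.ι F (.E j) * .ι F (.K i)))
  | K_F (i j : ι) : Rel (.ι F (.K i) * .ι F (.F j))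
      (q ^ (-((d i : ℤ) * a i j)) • (.ι F (.F j) * .ι F (.K i)))
  | E_F_self (i : ι) : Rel (.ι F (.E i) * .ι F (.F i) - .ι F (.F i) * .ι F (.E i))
      ((q ^ d i - (q ^ d i)⁻¹)⁻¹ • (.ι F (.K i) - .ι F (.Kinv i)))
  | E_F_ne (i j : ι) : i ≠ j → Rel (.ι F (.E i) * .ι F (.F j)) (.ι F (.F j) * .ι F (.E i))
  | serre_E (i j : ι) : i ≠ j →
      Rel (qSerre (q ^ d i) (1 - a i j).toNat (.ι F (.E i)) (.ι F (.E j))) 0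
  | serre_F (i j : ι) : i ≠ j →
      Rel (qSerre (q ^ d i) (1 - a i j).toNat (.ι F (.F i)) (.ι F (.F j))) 0

/-- The quantized enveloping algebra `U_q` of the Cartan matrix `a`, for a `q` which is not a root
of unity. -/
def Uq : Type _ := RingQuot (Rel q a d)

instance : Ring (Uq q a d) := inferInstanceAs (Ring (RingQuot (Rel q a d)))

instance {R : Type*} [CommSemiring R] [Algebra R F] : Algebra R (Uq q a d) :=
  inferInstanceAs (Algebra R (RingQuot (Rel q a d)))

/-- The presentation of `Uq` as a quotient of the free algebra on its generators. -/
def Uq.mk : FreeAlgebra F (Gen ι) →ₐ[F] Uq q a d := RingQuot.mkAlgHom F (Rel q a d)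

/-- The generator of `Uq` of a given name. -/
def gen (x : Gen ι) : Uq q a d := Uq.mk q a d (FreeAlgebra.ι F x)

/-- The positive part `U_q⁺` with its torus: the subalgebra of `Uq` generated by the `E i` and the
`K i ^ ±1`. -/
def UqPlus : Subalgebra F (Uq q a d) :=
  Algebra.adjoin F (Set.range (fun i => gen q a d (.E i)) ∪
    Set.range (fun i => gen q a d (.K i)) ∪ Set.range (fun i => gen q a d (.Kinv i)))

/-- The generators `E i` of `U_q⁺`. -/
def UqPlus.E (i : ι) : UqPlus q a d :=
  ⟨gen q a d (.E i), Algebra.subset_adjoin (.inl (.inl ⟨i, rfl⟩))⟩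

/-- The generators `K i` of `U_q⁺`. -/
def UqPlus.K (i : ι) : UqPlus q a d :=
  ⟨gen q a d (.K i), Algebra.subset_adjoin (.inl (.inr ⟨i, rfl⟩))⟩

end QuantumGroup

/-! ### The restricted form at a root of unity -/

section Restricted

variable {k : Type*} [Field k] {ι : Type*} (a : Matrix ι ι ℤ) (d : ι → ℕ)

variable (k) in
/-- The quantized enveloping algebra over `k(v)`, for the indeterminate `v`. -/
abbrev Uv : Type _ := Uq (RatFunc.X : RatFunc k) a d

variable (k) in
/-- Lusztig's restricted integral form: the `k[v, v⁻¹]`-subalgebra of `Uv` generated by the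
`K i ^ ±1` and by the divided powers of the `E i` and the `F i`. -/
def integralForm : Subalgebra k (Uv k a d) :=
  Algebra.adjoin k
    ({algebraMap (RatFunc k) (Uv k a d) RatFunc.X,
      algebraMap (RatFunc k) (Uv k a d) (RatFunc.X)⁻¹} ∪
    Set.range (fun i => gen (RatFunc.X : RatFunc k) a d (.K i)) ∪
    Set.range (fun i => gen (RatFunc.X : RatFunc k) a d (.Kinv i)) ∪
    Set.range (fun x : ι × ℕ => (qFact ((RatFunc.X : RatFunc k) ^ d x.1) x.2)⁻¹ •
      gen (RatFunc.X : RatFunc k) a d (.E x.1) ^ x.2) ∪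
    Set.range (fun x : ι × ℕ => (qFact ((RatFunc.X : RatFunc k) ^ d x.1) x.2)⁻¹ •
      gen (RatFunc.X : RatFunc k) a d (.F x.1) ^ x.2))

theorem v_mem_integralForm :
    algebraMap (RatFunc k) (Uv k a d) RatFunc.X ∈ integralForm k a d :=
  Algebra.subset_adjoin (.inl (.inl (.inl (.inl (.inl rfl)))))

theorem K_mem_integralForm (i : ι) :
    gen (RatFunc.X : RatFunc k) a d (.K i) ∈ integralForm k a d :=
  Algebra.subset_adjoin (.inl (.inl (.inl (.inr ⟨i, rfl⟩))))

theorem Kinv_mem_integralForm (i : ι) :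
    gen (RatFunc.X : RatFunc k) a d (.Kinv i) ∈ integralForm k a d :=
  Algebra.subset_adjoin (.inl (.inl (.inr ⟨i, rfl⟩)))

theorem E_mem_integralForm (i : ι) :
    gen (RatFunc.X : RatFunc k) a d (.E i) ∈ integralForm k a d := by
  have h : (qFact ((RatFunc.X : RatFunc k) ^ d i) 1)⁻¹ •
      gen (RatFunc.X : RatFunc k) a d (.E i) ^ 1 ∈ integralForm k a d :=
    Algebra.subset_adjoin (.inl (.inr ⟨(i, 1), rfl⟩))
  simpa [qFact, qInt] using h

variable (q : k)

/-- The relation `v = q` on the integral form. -/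
inductive SpecRel : integralForm k a d → integralForm k a d → Prop
  | v_eq : SpecRel ⟨_, v_mem_integralForm a d⟩ (algebraMap k _ q)

/-- The restricted specialization: the quotient of the integral form by the two-sided ideal
generated by `v - q`, that is, its base change along `k[v, v⁻¹] → k`, `v ↦ q`. -/
def Ures : Type _ := RingQuot (SpecRel a d q)

instance : Ring (Ures a d q) := inferInstanceAs (Ring (RingQuot (SpecRel a d q)))

instance : Algebra k (Ures a d q) := inferInstanceAs (Algebra k (RingQuot (SpecRel a d q)))

/-- The map from the integral form to its specialization. -/
def Ures.mk : integralForm k a d →ₐ[k] Ures a d q := RingQuot.mkAlgHom k (SpecRel a d q)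

/-- The positive part `u_q⁺` of the restricted quantized enveloping algebra, with its torus: the
subalgebra of the specialization generated by the `E i` and the `K i ^ ±1`. -/
def uqPlus : Subalgebra k (Ures a d q) :=
  Algebra.adjoin k (Set.range (fun i => Ures.mk a d q ⟨_, E_mem_integralForm a d i⟩) ∪
    Set.range (fun i => Ures.mk a d q ⟨_, K_mem_integralForm a d i⟩) ∪
    Set.range (fun i => Ures.mk a d q ⟨_, Kinv_mem_integralForm a d i⟩))

/-- The generators `E i` of `u_q⁺`. -/
def uqPlus.E (i : ι) : uqPlus a d q :=
  ⟨Ures.mk a d q ⟨_, E_mem_integralForm a d i⟩, Algebra.subset_adjoin (.inl (.inl ⟨i, rfl⟩))⟩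

/-- The generators `K i` of `u_q⁺`. -/
def uqPlus.K (i : ι) : uqPlus a d q :=
  ⟨Ures.mk a d q ⟨_, K_mem_integralForm a d i⟩, Algebra.subset_adjoin (.inl (.inr ⟨i, rfl⟩))⟩

variable (l : ℕ)

/-- The relations `K i ^ l = 1` on `u_q⁺`. -/
inductive TorsionRel : uqPlus a d q → uqPlus a d q → Prop
  | K_pow (i : ι) : TorsionRel (uqPlus.K a d q i ^ l) 1

/-- The quotient of `u_q⁺` by the two-sided ideal generated by the elements `K i ^ l - 1`. -/
def uqPlusQuot : Type _ := RingQuot (TorsionRel a d q l)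

instance : Ring (uqPlusQuot a d q l) := inferInstanceAs (Ring (RingQuot (TorsionRel a d q l)))

instance : Algebra k (uqPlusQuot a d q l) :=
  inferInstanceAs (Algebra k (RingQuot (TorsionRel a d q l)))

/-- The map from `u_q⁺` to its quotient. -/
def uqPlusQuot.mk : uqPlus a d q →ₐ[k] uqPlusQuot a d q l :=
  RingQuot.mkAlgHom k (TorsionRel a d q l)

end Restricted

end QuantumYB

end

/-! The proof has two independent halves: braidings on an abstract Hopf algebra `A`, and the
construction of the Hopf structure on the three quantum algebras.

Braidings from a projection. Let `p` be an idempotent bialgebra endomorphism and let the antipode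
`S` be bijective. The algebra `A ⊗ A` contains two copies of `A`, namely `x ⊗ 1` and `∑ p(x₍₁₎) ⊗
x₍₂₎`. Multiplying them in one order gives `∑ x p(y₍₁₎) ⊗ y₍₂₎`, in the other order `∑ p(x₍₁₎) y ⊗
x₍₂₎`, and `biproductBraidingAlg p` is precisely the operator that rewrites the second product as
the first. In `A ⊗ A ⊗ A` there are three copies of `A`, any two of which exchange in the same way.
The Yang-Baxter equation then says that reversing a product of three factors has only one outcome,
and compatibility with the product of `A` holds because each copy is embedded by an algebra map
(`isYBAlgebra_of_exchange`). Reversing all arrows gives the coalgebra statement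
(`isYBCoalgebra_of_exchange`), with the maps `x ⊗ y ↦ ε(y) x` and `x ⊗ y ↦ p(x) y`. Woronowicz's
braidings are the case `p = id`.

The single braiding. When the image of `p` is commutative and `A` is spanned by elements with a
group-like left degree `g` and right degree `h`, the third braiding is `x ⊗ y ↦ c y c⁻¹ ⊗ x` with `c
= g h⁻¹`. All axioms become identities between conjugations (`isYB_biproductBraiding`).

The Hopf structure. `IsPositivePart` isolates what is needed: generators, a few commutation
relations, and algebra maps which are the coproduct, counit, antipode and a grading by powers of
`X`. Evaluating the grading at `X = 0` yields `p`; evaluating it at `X = q²` yields the inverse of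
`S²`, so that `S` is bijective. On `U_q` the maps come from the presentation. The real work is in
the quantum Serre relations, which are iterated `q`-commutators: their coproduct is computed in
closed form, and all mixed terms vanish at the exponent `1 - a i j` (`serreIter_comul`,
`comulCoeff_eq_zero`). The maps then restrict to the subalgebra `U_q⁺`.

At a root of unity all computations are made over `k(v)`, where `v` is not a root of unity. The maps
carry divided powers into lattices, by the `q`-binomial theorem in the case of the coproduct, and
lattices can be specialized at `v = q` (`Ures.exists_algHom`). The relations `K i ^ l = 1` are
respected by all the maps, which gives the last quotient. -/

noncomputable section

namespace QuantumYB

/-! ### Exchange operators and the Yang-Baxter axioms -/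

section Exchange

variable {k : Type*} [Field k]

section Coalgebra

variable {B C : Type*} [AddCommGroup B] [Module k B] [Coalgebra k B]
  [AddCommGroup C] [Module k C]

/-- The map `b ↦ ∑ f b₍₁₎ ⊗ g b₍₂₎`. -/
def comulPair (f g : B →ₗ[k] C) : B →ₗ[k] C ⊗[k] C :=
  TensorProduct.map f g ∘ₗ Coalgebra.comul

/-- The map `b ↦ ∑ f b₍₁₎ ⊗ g b₍₂₎ ⊗ h b₍₃₎`. -/
def comulTriple (f g h : B →ₗ[k] C) : B →ₗ[k] (C ⊗[k] C) ⊗[k] C :=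
  TensorProduct.map (comulPair f g) h ∘ₗ Coalgebra.comul

/-- Coassociativity: the triple coproduct is bracketed to the left by definition, and this is the
bracketing on which `id ⊗ σ` acts. -/
theorem assoc_comp_comulTriple (f g h : B →ₗ[k] C) :
    (TensorProduct.assoc k C C C).toLinearMap ∘ₗ comulTriple f g h =
      TensorProduct.map f (comulPair g h) ∘ₗ Coalgebra.comul := by
  have h1 : comulTriple f g h = TensorProduct.map (TensorProduct.map f g) h ∘ₗ
      (Coalgebra.comul (R := k) (A := B)).rTensor B ∘ₗ Coalgebra.comul := by
    rw [comulTriple, comulPair, ← LinearMap.comp_assoc, LinearMap.rTensor, ← TensorProduct.map_comp,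
      LinearMap.comp_id]
  have h2 : TensorProduct.map f (comulPair g h) ∘ₗ Coalgebra.comul =
      TensorProduct.map f (TensorProduct.map g h) ∘ₗ
      (Coalgebra.comul (R := k) (A := B)).lTensor B ∘ₗ Coalgebra.comul := by
    rw [comulPair, ← LinearMap.comp_assoc, LinearMap.lTensor, ← TensorProduct.map_comp,
      LinearMap.comp_id]
  rw [h1, h2, ← Coalgebra.coassoc]
  simp only [← LinearMap.comp_assoc]
  congr 2
  rw [TensorProduct.map_map_comp_assoc_eq]

theorem comulTriple_eq (f g h : B →ₗ[k] C) :
    comulTriple f g h = (TensorProduct.assoc k C C C).symm.toLinearMap ∘ₗ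
      TensorProduct.map f (comulPair g h) ∘ₗ Coalgebra.comul := by
  rw [← assoc_comp_comulTriple, ← LinearMap.comp_assoc]
  simp

theorem braid₁_comp_comulTriple {σ : C ⊗[k] C →ₗ[k] C ⊗[k] C} {f g f' g' : B →ₗ[k] C}
    (hσ : σ ∘ₗ comulPair f g = comulPair f' g') (h : B →ₗ[k] C) :
    braid₁ σ ∘ₗ comulTriple f g h = comulTriple f' g' h := by
  rw [braid₁, comulTriple, comulTriple, ← LinearMap.comp_assoc, LinearMap.rTensor_comp_map, hσ]

theorem braid₂_comp_comulTriple {σ : C ⊗[k] C →ₗ[k] C ⊗[k] C} {g h g' h' : B →ₗ[k] C}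
    (hσ : σ ∘ₗ comulPair g h = comulPair g' h') (f : B →ₗ[k] C) :
    braid₂ σ ∘ₗ comulTriple f g h = comulTriple f g' h' := by
  rw [braid₂, LinearMap.comp_assoc, LinearMap.comp_assoc, assoc_comp_comulTriple, comulTriple_eq,
    ← LinearMap.comp_assoc _ _ (σ.lTensor C), LinearMap.lTensor_comp_map, hσ]

end Coalgebra

section CoalgebraCriterion

variable {B C : Type*} [AddCommGroup B] [Module k B] [Coalgebra k B]
  [AddCommGroup C] [Module k C] [Coalgebra k C]

/-- An exchange operator `σ` for three coalgebra maps `B → C` which together cover `C ⊗ C ⊗ C`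
is compatible with the coproduct of `C` and satisfies the Yang-Baxter equation. -/
theorem isYBCoalgebra_of_exchange (σ : C ⊗[k] C →ₗ[k] C ⊗[k] C) (hσ : Function.Bijective σ)
    (f g h : B →ₗc[k] C)
    (hfg : σ ∘ₗ comulPair f.toLinearMap g.toLinearMap = comulPair g.toLinearMap f.toLinearMap)
    (hfh : σ ∘ₗ comulPair f.toLinearMap h.toLinearMap = comulPair h.toLinearMap f.toLinearMap)
    (hgh : σ ∘ₗ comulPair g.toLinearMap h.toLinearMap = comulPair h.toLinearMap g.toLinearMap)
    (s2 : Function.Surjective (comulPair f.toLinearMap g.toLinearMap))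
    (s3 : Function.Surjective (comulTriple f.toLinearMap g.toLinearMap h.toLinearMap)) :
    IsYBCoalgebra σ := by
  have hom (f : B →ₗc[k] C) : Coalgebra.comul ∘ₗ f.toLinearMap =
    comulPair f.toLinearMap f.toLinearMap := f.map_comp_comul.symm
  have right (f g : B →ₗc[k] C) : (Coalgebra.comul (R := k) (A := C)).rTensor C ∘ₗ
      comulPair f.toLinearMap g.toLinearMap =
      comulTriple f.toLinearMap f.toLinearMap g.toLinearMap := by
    rw [comulTriple, ← hom, comulPair, ← LinearMap.comp_assoc, LinearMap.rTensor_comp_map]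
  have left (f g : B →ₗc[k] C) : (TensorProduct.assoc k C C C).symm.toLinearMap ∘ₗ
      (Coalgebra.comul (R := k) (A := C)).lTensor C ∘ₗ
      comulPair f.toLinearMap g.toLinearMap =
      comulTriple f.toLinearMap g.toLinearMap g.toLinearMap := by
    rw [comulTriple_eq, ← hom, comulPair, ← LinearMap.comp_assoc _ _ (LinearMap.lTensor _ _),
      LinearMap.lTensor_comp_map]
  have cl (f g : B →ₗc[k] C) : (Coalgebra.counit (R := k) (A := C)).lTensor C ∘ₗ
      comulPair f.toLinearMap g.toLinearMap =
      (TensorProduct.rid k C).symm.toLinearMap ∘ₗ f.toLinearMap := by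
    rw [comulPair, ← LinearMap.comp_assoc, LinearMap.lTensor_comp_map, g.counit_comp,
      ← LinearMap.rTensor_comp_lTensor, LinearMap.comp_assoc, Coalgebra.lTensor_counit_comp_comul]
    ext; simp
  have cr (f g : B →ₗc[k] C) : (Coalgebra.counit (R := k) (A := C)).rTensor C ∘ₗ
      comulPair f.toLinearMap g.toLinearMap =
      (TensorProduct.lid k C).symm.toLinearMap ∘ₗ g.toLinearMap := by
    rw [comulPair, ← LinearMap.comp_assoc, LinearMap.rTensor_comp_map, f.counit_comp,
      ← LinearMap.lTensor_comp_rTensor, LinearMap.comp_assoc, Coalgebra.rTensor_counit_comp_comul]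
    ext; simp
  constructor
  · refine ⟨hσ, ?_⟩
    -- On the triple `(f, g, h)` both sides of the Yang-Baxter equation produce `(h, g, f)`, by the
    -- two ways to write the reversal as three transpositions.
    rw [← LinearMap.cancel_right s3]
    simp only [LinearMap.comp_assoc]
    rw [braid₁_comp_comulTriple hfg, braid₂_comp_comulTriple hfh, braid₁_comp_comulTriple hgh,
      braid₂_comp_comulTriple hgh, braid₁_comp_comulTriple hfh, braid₂_comp_comulTriple hfg]
  -- As `f` is a coalgebra map, `Δ ⊗ id` turns the pair `(f, g)` into `(f, f, g)`; then `g` is moved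
  -- past both copies of `f`.
  · rw [← LinearMap.cancel_right s2]
    simp only [LinearMap.comp_assoc]
    rw [right, hfg, left, braid₂_comp_comulTriple hfg, braid₁_comp_comulTriple hfg]
  · rw [← LinearMap.cancel_right s2]
    simp only [LinearMap.comp_assoc]
    rw [left, hfg, right, braid₁_comp_comulTriple hfg, braid₂_comp_comulTriple hfg]
  · rw [← LinearMap.cancel_right s2]
    simp only [LinearMap.comp_assoc]
    rw [hfg, cl, cr]
    ext; simp
  · rw [← LinearMap.cancel_right s2]
    simp only [LinearMap.comp_assoc]
    rw [hfg, cl, cr]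
    ext; simp

end CoalgebraCriterion

section Algebra

variable {A B : Type*} [AddCommGroup A] [Module k A] [Ring B] [Algebra k B]

/-- The map `x ⊗ y ↦ f x * g y`. -/
def mulPair (f g : A →ₗ[k] B) : A ⊗[k] A →ₗ[k] B :=
  LinearMap.mul' k B ∘ₗ TensorProduct.map f g

/-- The map `x ⊗ y ⊗ z ↦ f x * g y * h z`. -/
def mulTriple (f g h : A →ₗ[k] B) : (A ⊗[k] A) ⊗[k] A →ₗ[k] B :=
  LinearMap.mul' k B ∘ₗ TensorProduct.map (mulPair f g) h

@[simp]
theorem mulPair_tmul (f g : A →ₗ[k] B) (x y : A) : mulPair f g (x ⊗ₜ[k] y) = f x * g y := rfl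

@[simp]
theorem mulTriple_tmul (f g h : A →ₗ[k] B) (x : A ⊗[k] A) (y : A) :
    mulTriple f g h (x ⊗ₜ[k] y) = mulPair f g x * h y := rfl

theorem mulTriple_eq (f g h : A →ₗ[k] B) :
    mulTriple f g h = LinearMap.mul' k B ∘ₗ TensorProduct.map f (mulPair g h) ∘ₗ
      (TensorProduct.assoc k A A A).toLinearMap := by
  ext x y z
  simp [mul_assoc]

theorem mulTriple_comp_braid₁ {σ : A ⊗[k] A →ₗ[k] A ⊗[k] A} {f g f' g' : A →ₗ[k] B}
    (hσ : mulPair f g ∘ₗ σ = mulPair f' g') (h : A →ₗ[k] B) :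
    mulTriple f g h ∘ₗ braid₁ σ = mulTriple f' g' h := by
  rw [braid₁, mulTriple, mulTriple, LinearMap.comp_assoc, LinearMap.map_comp_rTensor, hσ]

theorem mulTriple_comp_braid₂ {σ : A ⊗[k] A →ₗ[k] A ⊗[k] A} {g h g' h' : A →ₗ[k] B}
    (hσ : mulPair g h ∘ₗ σ = mulPair g' h') (f : A →ₗ[k] B) :
    mulTriple f g h ∘ₗ braid₂ σ = mulTriple f g' h' := by
  rw [mulTriple_eq, mulTriple_eq, ← hσ, ← LinearMap.map_comp_lTensor, braid₂]
  ext; simp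

end Algebra

section AlgebraCriterion

variable {A B : Type*} [Ring A] [Algebra k A] [Ring B] [Algebra k B]

/-- An exchange operator `σ` for three algebra maps `A → B` which together embed `A ⊗ A ⊗ A`
is compatible with the product of `A` and satisfies the Yang-Baxter equation. -/
theorem isYBAlgebra_of_exchange (σ : A ⊗[k] A →ₗ[k] A ⊗[k] A) (hσ : Function.Bijective σ)
    (f g h : A →ₐ[k] B)
    (hfg : mulPair f.toLinearMap g.toLinearMap ∘ₗ σ = mulPair g.toLinearMap f.toLinearMap)
    (hfh : mulPair f.toLinearMap h.toLinearMap ∘ₗ σ = mulPair h.toLinearMap f.toLinearMap)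
    (hgh : mulPair g.toLinearMap h.toLinearMap ∘ₗ σ = mulPair h.toLinearMap g.toLinearMap)
    (s2 : Function.Injective (mulPair f.toLinearMap g.toLinearMap))
    (s3 : Function.Injective (mulTriple f.toLinearMap g.toLinearMap h.toLinearMap)) :
    IsYBAlgebra σ := by
  have right (f g : A →ₐ[k] B) : mulPair f.toLinearMap g.toLinearMap ∘ₗ
      (LinearMap.mul' k A).rTensor A =
      mulTriple f.toLinearMap f.toLinearMap g.toLinearMap := by
    ext; simp
  have left (f g : A →ₐ[k] B) : mulPair f.toLinearMap g.toLinearMap ∘ₗ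
      (LinearMap.mul' k A).lTensor A ∘ₗ (TensorProduct.assoc k A A A).toLinearMap =
      mulTriple f.toLinearMap g.toLinearMap g.toLinearMap := by
    ext; simp [mul_assoc]
  constructor
  · refine ⟨hσ, ?_⟩
    -- Dually, both sides rewrite the product in the order `h, g, f` as one in the order `f, g, h`.
    rw [← LinearMap.cancel_left s3]
    simp only [← LinearMap.comp_assoc]
    rw [mulTriple_comp_braid₁ hfg, mulTriple_comp_braid₂ hfh, mulTriple_comp_braid₁ hgh,
      mulTriple_comp_braid₂ hgh, mulTriple_comp_braid₁ hfh, mulTriple_comp_braid₂ hfg]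
  · rw [← LinearMap.cancel_left s2, ← LinearMap.comp_assoc, hfg, right,
      ← LinearMap.comp_assoc _ _ (LinearMap.lTensor _ _), ← LinearMap.comp_assoc, left,
      ← LinearMap.comp_assoc, mulTriple_comp_braid₁ hfg, mulTriple_comp_braid₂ hfg]
  · rw [← LinearMap.cancel_left s2, ← LinearMap.comp_assoc, hfg, left,
      ← LinearMap.comp_assoc, right,
      ← LinearMap.comp_assoc, mulTriple_comp_braid₂ hfg, mulTriple_comp_braid₁ hfg]
  · intro a
    apply s2
    rw [← LinearMap.comp_apply, hfg]
    simp
  · intro a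
    apply s2
    rw [← LinearMap.comp_apply, hfg]
    simp

end AlgebraCriterion

end Exchange

/-! ### Operators twisted by the coproduct, and their inverses -/

section ConvolutionOperators

variable {k : Type*} [Field k] {A : Type*} [Ring A] [Bialgebra k A]

/-- The form of coassociativity behind the Sweedler computations below: a term in the three legs of
a double coproduct is encoded as one linear map `Φ`, which may then be evaluated on either
bracketing. -/
theorem coassoc_apply_map {M : Type*} [AddCommGroup M] [Module k M]
    (Φ : A ⊗[k] (A ⊗[k] A) →ₗ[k] M) (x : A) :
    Φ ((Coalgebra.comul (R := k) (A := A)).lTensor A (Coalgebra.comul x)) =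
      Φ (TensorProduct.assoc k A A A
        ((Coalgebra.comul (R := k) (A := A)).rTensor A (Coalgebra.comul x))) := by
  rw [Coalgebra.coassoc_apply]

/-- The operator `x ⊗ y ↦ ∑ x f(y₍₁₎) ⊗ y₍₂₎`. -/
def twistRight (f : A →ₗ[k] A) : A ⊗[k] A →ₗ[k] A ⊗[k] A :=
  (LinearMap.mul' k A ∘ₗ f.lTensor A).rTensor A ∘ₗ (TensorProduct.assoc k A A A).symm.toLinearMap ∘ₗ
    (Coalgebra.comul (R := k) (A := A)).lTensor A

/-- The operator `x ⊗ y ↦ ∑ x₍₁₎ ⊗ f(x₍₂₎) y`. -/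
def twistLeft (f : A →ₗ[k] A) : A ⊗[k] A →ₗ[k] A ⊗[k] A :=
  (LinearMap.mul' k A ∘ₗ f.rTensor A).lTensor A ∘ₗ (TensorProduct.assoc k A A A).toLinearMap ∘ₗ
    (Coalgebra.comul (R := k) (A := A)).rTensor A

/-- The operator `x ⊗ y ↦ ∑ f(x₍₁₎) y ⊗ x₍₂₎`. -/
def twistSwap (f : A →ₗ[k] A) : A ⊗[k] A →ₗ[k] A ⊗[k] A :=
  ydBraiding (LinearMap.mul' k A) (f.rTensor A ∘ₗ Coalgebra.comul (R := k) (A := A))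

/-- The operator `x ⊗ y ↦ ∑ y₍₂₎ ⊗ f(y₍₁₎) x`. -/
def twistSwapInv (f : A →ₗ[k] A) : A ⊗[k] A →ₗ[k] A ⊗[k] A :=
  (TensorProduct.comm k A A).toLinearMap ∘ₗ twistSwap f ∘ₗ (TensorProduct.comm k A A).toLinearMap

theorem twistRight_tmul (f : A →ₗ[k] A) (x y : A) :
    twistRight f (x ⊗ₜ[k] y) = (LinearMap.mulLeft k x ∘ₗ f).rTensor A (Coalgebra.comul y) := by
  simp only [twistRight, LinearMap.comp_apply, LinearMap.lTensor_tmul]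
  induction Coalgebra.comul (R := k) y with
  | zero => simp
  | tmul a b => simp
  | add a b ha hb => simp only [TensorProduct.tmul_add, map_add, ha, hb]

theorem twistLeft_tmul (f : A →ₗ[k] A) (x y : A) :
    twistLeft f (x ⊗ₜ[k] y) = (LinearMap.mulRight k y ∘ₗ f).lTensor A (Coalgebra.comul x) := by
  simp only [twistLeft, LinearMap.comp_apply, LinearMap.rTensor_tmul]
  induction Coalgebra.comul (R := k) x with
  | zero => simp
  | tmul a b => simp
  | add a b ha hb => simp only [TensorProduct.add_tmul, map_add, ha, hb]

theorem twistSwap_tmul (f : A →ₗ[k] A) (x y : A) :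
    twistSwap f (x ⊗ₜ[k] y) = (LinearMap.mulRight k y ∘ₗ f).rTensor A (Coalgebra.comul x) := by
  simp only [twistSwap, ydBraiding, LinearMap.comp_apply, LinearMap.rTensor_tmul]
  induction Coalgebra.comul (R := k) x with
  | zero => simp
  | tmul a b => simp
  | add a b ha hb => simp only [TensorProduct.add_tmul, map_add, ha, hb]

theorem rTensor_unit_counit (φ : A →ₗ[k] A) (y : A) :
    (φ ∘ₗ Algebra.linearMap k A ∘ₗ Coalgebra.counit).rTensor A (Coalgebra.comul y) =
      φ 1 ⊗ₜ[k] y := by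
  rw [LinearMap.rTensor_comp, LinearMap.rTensor_comp, LinearMap.comp_apply, LinearMap.comp_apply,
    Coalgebra.rTensor_counit_comul]
  simp

theorem lTensor_unit_counit (φ : A →ₗ[k] A) (y : A) :
    (φ ∘ₗ Algebra.linearMap k A ∘ₗ Coalgebra.counit).lTensor A (Coalgebra.comul y) =
      y ⊗ₜ[k] φ 1 := by
  rw [LinearMap.lTensor_comp, LinearMap.lTensor_comp, LinearMap.comp_apply, LinearMap.comp_apply,
    Coalgebra.lTensor_counit_comul]
  simp

/-- The composite is `x ⊗ y ↦ ∑ x g(y₍₁₎) f(y₍₂₎) ⊗ y₍₃₎`, so a convolution inverse on the correct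
side cancels it. -/
theorem twistRight_comp {f g : A →ₗ[k] A}
    (h : LinearMap.mul' k A ∘ₗ TensorProduct.map g f ∘ₗ Coalgebra.comul =
      Algebra.linearMap k A ∘ₗ Coalgebra.counit) :
    twistRight f ∘ₗ twistRight g = LinearMap.id := by
  refine TensorProduct.ext' fun x y => ?_
  let Φ : A ⊗[k] (A ⊗[k] A) →ₗ[k] A ⊗[k] A :=
    (LinearMap.mulLeft k x ∘ₗ LinearMap.mul' k A ∘ₗ TensorProduct.map g f).rTensor A ∘ₗ
      (TensorProduct.assoc k A A A).symm.toLinearMap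
  have h1 (Y : A ⊗[k] A) : twistRight f ((LinearMap.mulLeft k x ∘ₗ g).rTensor A Y) =
      Φ ((Coalgebra.comul (R := k) (A := A)).lTensor A Y) := by
    induction Y with
    | zero => simp
    | add a b ha hb => simp only [map_add, ha, hb]
    | tmul a b =>
      simp only [LinearMap.rTensor_tmul, LinearMap.lTensor_tmul, twistRight_tmul]
      induction Coalgebra.comul (R := k) b with
      | zero => simp
      | tmul a b => simp [Φ]
      | add a b ha hb => simp only [TensorProduct.tmul_add, map_add, ha, hb]
  have h2 (Y : A ⊗[k] A) : Φ (TensorProduct.assoc k A A A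
      ((Coalgebra.comul (R := k) (A := A)).rTensor A Y)) =
      (LinearMap.mulLeft k x ∘ₗ Algebra.linearMap k A ∘ₗ Coalgebra.counit).rTensor A Y := by
    rw [← h]
    simp [Φ, LinearMap.rTensor_comp]
  rw [LinearMap.comp_apply, twistRight_tmul, h1, coassoc_apply_map, h2, rTensor_unit_counit]
  simp

theorem twistLeft_comp {f g : A →ₗ[k] A}
    (h : LinearMap.mul' k A ∘ₗ TensorProduct.map f g ∘ₗ Coalgebra.comul =
      Algebra.linearMap k A ∘ₗ Coalgebra.counit) :
    twistLeft f ∘ₗ twistLeft g = LinearMap.id := by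
  refine TensorProduct.ext' fun x y => ?_
  let Φ : A ⊗[k] (A ⊗[k] A) →ₗ[k] A ⊗[k] A :=
    (LinearMap.mulRight k y ∘ₗ LinearMap.mul' k A ∘ₗ TensorProduct.map f g).lTensor A
  have h1 (Y : A ⊗[k] A) : twistLeft f ((LinearMap.mulRight k y ∘ₗ g).lTensor A Y) =
      Φ (TensorProduct.assoc k A A A ((Coalgebra.comul (R := k) (A := A)).rTensor A Y)) := by
    induction Y with
    | zero => simp
    | add a b ha hb => simp only [map_add, ha, hb]
    | tmul a b =>
      simp only [LinearMap.rTensor_tmul, LinearMap.lTensor_tmul, twistLeft_tmul]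
      induction Coalgebra.comul (R := k) a with
      | zero => simp
      | tmul a b => simp [Φ, mul_assoc]
      | add a b ha hb => simp only [TensorProduct.add_tmul, map_add, ha, hb]
  have h2 (Y : A ⊗[k] A) : Φ ((Coalgebra.comul (R := k) (A := A)).lTensor A Y) =
      (LinearMap.mulRight k y ∘ₗ Algebra.linearMap k A ∘ₗ Coalgebra.counit).lTensor A Y := by
    rw [← h]
    simp [Φ, LinearMap.lTensor_comp]
  rw [LinearMap.comp_apply, twistLeft_tmul, h1, ← coassoc_apply_map, h2, lTensor_unit_counit]
  simp

/-- The composite produces `∑ f(x₍₂₎) g(x₍₁₎) y ⊗ x₍₃₎`. The legs occur in reversed order, so the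
inverse is taken for convolution with the opposite coproduct; this is where the inverse of the
antipode enters. -/
theorem twistSwap_twist {f g : A →ₗ[k] A}
    (h : LinearMap.mul' k A ∘ₗ TensorProduct.map f g ∘ₗ (TensorProduct.comm k A A).toLinearMap ∘ₗ
      Coalgebra.comul = Algebra.linearMap k A ∘ₗ Coalgebra.counit) (x y : A) :
    twistSwap f (TensorProduct.comm k A A (twistSwap g (x ⊗ₜ[k] y))) = y ⊗ₜ[k] x := by
  let Φ : A ⊗[k] (A ⊗[k] A) →ₗ[k] A ⊗[k] A :=
    (LinearMap.mulRight k y ∘ₗ LinearMap.mul' k A ∘ₗ TensorProduct.map f g ∘ₗ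
      (TensorProduct.comm k A A).toLinearMap).rTensor A ∘ₗ
      (TensorProduct.assoc k A A A).symm.toLinearMap
  have h1 (Y : A ⊗[k] A) : twistSwap f (TensorProduct.comm k A A
      ((LinearMap.mulRight k y ∘ₗ g).rTensor A Y)) =
      Φ ((Coalgebra.comul (R := k) (A := A)).lTensor A Y) := by
    induction Y with
    | zero => simp
    | add a b ha hb => simp only [map_add, ha, hb]
    | tmul a b =>
      simp only [LinearMap.rTensor_tmul, LinearMap.lTensor_tmul, TensorProduct.comm_tmul,
        twistSwap_tmul]
      induction Coalgebra.comul (R := k) b with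
      | zero => simp
      | tmul a b => simp [Φ, mul_assoc]
      | add a b ha hb => simp only [TensorProduct.tmul_add, map_add, ha, hb]
  have h2 (Y : A ⊗[k] A) : Φ (TensorProduct.assoc k A A A
      ((Coalgebra.comul (R := k) (A := A)).rTensor A Y)) =
      (LinearMap.mulRight k y ∘ₗ Algebra.linearMap k A ∘ₗ Coalgebra.counit).rTensor A Y := by
    rw [← h]
    simp [Φ, LinearMap.rTensor_comp]
  rw [twistSwap_tmul, h1, coassoc_apply_map, h2, rTensor_unit_counit]
  simp

theorem twistSwap_bijective {f g : A →ₗ[k] A}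
    (hfg : LinearMap.mul' k A ∘ₗ TensorProduct.map f g ∘ₗ (TensorProduct.comm k A A).toLinearMap ∘ₗ
      Coalgebra.comul = Algebra.linearMap k A ∘ₗ Coalgebra.counit)
    (hgf : LinearMap.mul' k A ∘ₗ TensorProduct.map g f ∘ₗ (TensorProduct.comm k A A).toLinearMap ∘ₗ
      Coalgebra.comul = Algebra.linearMap k A ∘ₗ Coalgebra.counit) :
    Function.Bijective (twistSwap f) := by
  refine Function.bijective_iff_has_inverse.mpr ⟨twistSwapInv g, ?_, ?_⟩
  · intro x
    change (twistSwapInv g ∘ₗ twistSwap f) x = LinearMap.id (R := k) x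
    congr 1
    refine TensorProduct.ext' fun x y => ?_
    simp [twistSwapInv, twistSwap_twist hgf]
  · intro x
    change (twistSwap f ∘ₗ twistSwapInv g) x = LinearMap.id (R := k) x
    congr 1
    refine TensorProduct.ext' fun x y => ?_
    simp [twistSwapInv, twistSwap_twist hfg]

end ConvolutionOperators

/-! ### Antipodes and their inverses composed with a bialgebra endomorphism -/

section Antipode

variable {k : Type*} [Field k] {A : Type*} [Ring A] [HopfAlgebra k A] (p : A →ₐc[k] A)

/-- In the convolution algebra `p ∘ S` is a left inverse and `S ∘ p` a right inverse of `p`, so they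
agree. -/
theorem map_antipode (x : A) :
    p (HopfAlgebra.antipode k x) = HopfAlgebra.antipode k (p x) := by
  have h1 : WithConv.toConv ((p : A →ₗ[k] A) ∘ₗ HopfAlgebra.antipode k) *
      WithConv.toConv (p : A →ₗ[k] A) = 1 := by
    have := LinearMap.algHom_comp_convMul_distrib (p : A →ₐ[k] A)
      (WithConv.toConv (HopfAlgebra.antipode k (A := A))) (WithConv.toConv LinearMap.id)
    rw [LinearMap.antipode_mul_id] at this
    refine Eq.trans ?_ (Eq.trans (congrArg WithConv.toConv this.symm) ?_)
    · rfl
    · ext x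
      exact (p : A →ₐ[k] A).commutes _
  have h2 : WithConv.toConv (p : A →ₗ[k] A) *
      WithConv.toConv (HopfAlgebra.antipode k ∘ₗ (p : A →ₗ[k] A)) = 1 := by
    have := LinearMap.convMul_comp_coalgHom_distrib (WithConv.toConv LinearMap.id)
      (WithConv.toConv (HopfAlgebra.antipode k (A := A))) (p : A →ₗc[k] A)
    rw [LinearMap.id_mul_antipode] at this
    refine Eq.trans ?_ (Eq.trans (congrArg WithConv.toConv this.symm) ?_)
    · rfl
    · ext x
      simp
  have := congrArg WithConv.ofConv (left_inv_eq_right_inv h1 h2)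
  exact congrArg (fun f : A →ₗ[k] A => f x) this

theorem comul_comp_bialgHom : Coalgebra.comul ∘ₗ (p : A →ₗ[k] A) =
    TensorProduct.map (p : A →ₗ[k] A) (p : A →ₗ[k] A) ∘ₗ Coalgebra.comul :=
  (p : A →ₗc[k] A).map_comp_comul.symm

theorem counit_comp_bialgHom : Coalgebra.counit ∘ₗ (p : A →ₗ[k] A) = Coalgebra.counit (R := k) :=
  (p : A →ₗc[k] A).counit_comp

theorem conv_antipode_left :
    LinearMap.mul' k A ∘ₗ TensorProduct.map (HopfAlgebra.antipode k ∘ₗ (p : A →ₗ[k] A))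
      (p : A →ₗ[k] A) ∘ₗ Coalgebra.comul = Algebra.linearMap k A ∘ₗ Coalgebra.counit := by
  have h := congrArg (fun f => f ∘ₗ (p : A →ₗ[k] A))
    (HopfAlgebra.mul_antipode_rTensor_comul (R := k) (A := A))
  simp only [LinearMap.comp_assoc, comul_comp_bialgHom, counit_comp_bialgHom] at h
  rwa [← LinearMap.comp_assoc _ _ (LinearMap.rTensor _ _), LinearMap.rTensor_comp_map] at h

theorem conv_antipode_right :
    LinearMap.mul' k A ∘ₗ TensorProduct.map (p : A →ₗ[k] A)
      (HopfAlgebra.antipode k ∘ₗ (p : A →ₗ[k] A)) ∘ₗ Coalgebra.comul =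
      Algebra.linearMap k A ∘ₗ Coalgebra.counit := by
  have h := congrArg (fun f => f ∘ₗ (p : A →ₗ[k] A))
    (HopfAlgebra.mul_antipode_lTensor_comul (R := k) (A := A))
  simp only [LinearMap.comp_assoc, comul_comp_bialgHom, counit_comp_bialgHom] at h
  rwa [← LinearMap.comp_assoc _ _ (LinearMap.lTensor _ _), LinearMap.lTensor_comp_map] at h

/-- Applying the antimultiplicative and injective map `S` to `∑ p(x₍₂₎) T(p(x₍₁₎))`, where `T`
inverts `S`, gives the ordinary antipode identity. -/
theorem conv_antipode_symm_right {T : A →ₗ[k] A}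
    (hT : Function.LeftInverse (HopfAlgebra.antipode k) T)
    (hT' : Function.LeftInverse T (HopfAlgebra.antipode k)) :
    LinearMap.mul' k A ∘ₗ TensorProduct.map (p : A →ₗ[k] A) (T ∘ₗ (p : A →ₗ[k] A)) ∘ₗ
      (TensorProduct.comm k A A).toLinearMap ∘ₗ Coalgebra.comul =
      Algebra.linearMap k A ∘ₗ Coalgebra.counit := by
  have h := conv_antipode_right p
  have key : HopfAlgebra.antipode k ∘ₗ LinearMap.mul' k A ∘ₗ
      TensorProduct.map (p : A →ₗ[k] A) (T ∘ₗ (p : A →ₗ[k] A)) ∘ₗ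
      (TensorProduct.comm k A A).toLinearMap = LinearMap.mul' k A ∘ₗ
      TensorProduct.map (p : A →ₗ[k] A) (HopfAlgebra.antipode k ∘ₗ (p : A →ₗ[k] A)) := by
    ext x y
    simp [HopfAlgebra.antipode_mul_antidistrib, hT _]
  ext x
  apply hT'.injective
  have h1 := LinearMap.congr_fun h x
  have h2 := LinearMap.congr_fun key (Coalgebra.comul x)
  simp only [LinearMap.comp_apply] at h1 h2 ⊢
  rw [h2, h1]
  simp [Algebra.algebraMap_eq_smul_one]

theorem conv_antipode_symm_left {T : A →ₗ[k] A}
    (hT : Function.LeftInverse (HopfAlgebra.antipode k) T)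
    (hT' : Function.LeftInverse T (HopfAlgebra.antipode k)) :
    LinearMap.mul' k A ∘ₗ TensorProduct.map (T ∘ₗ (p : A →ₗ[k] A)) (p : A →ₗ[k] A) ∘ₗ
      (TensorProduct.comm k A A).toLinearMap ∘ₗ Coalgebra.comul =
      Algebra.linearMap k A ∘ₗ Coalgebra.counit := by
  have h := conv_antipode_left p
  have key : HopfAlgebra.antipode k ∘ₗ LinearMap.mul' k A ∘ₗ
      TensorProduct.map (T ∘ₗ (p : A →ₗ[k] A)) (p : A →ₗ[k] A) ∘ₗ
      (TensorProduct.comm k A A).toLinearMap = LinearMap.mul' k A ∘ₗ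
      TensorProduct.map (HopfAlgebra.antipode k ∘ₗ (p : A →ₗ[k] A)) (p : A →ₗ[k] A) := by
    ext x y
    simp [HopfAlgebra.antipode_mul_antidistrib, hT _]
  ext x
  apply hT'.injective
  have h1 := LinearMap.congr_fun h x
  have h2 := LinearMap.congr_fun key (Coalgebra.comul x)
  simp only [LinearMap.comp_apply] at h1 h2 ⊢
  rw [h2, h1]
  simp [Algebra.algebraMap_eq_smul_one]

end Antipode

/-! ### The Yang-Baxter algebra attached to a projection -/

section BiproductAlgebra

variable {k : Type*} [Field k] {A : Type*} [Ring A] [HopfAlgebra k A] (p : A →ₐc[k] A)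

theorem comul_bialgHom (x : A) : Coalgebra.comul (R := k) (p x) =
    TensorProduct.map (p : A →ₗ[k] A) (p : A →ₗ[k] A) (Coalgebra.comul x) :=
  LinearMap.congr_fun (comul_comp_bialgHom p) x

/-- The factorization that exhibits this braiding as an exchange operator: the left factor is
inverse to `twistRight p`, hence `twistRight p ∘ σ = twistSwap p`. -/
theorem biproductBraidingAlg_eq :
    biproductBraidingAlg p = twistRight (HopfAlgebra.antipode k ∘ₗ (p : A →ₗ[k] A)) ∘ₗ
      twistSwap (p : A →ₗ[k] A) := by
  refine TensorProduct.ext' fun x y => ?_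
  let Φ : A ⊗[k] (A ⊗[k] A) →ₗ[k] A ⊗[k] A :=
    (LinearMap.mul' k A ∘ₗ TensorProduct.map (LinearMap.mulRight k y ∘ₗ (p : A →ₗ[k] A))
      (HopfAlgebra.antipode k ∘ₗ (p : A →ₗ[k] A))).rTensor A ∘ₗ
      (TensorProduct.assoc k A A A).symm.toLinearMap
  have h1 (X : A ⊗[k] A) : twistRight (HopfAlgebra.antipode k ∘ₗ (p : A →ₗ[k] A))
      ((LinearMap.mulRight k y ∘ₗ (p : A →ₗ[k] A)).rTensor A X) =
      Φ ((Coalgebra.comul (R := k) (A := A)).lTensor A X) := by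
    induction X with
    | zero => simp
    | add a b ha hb => simp only [map_add, ha, hb]
    | tmul a b =>
      simp only [LinearMap.rTensor_tmul, LinearMap.lTensor_tmul, twistRight_tmul]
      induction Coalgebra.comul (R := k) b with
      | zero => simp
      | tmul a b => simp [Φ, mul_assoc]
      | add a b ha hb => simp only [TensorProduct.tmul_add, map_add, ha, hb]
  have h2 (X : A ⊗[k] A) : Φ (TensorProduct.assoc k A A A
      ((Coalgebra.comul (R := k) (A := A)).rTensor A X)) =
      (adjointAction k A).rTensor A (TensorProduct.rightComm k A A A
        ((((p : A →ₗ[k] A).rTensor A) X) ⊗ₜ[k] y)) := by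
    induction X with
    | zero => simp
    | add a b ha hb => simp only [map_add, TensorProduct.add_tmul, ha, hb]
    | tmul a b =>
      simp only [LinearMap.rTensor_tmul, adjointAction, TensorProduct.rightComm_tmul,
        LinearMap.comp_apply,
        LinearMap.coe_coe, comul_bialgHom]
      induction Coalgebra.comul (R := k) a with
      | zero => simp
      | tmul a b => simp [Φ]
      | add a b ha hb => simp only [TensorProduct.add_tmul, map_add, ha, hb]
  rw [LinearMap.comp_apply, twistSwap_tmul, h1, coassoc_apply_map, h2]
  rfl

variable {p}

/-- The algebra map `(p ⊗ id) Δ`. -/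
def leftCoaction (p : A →ₐc[k] A) : A →ₐ[k] A ⊗[k] A :=
  (Algebra.TensorProduct.map (p : A →ₐ[k] A) (AlgHom.id k A)).comp (Bialgebra.comulAlgHom k A)

theorem leftCoaction_apply (x : A) :
    leftCoaction p x = (p : A →ₗ[k] A).rTensor A (Coalgebra.comul x) := rfl

/-- This and `mulPair_leftCoaction_includeLeft` identify the products of the two copies of `A`
inside `A ⊗ A`, taken in the two orders, with the two twist operators. -/
theorem mulPair_includeLeft_leftCoaction :
    mulPair (Algebra.TensorProduct.includeLeft : A →ₐ[k] A ⊗[k] A).toLinearMap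
      (leftCoaction p).toLinearMap = twistRight (p : A →ₗ[k] A) := by
  refine TensorProduct.ext' fun x y => ?_
  rw [twistRight_tmul, mulPair_tmul, AlgHom.toLinearMap_apply, AlgHom.toLinearMap_apply,
    leftCoaction_apply]
  induction Coalgebra.comul (R := k) y with
  | zero => simp
  | tmul a b => simp
  | add a b ha hb => simp only [mul_add, map_add, ha, hb]

theorem mulPair_leftCoaction_includeLeft :
    mulPair (leftCoaction p).toLinearMap
      (Algebra.TensorProduct.includeLeft : A →ₐ[k] A ⊗[k] A).toLinearMap =
      twistSwap (p : A →ₗ[k] A) := by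
  refine TensorProduct.ext' fun x y => ?_
  rw [twistSwap_tmul, mulPair_tmul, AlgHom.toLinearMap_apply, AlgHom.toLinearMap_apply,
    leftCoaction_apply]
  induction Coalgebra.comul (R := k) x with
  | zero => simp
  | tmul a b => simp
  | add a b ha hb => simp only [add_mul, map_add, ha, hb]

theorem mulPair_comp {B C : Type*} [Ring B] [Algebra k B] [Ring C] [Algebra k C] (f g : A →ₐ[k] B)
    (G : B →ₐ[k] C) : mulPair (G.comp f).toLinearMap (G.comp g).toLinearMap =
      G.toLinearMap ∘ₗ mulPair f.toLinearMap g.toLinearMap := by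
  ext; simp

/-- Besides coassociativity this needs that `p` is idempotent: one side has `p(p(x₍₁₎))` in its
first leg where the other has `p(x₍₁₎)`. -/
theorem leftCoaction_coassoc (hp : ∀ x, p (p x) = p x) :
    ((Algebra.TensorProduct.assoc k k k A A A).toAlgHom.comp
      (Algebra.TensorProduct.map (leftCoaction p) (AlgHom.id k A))).comp (leftCoaction p) =
    (Algebra.TensorProduct.map (AlgHom.id k A) (leftCoaction p)).comp (leftCoaction p) := by
  ext x
  have h1 (X : A ⊗[k] A) : ((Algebra.TensorProduct.assoc k k k A A A).toAlgHom.comp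
      (Algebra.TensorProduct.map (leftCoaction p) (AlgHom.id k A)))
      ((p : A →ₗ[k] A).rTensor A X) =
      TensorProduct.map (p : A →ₗ[k] A) ((p : A →ₗ[k] A).rTensor A)
      (TensorProduct.assoc k A A A ((Coalgebra.comul (R := k) (A := A)).rTensor A X)) := by
    induction X with
    | zero => simp
    | add a b ha hb => simp only [map_add, ha, hb]
    | tmul a b =>
      simp only [AlgHom.comp_apply, LinearMap.rTensor_tmul, Algebra.TensorProduct.map_tmul,
        leftCoaction_apply, LinearMap.coe_coe, comul_bialgHom]
      induction Coalgebra.comul (R := k) a with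
      | zero => simp
      | tmul a b => simp [hp]
      | add a b ha hb => simp only [TensorProduct.add_tmul, map_add, ha, hb]
  have h2 (X : A ⊗[k] A) : (Algebra.TensorProduct.map (AlgHom.id k A) (leftCoaction p))
      ((p : A →ₗ[k] A).rTensor A X) =
      TensorProduct.map (p : A →ₗ[k] A) ((p : A →ₗ[k] A).rTensor A)
      ((Coalgebra.comul (R := k) (A := A)).lTensor A X) := by
    induction X with
    | zero => simp
    | add a b ha hb => simp only [map_add, ha, hb]
    | tmul a b => simp [leftCoaction_apply]
  rw [AlgHom.comp_apply, AlgHom.comp_apply _ (leftCoaction p), leftCoaction_apply, h1, h2,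
    coassoc_apply_map]

theorem map_id_includeLeft_injective : Function.Injective
    (Algebra.TensorProduct.map (AlgHom.id k A)
      (Algebra.TensorProduct.includeLeft : A →ₐ[k] A ⊗[k] A)) := by
  apply Function.LeftInverse.injective (g := (TensorProduct.rid k A).toLinearMap.lTensor A ∘ₗ
    ((Coalgebra.counit (R := k) (A := A)).lTensor A).lTensor A)
  intro x
  induction x with
  | zero => simp
  | add a b ha hb => simp only [map_add, ha, hb]
  | tmul a b => simp

/-- The three copies of `A` in `A ⊗ (A ⊗ A)` are `x ⊗ 1 ⊗ 1`, `∑ p(x₍₁₎) ⊗ x₍₂₎ ⊗ 1` and `∑ p(x₍₁₎)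
⊗ p(x₍₂₎) ⊗ x₍₃₎`. Every pair is the image of the basic pair in `A ⊗ A` under an algebra map, so the
exchange relation is proved once and transported. -/
theorem isYBAlgebra_biproductBraidingAlg (hp : ∀ x, p (p x) = p x)
    (hS : Function.Bijective (HopfAlgebra.antipode k (A := A))) :
    IsYBAlgebra (biproductBraidingAlg p) := by
  obtain ⟨T, hT⟩ : ∃ T : A →ₗ[k] A, Function.LeftInverse T (HopfAlgebra.antipode k (A := A)) ∧
      Function.RightInverse T (HopfAlgebra.antipode k (A := A)) :=
    ⟨(LinearEquiv.ofBijective _ hS).symm.toLinearMap,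
      (LinearEquiv.ofBijective _ hS).symm_apply_apply,
      (LinearEquiv.ofBijective _ hS).apply_symm_apply⟩
  have hl := twistRight_comp (conv_antipode_right p)
  have hr := twistRight_comp (conv_antipode_left p)
  have hσ : twistRight (p : A →ₗ[k] A) ∘ₗ biproductBraidingAlg p =
      twistSwap (p : A →ₗ[k] A) := by
    rw [biproductBraidingAlg_eq, ← LinearMap.comp_assoc, hr, LinearMap.id_comp]
  have hl' : Function.LeftInverse (twistRight (HopfAlgebra.antipode k ∘ₗ (p : A →ₗ[k] A)))
      (twistRight (p : A →ₗ[k] A)) := LinearMap.congr_fun hl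
  have hr' : Function.RightInverse (twistRight (HopfAlgebra.antipode k ∘ₗ (p : A →ₗ[k] A)))
      (twistRight (p : A →ₗ[k] A)) := LinearMap.congr_fun hr
  have inj : Function.Injective (twistRight (p : A →ₗ[k] A)) := hl'.injective
  have base : mulPair (Algebra.TensorProduct.includeLeft : A →ₐ[k] A ⊗[k] A).toLinearMap
      (leftCoaction p).toLinearMap ∘ₗ biproductBraidingAlg p =
      mulPair (leftCoaction p).toLinearMap
      (Algebra.TensorProduct.includeLeft : A →ₐ[k] A ⊗[k] A).toLinearMap := by
    rw [mulPair_includeLeft_leftCoaction, mulPair_leftCoaction_includeLeft, hσ]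
  have pull (G : A ⊗[k] A →ₐ[k] A ⊗[k] (A ⊗[k] A)) :
      mulPair (G.comp Algebra.TensorProduct.includeLeft).toLinearMap
      (G.comp (leftCoaction p)).toLinearMap ∘ₗ biproductBraidingAlg p =
      mulPair (G.comp (leftCoaction p)).toLinearMap
      (G.comp Algebra.TensorProduct.includeLeft).toLinearMap := by
    rw [mulPair_comp, mulPair_comp, LinearMap.comp_assoc, base]
  -- The map with indices `i`, `j` carries the two basic copies of `A` to the copies numbered `i`
  -- and `j`.
  let G₁₂ : A ⊗[k] A →ₐ[k] A ⊗[k] (A ⊗[k] A) :=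
    Algebra.TensorProduct.map (AlgHom.id k A) Algebra.TensorProduct.includeLeft
  let G₁₃ : A ⊗[k] A →ₐ[k] A ⊗[k] (A ⊗[k] A) :=
    Algebra.TensorProduct.map (AlgHom.id k A) (leftCoaction p)
  let G₂₃ : A ⊗[k] A →ₐ[k] A ⊗[k] (A ⊗[k] A) :=
    (Algebra.TensorProduct.assoc k k k A A A).toAlgHom.comp
      (Algebra.TensorProduct.map (leftCoaction p) (AlgHom.id k A))
  have e₁ : G₁₃.comp Algebra.TensorProduct.includeLeft =
      G₁₂.comp Algebra.TensorProduct.includeLeft := by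
    ext x; simp [G₁₂, G₁₃, Algebra.TensorProduct.one_def]
  have e₂ : G₂₃.comp Algebra.TensorProduct.includeLeft = G₁₂.comp (leftCoaction p) := by
    ext x
    simp only [G₂₃, G₁₂, AlgHom.comp_apply, Algebra.TensorProduct.includeLeft_apply,
      Algebra.TensorProduct.map_tmul]
    induction leftCoaction p x with
    | zero => simp
    | tmul a b => simp
    | add a b ha hb => simp only [TensorProduct.add_tmul, map_add, ha, hb]
  have e₃ : G₂₃.comp (leftCoaction p) = G₁₃.comp (leftCoaction p) := leftCoaction_coassoc hp
  refine isYBAlgebra_of_exchange _ ?_ (G₁₂.comp Algebra.TensorProduct.includeLeft)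
    (G₁₂.comp (leftCoaction p)) (G₁₃.comp (leftCoaction p)) (pull G₁₂) ?_ ?_ ?_ ?_
  -- In `twistRight p ∘ σ = twistSwap p` the first factor is invertible by the antipode and the
  -- right side by the inverse of the antipode.
  · have : Function.Bijective (twistRight (p : A →ₗ[k] A) ∘ₗ biproductBraidingAlg p) := by
      rw [hσ]
      exact twistSwap_bijective (conv_antipode_symm_right p hT.2 hT.1)
        (conv_antipode_symm_left p hT.2 hT.1)
    rw [LinearMap.coe_comp] at this
    exact (Function.Bijective.of_comp_iff' ⟨inj, hr'.surjective⟩ _).mp this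
  · rw [← e₁]; exact pull G₁₃
  · rw [← e₂, ← e₃]; exact pull G₂₃
  · rw [mulPair_comp, mulPair_includeLeft_leftCoaction]
    exact map_id_includeLeft_injective.comp inj
  -- Multiplying the last two copies first shows that the triple product is a twist of factors two
  -- and three followed by one of factors one and two; flatness over the field keeps both injective.
  · have : mulTriple (G₁₂.comp Algebra.TensorProduct.includeLeft).toLinearMap
        (G₁₂.comp (leftCoaction p)).toLinearMap (G₁₃.comp (leftCoaction p)).toLinearMap =
        (TensorProduct.assoc k A A A).toLinearMap ∘ₗ (twistRight (p : A →ₗ[k] A)).rTensor A ∘ₗ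
        (TensorProduct.assoc k A A A).symm.toLinearMap ∘ₗ
        (twistRight (p : A →ₗ[k] A)).lTensor A ∘ₗ (TensorProduct.assoc k A A A).toLinearMap := by
      rw [mulTriple_eq, ← e₂, ← e₃, mulPair_comp, mulPair_includeLeft_leftCoaction]
      refine TensorProduct.ext_threefold fun x y z => ?_
      simp only [LinearMap.comp_apply, LinearEquiv.coe_coe, TensorProduct.assoc_tmul,
        LinearMap.lTensor_tmul, TensorProduct.map_tmul]
      induction twistRight (p : A →ₗ[k] A) (y ⊗ₜ[k] z) with
      | zero => simp
      | add a b ha hb => simp only [TensorProduct.tmul_add, map_add, ha, hb]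
      | tmul u v =>
        rw [TensorProduct.assoc_symm_tmul, LinearMap.rTensor_tmul,
          ← mulPair_includeLeft_leftCoaction]
        simp only [mulPair_tmul, AlgHom.toLinearMap_apply, G₁₂, G₂₃, AlgHom.comp_apply,
          Algebra.TensorProduct.map_tmul, Algebra.TensorProduct.includeLeft_apply]
        induction leftCoaction p u with
        | zero => simp
        | tmul a b => simp
        | add a b ha hb => simp only [TensorProduct.add_tmul, TensorProduct.tmul_add,
            map_add, mul_add, ha, hb]
    rw [this]
    have i1 := Module.Flat.rTensor_preserves_injective_linearMap (M := A) _ inj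
    have i2 := Module.Flat.lTensor_preserves_injective_linearMap (M := A) _ inj
    simp only [LinearMap.coe_comp, LinearEquiv.coe_coe]
    exact (LinearEquiv.injective _).comp (i1.comp ((LinearEquiv.injective _).comp
      (i2.comp (LinearEquiv.injective _))))

end BiproductAlgebra

/-! ### The dual construction: the Yang-Baxter coalgebra attached to a projection -/

section BiproductCoalgebra

variable {k : Type*} [Field k] {A : Type*} [Ring A] [HopfAlgebra k A]

/-- The coalgebra map `id ⊗ ε`. -/
def tensorFst (C D : Type*) [AddCommGroup C] [Module k C] [Coalgebra k C] [AddCommGroup D]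
    [Module k D] [Coalgebra k D] : C ⊗[k] D →ₗc[k] C :=
  (Coalgebra.TensorProduct.rid k k C : C ⊗[k] k →ₗc[k] C).comp
    (Coalgebra.TensorProduct.map (CoalgHom.id k C) (Coalgebra.counitCoalgHom k D))

section

variable {C D : Type*} [AddCommGroup C] [Module k C] [Coalgebra k C] [AddCommGroup D]
    [Module k D] [Coalgebra k D]

theorem tensorFst_tmul (x : C) (y : D) :
    tensorFst (k := k) C D (x ⊗ₜ[k] y) = Coalgebra.counit (R := k) y • x := rfl

theorem map_tensorFst_id_comp_comul :
    TensorProduct.map (tensorFst (k := k) C D).toLinearMap LinearMap.id ∘ₗ Coalgebra.comul =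
      (TensorProduct.assoc k C C D).toLinearMap ∘ₗ (Coalgebra.comul (R := k)).rTensor D := by
  refine TensorProduct.ext' fun x y => ?_
  have h := Coalgebra.rTensor_counit_comul (R := k) y
  have h2 : y = TensorProduct.lid k D ((1 : k) ⊗ₜ y) := by simp
  simp only [LinearMap.comp_apply, TensorProduct.comul_tmul, LinearMap.rTensor_tmul]
  -- Writing the bare `y` as `∑ ε(y₍₁₎) y₍₂₎` makes both sides linear in `Δ x` and in `Δ y`, so that
  -- both can be replaced by pure tensors.
  nth_rw 2 [h2]
  rw [← h]
  induction Coalgebra.comul (R := k) x with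
  | zero => simp
  | add a b ha hb => simp only [TensorProduct.add_tmul, map_add, ha, hb]
  | tmul a b =>
    induction Coalgebra.comul (R := k) y with
    | zero => simp
    | add a b ha hb => simp only [TensorProduct.tmul_add, map_add, ha, hb]
    | tmul c d => simp [tensorFst_tmul, TensorProduct.smul_tmul, TensorProduct.tmul_smul]

theorem map_id_tensorFst_comp_comul :
    TensorProduct.map LinearMap.id (tensorFst (k := k) C D).toLinearMap ∘ₗ Coalgebra.comul =
      (TensorProduct.rightComm k C C D).toLinearMap ∘ₗ (Coalgebra.comul (R := k)).rTensor D := by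
  refine TensorProduct.ext' fun x y => ?_
  have h := Coalgebra.lTensor_counit_comul (R := k) y
  have h2 : y = TensorProduct.rid k D (y ⊗ₜ (1 : k)) := by simp
  simp only [LinearMap.comp_apply, TensorProduct.comul_tmul, LinearMap.rTensor_tmul]
  nth_rw 2 [h2]
  rw [← h]
  induction Coalgebra.comul (R := k) x with
  | zero => simp
  | add a b ha hb => simp only [TensorProduct.add_tmul, map_add, ha, hb]
  | tmul a b =>
    induction Coalgebra.comul (R := k) y with
    | zero => simp
    | add a b ha hb => simp only [TensorProduct.tmul_add, map_add, ha, hb]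
    | tmul c d => simp [tensorFst_tmul, TensorProduct.tmul_smul]

end

variable (p : A →ₐc[k] A)

/-- Applying the twists in turn gives `∑ x₍₁₎ ⊗ S(p(x₍₂₎)) y` and then `∑ p(x₍₁₎) S(p(x₍₃₎)) y ⊗
x₍₂₎`; it remains to commute `S` with `p`. Consequently `σ ∘ twistLeft p = twistSwap p`. -/
theorem biproductBraidingCoalg_eq :
    biproductBraidingCoalg p = twistSwap (p : A →ₗ[k] A) ∘ₗ
      twistLeft (HopfAlgebra.antipode k ∘ₗ (p : A →ₗ[k] A)) := by
  refine TensorProduct.ext' fun x y => ?_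
  have h1 (X : A ⊗[k] A) : twistSwap (p : A →ₗ[k] A)
      ((LinearMap.mulRight k y ∘ₗ HopfAlgebra.antipode k ∘ₗ (p : A →ₗ[k] A)).lTensor A X) =
      (LinearMap.mul' k A).rTensor A (TensorProduct.rightComm k A A A
        ((((p : A →ₗ[k] A).rTensor A)
          ((LinearMap.mul' k A ∘ₗ (HopfAlgebra.antipode k (A := A)).lTensor A).rTensor A
            (TensorProduct.rightComm k A A A
              ((Coalgebra.comul (R := k)).rTensor A X)))) ⊗ₜ y)) := by
    induction X with
    | zero => simp
    | add a b ha hb => simp only [map_add, TensorProduct.add_tmul, ha, hb]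
    | tmul a b =>
      simp only [LinearMap.rTensor_tmul, LinearMap.lTensor_tmul, twistSwap_tmul]
      induction Coalgebra.comul (R := k) a with
      | zero => simp
      | tmul a b => simp [mul_assoc, map_antipode]
      | add a b ha hb => simp only [TensorProduct.add_tmul, map_add, ha, hb]
  rw [LinearMap.comp_apply, twistLeft_tmul, h1]
  rfl

/-- The coalgebra map `x ⊗ y ↦ p x * y`. -/
def mulProj : A ⊗[k] A →ₗc[k] A :=
  (Bialgebra.mulCoalgHom k A).comp
    (Coalgebra.TensorProduct.map (p : A →ₗc[k] A) (CoalgHom.id k A))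

theorem mulProj_tmul (x y : A) : mulProj p (x ⊗ₜ[k] y) = p x * y := rfl

theorem comulPair_tensorFst_mulProj :
    comulPair (tensorFst (k := k) A A).toLinearMap (mulProj p).toLinearMap =
      twistLeft (p : A →ₗ[k] A) := by
  have : comulPair (tensorFst (k := k) A A).toLinearMap (mulProj p).toLinearMap =
      (mulProj p).toLinearMap.lTensor A ∘ₗ
      TensorProduct.map (tensorFst (k := k) A A).toLinearMap LinearMap.id ∘ₗ
        Coalgebra.comul := by
    rw [comulPair, ← LinearMap.comp_assoc, LinearMap.lTensor_comp_map, LinearMap.comp_id]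
  rw [this, map_tensorFst_id_comp_comul]
  rfl

theorem comulPair_mulProj_tensorFst :
    comulPair (mulProj p).toLinearMap (tensorFst (k := k) A A).toLinearMap =
      twistSwap (p : A →ₗ[k] A) := by
  have : comulPair (mulProj p).toLinearMap (tensorFst (k := k) A A).toLinearMap =
      (mulProj p).toLinearMap.rTensor A ∘ₗ
      TensorProduct.map LinearMap.id (tensorFst (k := k) A A).toLinearMap ∘ₗ
        Coalgebra.comul := by
    rw [comulPair, ← LinearMap.comp_assoc, LinearMap.rTensor_comp_map, LinearMap.comp_id]
  rw [this, map_id_tensorFst_comp_comul]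
  refine TensorProduct.ext' fun x y => ?_
  rw [twistSwap_tmul]
  simp only [LinearMap.comp_apply, LinearMap.rTensor_tmul]
  induction Coalgebra.comul (R := k) x with
  | zero => simp
  | add a b ha hb => simp only [TensorProduct.add_tmul, map_add, ha, hb]
  | tmul a b => simp [mulProj_tmul]

theorem comulPair_comp {B B' C : Type*} [AddCommGroup B] [Module k B] [Coalgebra k B]
    [AddCommGroup B'] [Module k B'] [Coalgebra k B'] [AddCommGroup C] [Module k C]
    [Coalgebra k C] (f g : B →ₗc[k] C) (G : B' →ₗc[k] B) :
    comulPair (f.comp G).toLinearMap (g.comp G).toLinearMap =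
      comulPair f.toLinearMap g.toLinearMap ∘ₗ G.toLinearMap := by
  rw [comulPair, comulPair, LinearMap.comp_assoc, ← G.map_comp_comul, ← LinearMap.comp_assoc,
    ← TensorProduct.map_comp]
  rfl

variable {p}

/-- The three coalgebra maps to `A` send `x ⊗ y ⊗ z` to `ε(y) ε(z) x`, to `ε(z) p(x) y` and to `p(x)
p(y) z`. Any two of them factor through the basic pair on `A ⊗ A`. -/
theorem isYBCoalgebra_biproductBraidingCoalg (hp : ∀ x, p (p x) = p x)
    (hS : Function.Bijective (HopfAlgebra.antipode k (A := A))) :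
    IsYBCoalgebra (biproductBraidingCoalg p) := by
  obtain ⟨T, hT⟩ : ∃ T : A →ₗ[k] A, Function.LeftInverse T (HopfAlgebra.antipode k (A := A)) ∧
      Function.RightInverse T (HopfAlgebra.antipode k (A := A)) :=
    ⟨(LinearEquiv.ofBijective _ hS).symm.toLinearMap,
      (LinearEquiv.ofBijective _ hS).symm_apply_apply,
      (LinearEquiv.ofBijective _ hS).apply_symm_apply⟩
  have hl := twistLeft_comp (conv_antipode_left p)
  have hr := twistLeft_comp (conv_antipode_right p)
  have hσ : biproductBraidingCoalg p ∘ₗ twistLeft (p : A →ₗ[k] A) =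
      twistSwap (p : A →ₗ[k] A) := by
    rw [biproductBraidingCoalg_eq, LinearMap.comp_assoc, hl, LinearMap.comp_id]
  have hl' : Function.LeftInverse (twistLeft (HopfAlgebra.antipode k ∘ₗ (p : A →ₗ[k] A)))
      (twistLeft (p : A →ₗ[k] A)) := LinearMap.congr_fun hl
  have hr' : Function.RightInverse (twistLeft (HopfAlgebra.antipode k ∘ₗ (p : A →ₗ[k] A)))
      (twistLeft (p : A →ₗ[k] A)) := LinearMap.congr_fun hr
  have surj : Function.Surjective (twistLeft (p : A →ₗ[k] A)) := hr'.surjective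
  have base : biproductBraidingCoalg p ∘ₗ
      comulPair (tensorFst (k := k) A A).toLinearMap (mulProj p).toLinearMap =
      comulPair (mulProj p).toLinearMap (tensorFst (k := k) A A).toLinearMap := by
    rw [comulPair_mulProj_tensorFst, comulPair_tensorFst_mulProj, hσ]
  have pull (G : A ⊗[k] (A ⊗[k] A) →ₗc[k] A ⊗[k] A) : biproductBraidingCoalg p ∘ₗ
      comulPair ((tensorFst (k := k) A A).comp G).toLinearMap ((mulProj p).comp G).toLinearMap =
      comulPair ((mulProj p).comp G).toLinearMap ((tensorFst (k := k) A A).comp G).toLinearMap := by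
    rw [comulPair_comp, comulPair_comp, ← LinearMap.comp_assoc, base]
  let G₁₂ : A ⊗[k] (A ⊗[k] A) →ₗc[k] A ⊗[k] A :=
    Coalgebra.TensorProduct.map (CoalgHom.id k A) (tensorFst A A)
  let G₁₃ : A ⊗[k] (A ⊗[k] A) →ₗc[k] A ⊗[k] A :=
    Coalgebra.TensorProduct.map (CoalgHom.id k A) (mulProj p)
  let G₂₃ : A ⊗[k] (A ⊗[k] A) →ₗc[k] A ⊗[k] A :=
    (Coalgebra.TensorProduct.map (mulProj p) (CoalgHom.id k A)).comp
      ((Coalgebra.TensorProduct.assoc k k A A A).symm : A ⊗[k] (A ⊗[k] A) →ₗc[k] (A ⊗[k] A) ⊗[k] A)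
  have G₂₃_tmul (x y z : A) : G₂₃ (x ⊗ₜ (y ⊗ₜ z)) = (p x * y) ⊗ₜ z := rfl
  have ext3 {f g : A ⊗[k] (A ⊗[k] A) →ₗc[k] A}
      (h : ∀ x y z, f (x ⊗ₜ (y ⊗ₜ z)) = g (x ⊗ₜ (y ⊗ₜ z))) : f = g := by
    have : f.toLinearMap = g.toLinearMap := by
      ext x y z
      exact h x y z
    ext x
    exact LinearMap.congr_fun this x
  have e₁ : (tensorFst A A).comp G₁₃ = (tensorFst A A).comp G₁₂ := by
    refine ext3 fun x y z => ?_
    simp only [G₁₃, G₁₂, CoalgHom.comp_apply, Coalgebra.TensorProduct.map_tmul, tensorFst_tmul,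
      mulProj_tmul, map_smul, Bialgebra.counit_mul, CoalgHomClass.counit_comp_apply, smul_eq_mul]
    rw [mul_comm]
  have e₂ : (tensorFst A A).comp G₂₃ = (mulProj p).comp G₁₂ := by
    refine ext3 fun x y z => ?_
    simp only [G₁₂, CoalgHom.comp_apply, G₂₃_tmul, Coalgebra.TensorProduct.map_tmul,
      tensorFst_tmul, mulProj_tmul]
    simp
  -- Here idempotence enters: `p(p(x) y) z = p(x) p(y) z`.
  have e₃ : (mulProj p).comp G₂₃ = (mulProj p).comp G₁₃ := by
    refine ext3 fun x y z => ?_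
    simp only [G₁₃, CoalgHom.comp_apply, G₂₃_tmul, Coalgebra.TensorProduct.map_tmul,
      mulProj_tmul]
    simp [hp, mul_assoc]
  refine isYBCoalgebra_of_exchange _ ?_ ((tensorFst A A).comp G₁₂) ((mulProj p).comp G₁₂)
    ((mulProj p).comp G₁₃) (pull G₁₂) ?_ ?_ ?_ ?_
  · have : Function.Bijective (biproductBraidingCoalg p ∘ₗ twistLeft (p : A →ₗ[k] A)) := by
      rw [hσ]
      exact twistSwap_bijective (conv_antipode_symm_right p hT.2 hT.1)
        (conv_antipode_symm_left p hT.2 hT.1)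
    rw [LinearMap.coe_comp] at this
    exact (Function.Bijective.of_comp_iff _ ⟨hl'.injective, surj⟩).mp this
  · rw [← e₁]; exact pull G₁₃
  · rw [← e₂, ← e₃]; exact pull G₂₃
  · rw [comulPair_comp, comulPair_tensorFst_mulProj, LinearMap.coe_comp]
    -- The coalgebra map `G₁₂` discards the last factor by the counit, and inserting `1` there
    -- splits it.
    refine surj.comp (Function.LeftInverse.surjective
      (g := LinearMap.lTensor A ((TensorProduct.mk k A A).flip 1)) fun x => ?_)
    induction x with
    | zero => simp
    | add a b ha hb => simp only [map_add, ha, hb]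
    | tmul a b => simp [G₁₂, tensorFst_tmul]
  -- The triple is a composite of two twists on adjacent factors, so it inherits surjectivity from
  -- `twistLeft p`.
  · have : comulTriple ((tensorFst A A).comp G₁₂).toLinearMap ((mulProj p).comp G₁₂).toLinearMap
        ((mulProj p).comp G₁₃).toLinearMap =
        (TensorProduct.assoc k A A A).symm.toLinearMap ∘ₗ (twistLeft (p : A →ₗ[k] A)).lTensor A ∘ₗ
        (TensorProduct.assoc k A A A).toLinearMap ∘ₗ (twistLeft (p : A →ₗ[k] A)).rTensor A ∘ₗ
        (TensorProduct.assoc k A A A).symm.toLinearMap := by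
      have h1 : (tensorFst A A).comp G₁₂ = tensorFst A (A ⊗[k] A) := by
        refine ext3 fun x y z => ?_
        simp only [G₁₂, CoalgHom.comp_apply, Coalgebra.TensorProduct.map_tmul, tensorFst_tmul]
        simp [mul_comm]
      have h2 : TensorProduct.map (tensorFst (k := k) A (A ⊗[k] A)).toLinearMap G₂₃.toLinearMap ∘ₗ
          Coalgebra.comul = G₂₃.toLinearMap.lTensor A ∘ₗ
          TensorProduct.map (tensorFst (k := k) A (A ⊗[k] A)).toLinearMap LinearMap.id ∘ₗ
            Coalgebra.comul := by
        rw [← LinearMap.comp_assoc, LinearMap.lTensor_comp_map, LinearMap.comp_id]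
      rw [comulTriple_eq, ← e₂, ← e₃, comulPair_comp, comulPair_tensorFst_mulProj, h1,
        ← LinearMap.lTensor_comp_map, LinearMap.comp_assoc, h2, map_tensorFst_id_comp_comul]
      congr 2
      refine TensorProduct.ext' fun x w => ?_
      simp only [LinearMap.comp_apply, LinearMap.rTensor_tmul, LinearEquiv.coe_coe]
      induction w with
      | zero => simp
      | add a b ha hb => simp only [TensorProduct.tmul_add, map_add, ha, hb]
      | tmul y z =>
        rw [TensorProduct.assoc_symm_tmul, LinearMap.rTensor_tmul, twistLeft_tmul]
        induction Coalgebra.comul (R := k) x with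
        | zero => simp
        | add a b ha hb => simp only [TensorProduct.add_tmul, map_add, ha, hb]
        | tmul a b =>
          simp only [TensorProduct.assoc_tmul, LinearMap.lTensor_tmul]
          rfl
    rw [this]
    have i1 := LinearMap.rTensor_surjective A surj
    have i2 := LinearMap.lTensor_surjective A surj
    simp only [LinearMap.coe_comp, LinearEquiv.coe_coe]
    exact (LinearEquiv.surjective _).comp (i2.comp ((LinearEquiv.surjective _).comp
      (i1.comp (LinearEquiv.surjective _))))

end BiproductCoalgebra

/-! ### The braiding by conjugation on bihomogeneous elements -/

section Homogeneous

variable {k : Type*} [Field k] {A : Type*} [Ring A] [HopfAlgebra k A] (p : A →ₐc[k] A)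

/-- The left and the right coaction of the image of `p` on `x` are through the group-like
elements `g` and `h`. -/
structure IsBihomogeneous (g h : GroupLike k A) (x : A) : Prop where
  map_left : p g = g
  map_right : p h = h
  left : (p : A →ₗ[k] A).rTensor A (Coalgebra.comul x) = (g : A) ⊗ₜ[k] x
  right : (p : A →ₗ[k] A).lTensor A (Coalgebra.comul x) = x ⊗ₜ[k] (h : A)

/-- The element `x` is bihomogeneous, and its coproduct is a sum of tensor products of
bihomogeneous elements. -/
structure IsHomogeneous (g h : GroupLike k A) (x : A) : Prop extends IsBihomogeneous p g h x where
  comul_mem : Coalgebra.comul (R := k) x ∈ Submodule.span k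
    {w | ∃ (m : GroupLike k A) (y z : A),
      IsBihomogeneous p g m y ∧ IsBihomogeneous p m h z ∧ w = y ⊗ₜ[k] z}

variable {p}

theorem IsBihomogeneous.mul {g h g' h' : GroupLike k A} {x x' : A} (hx : IsBihomogeneous p g h x)
    (hx' : IsBihomogeneous p g' h' x') : IsBihomogeneous p (g * g') (h * h') (x * x') where
  map_left := by simp [hx.map_left, hx'.map_left]
  map_right := by simp [hx.map_right, hx'.map_right]
  left := by
    have key (X : A ⊗[k] A) : (p : A →ₗ[k] A).rTensor A X =
      Algebra.TensorProduct.map (p : A →ₐ[k] A) (AlgHom.id k A) X := rfl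
    have h1 := hx.left
    have h2 := hx'.left
    rw [key] at h1 h2 ⊢
    rw [Bialgebra.comul_mul, map_mul, h1, h2]
    simp
  right := by
    have key (X : A ⊗[k] A) : (p : A →ₗ[k] A).lTensor A X =
      Algebra.TensorProduct.map (AlgHom.id k A) (p : A →ₐ[k] A) X := rfl
    have h1 := hx.right
    have h2 := hx'.right
    rw [key] at h1 h2 ⊢
    rw [Bialgebra.comul_mul, map_mul, h1, h2]
    simp

theorem IsHomogeneous.mul {g h g' h' : GroupLike k A} {x x' : A} (hx : IsHomogeneous p g h x)
    (hx' : IsHomogeneous p g' h' x') : IsHomogeneous p (g * g') (h * h') (x * x') where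
  toIsBihomogeneous := hx.toIsBihomogeneous.mul hx'.toIsBihomogeneous
  comul_mem := by
    rw [Bialgebra.comul_mul]
    have := Submodule.mul_mem_mul hx.comul_mem hx'.comul_mem
    rw [Submodule.span_mul_span] at this
    refine Submodule.span_mono ?_ this
    rintro _ ⟨_, ⟨m, y, z, hy, hz, rfl⟩, _, ⟨m', y', z', hy', hz', rfl⟩, rfl⟩
    exact ⟨m * m', y * y', z * z', hy.mul hy', hz.mul hz', by simp⟩

theorem isBihomogeneous_groupLike {g : GroupLike k A} (hg : p g = g) :
    IsBihomogeneous p g g (g : A) where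
  map_left := hg
  map_right := hg
  left := by simp [hg]
  right := by simp [hg]

theorem isHomogeneous_groupLike {g : GroupLike k A} (hg : p g = g) :
    IsHomogeneous p g g (g : A) where
  toIsBihomogeneous := isBihomogeneous_groupLike hg
  comul_mem := by
    refine Submodule.subset_span ⟨g, g, g, isBihomogeneous_groupLike hg,
      isBihomogeneous_groupLike hg, ?_⟩
    simp

theorem isHomogeneous_one : IsHomogeneous p (1 : GroupLike k A) 1 (1 : A) := by
  simpa using isHomogeneous_groupLike (p := p) (g := (1 : GroupLike k A)) (by simp)

theorem map_inv_groupLike {g : GroupLike k A} (hg : p g = g) :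
    p ((g⁻¹ : GroupLike k A) : A) = (g⁻¹ : GroupLike k A) := by
  simp [map_antipode, hg]

/-- Since `p` annihilates `x`, exactly one of the two terms of `Δ x` survives in either coaction,
which gives the left degree `g` and the right degree `1`. -/
theorem isHomogeneous_primitive {g : GroupLike k A} (hg : p g = g) {x : A} (hx : p x = 0)
    (hΔ : Coalgebra.comul (R := k) x = x ⊗ₜ[k] 1 + (g : A) ⊗ₜ[k] x) : IsHomogeneous p g 1 x := by
  have hb : IsBihomogeneous p g 1 x :=
    { map_left := hg
      map_right := by simp
      left := by simp [hΔ, hx, hg]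
      right := by simp [hΔ, hx] }
  refine ⟨hb, ?_⟩
  rw [hΔ]
  refine add_mem (Submodule.subset_span ⟨1, x, 1, hb, isHomogeneous_one.toIsBihomogeneous, rfl⟩)
    (Submodule.subset_span ⟨g, g, x, isBihomogeneous_groupLike hg, hb, rfl⟩)

/-- Conjugation by a group-like element. -/
def groupLikeConj (c : GroupLike k A) : A →ₐ[k] A :=
  AlgHom.ofLinearMap (LinearMap.mulLeft k (c : A) ∘ₗ
    LinearMap.mulRight k ((c⁻¹ : GroupLike k A) : A))
    (by simp) (fun x y => by
      have h := c.2.antipode_mul_cancel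
      simp only [LinearMap.comp_apply, LinearMap.mulLeft_apply, LinearMap.mulRight_apply,
        GroupLike.val_inv]
      have : ∀ z, HopfAlgebra.antipode k (c : A) * ((c : A) * z) = z := fun z => by
        rw [← mul_assoc, h, one_mul]
      simp only [mul_assoc, this])

theorem groupLikeConj_apply (c : GroupLike k A) (x : A) :
    groupLikeConj c x = c * (x * ((c⁻¹ : GroupLike k A) : A)) := rfl

theorem groupLikeConj_mul (c d : GroupLike k A) (x : A) :
    groupLikeConj (c * d) x = groupLikeConj c (groupLikeConj d x) := by
  simp only [groupLikeConj_apply, mul_inv_rev, GroupLike.val_mul, mul_assoc]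

theorem groupLikeConj_one (x : A) : groupLikeConj (1 : GroupLike k A) x = x := by
  simp [groupLikeConj_apply]

theorem counit_groupLikeConj (c : GroupLike k A) (x : A) :
    Coalgebra.counit (R := k) (groupLikeConj c x) = Coalgebra.counit (R := k) x := by
  simp [groupLikeConj_apply]

theorem comul_groupLikeConj (c : GroupLike k A) (x : A) :
    Coalgebra.comul (R := k) (groupLikeConj c x) =
      TensorProduct.map (groupLikeConj c).toLinearMap (groupLikeConj c).toLinearMap
        (Coalgebra.comul x) := by
  rw [groupLikeConj_apply, Bialgebra.comul_mul, Bialgebra.comul_mul, c.2.comul_eq_tmul_self,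
    (c⁻¹).2.comul_eq_tmul_self]
  induction Coalgebra.comul (R := k) x with
  | zero => simp
  | add a b ha hb => simp only [map_add, mul_add, add_mul, ha, hb]
  | tmul a b => simp [groupLikeConj_apply]

theorem groupLike_comm (hcomm : ∀ x y, p x * p y = p y * p x) {c d : GroupLike k A}
    (hc : p c = c) (hd : p d = d) : c * d = d * c := by
  ext
  rw [GroupLike.val_mul, GroupLike.val_mul, ← hc, ← hd, hcomm]

/-- Conjugation by `c` changes a degree `g` into `c g c⁻¹`, which is `g` because the image of `p` is
commutative. -/
theorem IsBihomogeneous.conj (hcomm : ∀ x y, p x * p y = p y * p x) {g h c : GroupLike k A} {x : A}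
    (hx : IsBihomogeneous p g h x) (hc : p c = c) :
    IsBihomogeneous p g h (groupLikeConj c x) := by
  have := (isBihomogeneous_groupLike hc).mul
    (hx.mul (isBihomogeneous_groupLike (map_inv_groupLike hc)))
  have e (a : GroupLike k A) (ha : p a = a) : c * (a * c⁻¹) = a := by
    rw [groupLike_comm hcomm ha (map_inv_groupLike hc), mul_inv_cancel_left]
  rwa [e g hx.map_left, e h hx.map_right] at this

/-- After `p` is applied, `∑ x₍₁₎ S(x₍₃₎) ⊗ x₍₂₎` depends only on the left and right coactions of
`x` and becomes `g S(h) ⊗ x`. The extra map `φ` is the identity for the braiding and the antipode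
for its inverse. -/
theorem ydBraiding_adjointAction (φ : A →ₗ[k] A) {g h : GroupLike k A} {x : A}
    (hx : IsBihomogeneous p g h x) {c : GroupLike k A}
    (hc : φ ((g : A) * HopfAlgebra.antipode k (h : A)) = c) (y : A) :
    ydBraiding (adjointAction k A) ((φ ∘ₗ (p : A →ₗ[k] A)).rTensor A ∘ₗ adjointCoaction k A)
      (x ⊗ₜ[k] y) = groupLikeConj c y ⊗ₜ[k] x := by
  have h1 (X : A ⊗[k] A) : (p : A →ₗ[k] A).rTensor A
      ((LinearMap.mul' k A ∘ₗ (HopfAlgebra.antipode k (A := A)).lTensor A).rTensor A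
        (TensorProduct.rightComm k A A A ((Coalgebra.comul (R := k)).rTensor A X))) =
      (LinearMap.mul' k A ∘ₗ (HopfAlgebra.antipode k (A := A)).lTensor A).rTensor A
        (TensorProduct.rightComm k A A A (((p : A →ₗ[k] A).rTensor A ∘ₗ
          Coalgebra.comul (R := k)).rTensor A ((p : A →ₗ[k] A).lTensor A X))) := by
    induction X with
    | zero => simp
    | add a b ha hb => simp only [map_add, ha, hb]
    | tmul a b =>
      simp only [LinearMap.rTensor_tmul, LinearMap.lTensor_tmul, LinearMap.comp_apply]
      induction Coalgebra.comul (R := k) a with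
      | zero => simp
      | add a b ha hb => simp only [TensorProduct.add_tmul, map_add, ha, hb]
      | tmul a b => simp [map_antipode]
  have h2 : (p : A →ₗ[k] A).rTensor A (adjointCoaction k A x) =
      ((g : A) * HopfAlgebra.antipode k (h : A)) ⊗ₜ[k] x := by
    change (p : A →ₗ[k] A).rTensor A
      ((LinearMap.mul' k A ∘ₗ (HopfAlgebra.antipode k (A := A)).lTensor A).rTensor A
        (TensorProduct.rightComm k A A A ((Coalgebra.comul (R := k)).rTensor A
          (Coalgebra.comul x)))) = _
    rw [h1, hx.right]
    simp [hx.left]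
  rw [ydBraiding, LinearMap.comp_apply, LinearMap.comp_apply, LinearMap.rTensor_tmul,
    LinearMap.comp_apply, LinearMap.rTensor_comp, LinearMap.comp_apply, h2]
  simp [adjointAction, hc, groupLikeConj_apply, mul_assoc]

theorem biproductBraiding_tmul {g h : GroupLike k A} {x : A}
    (hx : IsBihomogeneous p g h x) (y : A) :
    biproductBraiding p (x ⊗ₜ[k] y) = groupLikeConj (g * h⁻¹) y ⊗ₜ[k] x :=
  ydBraiding_adjointAction LinearMap.id hx (by simp) y

/-- The inverse of `biproductBraiding p`. -/
def biproductBraidingInv (p : A →ₐc[k] A) : A ⊗[k] A →ₗ[k] A ⊗[k] A :=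
  (TensorProduct.comm k A A).toLinearMap ∘ₗ
    ydBraiding (adjointAction k A)
      ((HopfAlgebra.antipode k ∘ₗ (p : A →ₗ[k] A)).rTensor A ∘ₗ adjointCoaction k A) ∘ₗ
    (TensorProduct.comm k A A).toLinearMap

theorem biproductBraidingInv_tmul {g h : GroupLike k A} {x : A}
    (hx : IsBihomogeneous p g h x) (y : A) :
    biproductBraidingInv p (y ⊗ₜ[k] x) = x ⊗ₜ[k] groupLikeConj (g * h⁻¹)⁻¹ y := by
  simp only [biproductBraidingInv, LinearMap.comp_apply, LinearEquiv.coe_coe,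
    TensorProduct.comm_tmul]
  rw [ydBraiding_adjointAction (c := (g * h⁻¹)⁻¹) _ hx, TensorProduct.comm_tmul]
  rw [GroupLike.val_inv, GroupLike.val_mul, GroupLike.val_inv]

theorem IsBihomogeneous.map_degree {g h : GroupLike k A} {x : A} (hx : IsBihomogeneous p g h x) :
    p ((g * h⁻¹ : GroupLike k A) : A) = (g * h⁻¹ : GroupLike k A) := by
  rw [GroupLike.val_mul, map_mul, hx.map_left, map_inv_groupLike hx.map_right]

/-- Applying the counit to either coaction gives `p(x) = ε(x) g` and `p(x) = ε(x) h`. This is what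
makes the conjugation trivial in the counit axiom. -/
theorem IsBihomogeneous.degree_eq_one {g h : GroupLike k A} {x : A}
    (hx : IsBihomogeneous p g h x) (h0 : Coalgebra.counit (R := k) x ≠ 0) : g * h⁻¹ = 1 := by
  have h1 : p x = Coalgebra.counit (R := k) x • (g : A) := by
    have key (X : A ⊗[k] A) : TensorProduct.rid k A ((Coalgebra.counit (R := k)).lTensor A
        ((p : A →ₗ[k] A).rTensor A X)) =
        p (TensorProduct.rid k A ((Coalgebra.counit (R := k)).lTensor A X)) := by
      induction X with
      | zero => simp
      | add a b ha hb => simp only [map_add, ha, hb]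
      | tmul a b => simp
    have := key (Coalgebra.comul x)
    rw [hx.left, Coalgebra.lTensor_counit_comul] at this
    simpa using this.symm
  have h2 : p x = Coalgebra.counit (R := k) x • (h : A) := by
    have key (X : A ⊗[k] A) : TensorProduct.lid k A ((Coalgebra.counit (R := k)).rTensor A
        ((p : A →ₗ[k] A).lTensor A X)) =
        p (TensorProduct.lid k A ((Coalgebra.counit (R := k)).rTensor A X)) := by
      induction X with
      | zero => simp
      | add a b ha hb => simp only [map_add, ha, hb]
      | tmul a b => simp
    have := key (Coalgebra.comul x)
    rw [hx.right, Coalgebra.rTensor_counit_comul] at this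
    simpa using this.symm
  rw [mul_inv_eq_one]
  ext
  exact smul_right_injective A h0 (h1.symm.trans h2)

section Spanning

variable {M : Type*} [AddCommGroup M] [Module k M]

theorem ext_of_span {s : Set A} (hs : Submodule.span k s = ⊤) {f g : A ⊗[k] A →ₗ[k] M}
    (h : ∀ x ∈ s, ∀ y ∈ s, f (x ⊗ₜ y) = g (x ⊗ₜ y)) : f = g := by
  refine TensorProduct.ext (LinearMap.ext_on hs fun x hx => LinearMap.ext_on hs fun y hy => ?_)
  exact h x hx y hy

theorem ext_threefold_of_span {s : Set A} (hs : Submodule.span k s = ⊤)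
    {f g : (A ⊗[k] A) ⊗[k] A →ₗ[k] M}
    (h : ∀ x ∈ s, ∀ y ∈ s, ∀ z ∈ s, f ((x ⊗ₜ y) ⊗ₜ z) = g ((x ⊗ₜ y) ⊗ₜ z)) : f = g := by
  refine TensorProduct.ext (ext_of_span hs fun x hx y hy => LinearMap.ext_on hs fun z hz => ?_)
  exact h x hx y hy z hz

end Spanning

/-- On homogeneous `x` the braiding conjugates the other factor by the degree `g h⁻¹`. Degrees
multiply under products, telescope under coproducts and are invariant under conjugation, and they
commute with each other. -/
theorem isYB_biproductBraiding (hcomm : ∀ x y, p x * p y = p y * p x)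
    (hs : Submodule.span k {x : A | ∃ g h, IsHomogeneous p g h x} = ⊤) :
    IsYBAlgebra (biproductBraiding p) ∧ IsYBCoalgebra (biproductBraiding p) := by
  have bij : Function.Bijective (biproductBraiding p) := by
    refine Function.bijective_iff_has_inverse.mpr ⟨biproductBraidingInv p,
      LinearMap.congr_fun (f := biproductBraidingInv p ∘ₗ biproductBraiding p)
        (g := LinearMap.id) (ext_of_span hs ?_),
      LinearMap.congr_fun (f := biproductBraiding p ∘ₗ biproductBraidingInv p)
        (g := LinearMap.id) (ext_of_span hs ?_)⟩
    · rintro x ⟨g, h, hx⟩ y -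
      rw [LinearMap.comp_apply, biproductBraiding_tmul hx.toIsBihomogeneous,
        biproductBraidingInv_tmul hx.toIsBihomogeneous, ← groupLikeConj_mul, inv_mul_cancel,
        groupLikeConj_one]
      rfl
    · rintro y - x ⟨g, h, hx⟩
      rw [LinearMap.comp_apply, biproductBraidingInv_tmul hx.toIsBihomogeneous,
        biproductBraiding_tmul hx.toIsBihomogeneous, ← groupLikeConj_mul, mul_inv_cancel,
        groupLikeConj_one]
      rfl
  have b₁ {g h : GroupLike k A} {x : A} (hx : IsBihomogeneous p g h x) (y z : A) :
      braid₁ (biproductBraiding p) ((x ⊗ₜ y) ⊗ₜ z) =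
        (groupLikeConj (g * h⁻¹) y ⊗ₜ x) ⊗ₜ z := by
    rw [braid₁, LinearMap.rTensor_tmul, biproductBraiding_tmul hx]
  have b₂ {g h : GroupLike k A} {x : A} (hx : IsBihomogeneous p g h x) (y z : A) :
      braid₂ (biproductBraiding p) ((z ⊗ₜ x) ⊗ₜ y) =
        (z ⊗ₜ groupLikeConj (g * h⁻¹) y) ⊗ₜ x := by
    simp [braid₂, biproductBraiding_tmul hx]
  have braiding : IsBraiding (biproductBraiding p) := by
    refine ⟨bij, ext_threefold_of_span hs ?_⟩
    rintro x ⟨g, h, hx⟩ y ⟨g', h', hy⟩ z -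
    have hx := hx.toIsBihomogeneous
    have hy := hy.toIsBihomogeneous
    simp only [LinearMap.comp_apply]
    rw [b₁ hx, b₂ hx, b₁ (hy.conj hcomm hx.map_degree), b₂ hy, b₁ hx, b₂ hx, ← groupLikeConj_mul,
      ← groupLikeConj_mul, groupLike_comm hcomm hx.map_degree hy.map_degree]
  refine ⟨⟨braiding, ?_, ?_, ?_, ?_⟩, ⟨braiding, ?_, ?_, ?_, ?_⟩⟩
  · refine ext_threefold_of_span hs ?_
    rintro x ⟨g, h, hx⟩ y ⟨g', h', hy⟩ z -
    have hx := hx.toIsBihomogeneous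
    have hy := hy.toIsBihomogeneous
    have e : g * g' * (h * h')⁻¹ = g * h⁻¹ * (g' * h'⁻¹) := by
      rw [mul_inv_rev, mul_assoc, ← mul_assoc g' , mul_assoc g,
        ← groupLike_comm hcomm hy.map_degree (map_inv_groupLike hx.map_right)]
    simp only [LinearMap.comp_apply, LinearMap.rTensor_tmul, LinearMap.mul'_apply]
    rw [biproductBraiding_tmul (hx.mul hy), b₂ hy, b₁ hx, e, groupLikeConj_mul]
    simp
  · refine ext_threefold_of_span hs ?_
    rintro x ⟨g, h, hx⟩ y - z -
    have hx := hx.toIsBihomogeneous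
    simp only [LinearMap.comp_apply]
    rw [b₁ hx, b₂ hx]
    simp [biproductBraiding_tmul hx]
  · intro a
    rw [biproductBraiding_tmul (isHomogeneous_one (p := p)).toIsBihomogeneous]
    simp [groupLikeConj_one]
  · intro a
    have : biproductBraiding p ∘ₗ (TensorProduct.mk k A A).flip 1 = TensorProduct.mk k A A 1 := by
      refine LinearMap.ext_on hs ?_
      rintro x ⟨g, h, hx⟩
      simp [biproductBraiding_tmul hx.toIsBihomogeneous]
    exact LinearMap.congr_fun this a
  · refine ext_of_span hs ?_
    rintro x ⟨g, h, hx⟩ w -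
    simp only [LinearMap.comp_apply, LinearMap.rTensor_tmul]
    rw [biproductBraiding_tmul hx.toIsBihomogeneous, LinearMap.lTensor_tmul]
    refine Submodule.span_induction (p := fun X _ => (braid₁ (biproductBraiding p))
      ((braid₂ (biproductBraiding p)) (X ⊗ₜ[k] w)) = (TensorProduct.assoc k A A A).symm
      (groupLikeConj (g * h⁻¹) w ⊗ₜ[k] X)) ?_ (by simp) ?_ ?_ hx.comul_mem
    · rintro _ ⟨m, y, z, hy, hz, rfl⟩
      -- The factors of the coproduct have degrees `g m⁻¹` and `m h⁻¹`, with product the degree `g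
      -- h⁻¹` of `x`.
      rw [b₂ hz, b₁ hy, ← groupLikeConj_mul]
      simp
    · intro X Y _ _ hX hY
      simp only [TensorProduct.add_tmul, TensorProduct.tmul_add, map_add, hX, hY]
    · intro a X _ hX
      simp only [TensorProduct.tmul_smul, ← TensorProduct.smul_tmul', map_smul, hX]
  · refine ext_of_span hs ?_
    rintro x ⟨g, h, hx⟩ w -
    simp only [LinearMap.comp_apply, LinearMap.lTensor_tmul]
    rw [biproductBraiding_tmul hx.toIsBihomogeneous, LinearMap.rTensor_tmul, comul_groupLikeConj]
    induction Coalgebra.comul (R := k) w with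
    | zero => simp
    | add a b ha hb => simp only [TensorProduct.add_tmul, TensorProduct.tmul_add, map_add, ha, hb]
    | tmul a b =>
      rw [LinearEquiv.coe_coe, TensorProduct.assoc_symm_tmul, b₁ hx.toIsBihomogeneous,
        b₂ hx.toIsBihomogeneous]
      rfl
  · refine ext_of_span hs ?_
    rintro x ⟨g, h, hx⟩ w -
    simp only [LinearMap.comp_apply, LinearMap.rTensor_tmul]
    rw [biproductBraiding_tmul hx.toIsBihomogeneous]
    by_cases h0 : Coalgebra.counit (R := k) x = 0
    · simp [h0]
    · simp [hx.toIsBihomogeneous.degree_eq_one h0, groupLikeConj_one]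
  · refine ext_of_span hs ?_
    rintro x ⟨g, h, hx⟩ w -
    simp only [LinearMap.comp_apply, LinearMap.lTensor_tmul]
    rw [biproductBraiding_tmul hx.toIsBihomogeneous]
    simp [counit_groupLikeConj]

end Homogeneous

/-! ### Hopf algebra, projection and braidings of an abstract positive part -/

section Positive

/-- The algebra `A` is generated by the `E i` and the `K i ^ ±1`, which have commutation relations
as in the positive part of a quantum group, and it admits algebra maps which are the standard
coproduct, counit and antipode and a grading with the `E i` in degree `d i`. -/
structure IsPositivePart {k : Type*} [Field k] {A : Type*} [Ring A] [Algebra k A] {ι : Type*}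
    (q : k) (d : ι → ℕ) (E K Kinv : ι → A) : Prop where
  K_mul_Kinv : ∀ i, K i * Kinv i = 1
  Kinv_mul_K : ∀ i, Kinv i * K i = 1
  K_comm : ∀ i j, K i * K j = K j * K i
  K_E : ∀ i, K i * E i = (q ^ 2) ^ d i • (E i * K i)
  adjoin : Algebra.adjoin k (Set.range E ∪ Set.range K ∪ Set.range Kinv) = ⊤
  comul : ∃ Δ : A →ₐ[k] A ⊗[k] A, (∀ i, Δ (E i) = E i ⊗ₜ 1 + K i ⊗ₜ E i) ∧
    ∀ i, Δ (K i) = K i ⊗ₜ K i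
  counit : ∃ ε : A →ₐ[k] k, (∀ i, ε (E i) = 0) ∧ ∀ i, ε (K i) = 1
  antipode : ∃ S : A →ₐ[k] Aᵐᵒᵖ, (∀ i, S (E i) = .op (-(Kinv i * E i))) ∧
    ∀ i, S (K i) = .op (Kinv i)
  grading : ∃ γ : A →ₐ[k] Polynomial A,
    (∀ i, γ (E i) = Polynomial.C (E i) * Polynomial.X ^ d i) ∧
    ∀ i, γ (K i) = Polynomial.C (K i)

variable {k : Type*} [Field k] {A : Type*} [Ring A] {ι : Type*}

section

variable [alg : Algebra k A] {q : k} {d : ι → ℕ} {E K Kinv : ι → A}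

/-- By uniqueness of inverses, the value of a multiplicative map on `K i` determines that on `Kinv
i`; so algebra maps need to be prescribed on the `E i` and `K i` only. -/
theorem IsPositivePart.map_Kinv (hA : IsPositivePart q d E K Kinv) {B F : Type*} [Ring B]
    [FunLike F A B] [MonoidHomClass F A B] (f : F) {i : ι} {y : B} (h : f (K i) * y = 1) :
    f (Kinv i) = y :=
  left_inv_eq_right_inv (by rw [← map_mul, hA.Kinv_mul_K, map_one]) h

theorem IsPositivePart.algHom_ext (hA : IsPositivePart q d E K Kinv) {B : Type*} [Ring B]
    [Algebra k B] {f g : A →ₐ[k] B} (hE : ∀ i, f (E i) = g (E i)) (hK : ∀ i, f (K i) = g (K i)) :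
    f = g := by
  refine AlgHom.ext_of_adjoin_eq_top hA.adjoin ?_
  rintro _ ((⟨i, rfl⟩ | ⟨i, rfl⟩) | ⟨i, rfl⟩)
  · exact hE i
  · exact hK i
  · refine hA.map_Kinv f ?_
    rw [hK, ← map_mul, hA.K_mul_Kinv, map_one]

theorem IsPositivePart.induction (hA : IsPositivePart q d E K Kinv) {P : A → Prop}
    (hE : ∀ i, P (E i)) (hK : ∀ i, P (K i)) (hKinv : ∀ i, P (Kinv i))
    (smul : ∀ c : k, P (algebraMap k A c)) (add : ∀ x y, P x → P y → P (x + y))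
    (mul : ∀ x y, P x → P y → P (x * y)) (x : A) : P x := by
  have hx : x ∈ Algebra.adjoin k (Set.range E ∪ Set.range K ∪ Set.range Kinv) := by
    rw [hA.adjoin]; trivial
  induction hx using Algebra.adjoin_induction with
  | mem x hx =>
    rcases hx with (⟨i, rfl⟩ | ⟨i, rfl⟩) | ⟨i, rfl⟩
    exacts [hE i, hK i, hKinv i]
  | algebraMap r => exact smul r
  | add x y _ _ hx hy => exact add x y hx hy
  | mul x y _ _ hx hy => exact mul x y hx hy

/-- The bialgebra axioms are equalities of algebra maps and can be checked on generators. The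
antipode axioms are not, and are carried through products by induction. -/
theorem IsPositivePart.exists_hopfAlgebra (hA : IsPositivePart q d E K Kinv) :
    ∃ hopf : HopfAlgebra k A, hopf.toAlgebra = alg ∧ @IsStandardHopf k _ A _ ι hopf E K := by
  obtain ⟨Δ, hΔE, hΔK⟩ := hA.comul
  obtain ⟨ε, hεE, hεK⟩ := hA.counit
  obtain ⟨S, hSE, hSK⟩ := hA.antipode
  let bialg : Bialgebra k A := Bialgebra.ofAlgHom Δ ε
    (hA.algHom_ext (fun i => by
      simp [hΔE, hΔK, TensorProduct.add_tmul, TensorProduct.tmul_add,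
        Algebra.TensorProduct.one_def, add_assoc]) (fun i => by simp [hΔK]))
    (hA.algHom_ext (fun i => by simp [hΔE, hεE, hεK]) (fun i => by simp [hΔK, hεK]))
    (hA.algHom_ext (fun i => by simp [hΔE, hεE]) (fun i => by simp [hΔK, hεK]))
  have hcomul : (Coalgebra.comul : A →ₗ[k] A ⊗[k] A) = Δ.toLinearMap := rfl
  have hcounit : (Coalgebra.counit : A →ₗ[k] k) = ε.toLinearMap := rfl
  let T : A →ₗ[k] A := (MulOpposite.opLinearEquiv k).symm.toLinearMap ∘ₗ S.toLinearMap
  have hT (x : A) : T x = (S x).unop := rfl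
  have hTmul (x y : A) : T (x * y) = T y * T x := by simp [hT]
  have hTone : T 1 = 1 := by simp [hT]
  have hΔKinv (i : ι) : Δ (Kinv i) = Kinv i ⊗ₜ Kinv i := hA.map_Kinv Δ (by
    rw [hΔK, Algebra.TensorProduct.tmul_mul_tmul, hA.K_mul_Kinv, Algebra.TensorProduct.one_def])
  have hεKinv (i : ι) : ε (Kinv i) = 1 := hA.map_Kinv ε (by rw [hεK, mul_one])
  have hSKinv (i : ι) : S (Kinv i) = .op (K i) := hA.map_Kinv S (by
    rw [hSK, ← MulOpposite.op_mul, hA.K_mul_Kinv, MulOpposite.op_one])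
  have left (x : A) : LinearMap.mul' k A (T.rTensor A (Δ x)) = algebraMap k A (ε x) := by
    induction x using hA.induction with
    | hE i =>
      simp [hΔE, hεE, hT, hSE, hSK]
    | hK i => simp [hΔK, hεK, hT, hSK, hA.Kinv_mul_K]
    | hKinv i => simp [hΔKinv, hεKinv, hT, hSKinv, hA.K_mul_Kinv]
    | smul c => simp [Algebra.TensorProduct.algebraMap_apply, hT]
    | add x y hx hy => simp only [map_add, hx, hy]
    -- As `T` reverses products, `T(x₍₁₎) x₍₂₎` ends up in the middle, where it collapses to the
    -- scalar `ε(x)` and can be pulled out.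
    | mul x y hx hy =>
      have h1 (c e : A) (Z : A ⊗[k] A) : LinearMap.mul' k A (T.rTensor A (Z * (c ⊗ₜ e))) =
          T c * LinearMap.mul' k A (T.rTensor A Z) * e := by
        induction Z with
        | zero => simp
        | add a b ha hb => simp only [add_mul, mul_add, map_add, ha, hb]
        | tmul a b => simp [hTmul, mul_assoc]
      have h2 (W : A ⊗[k] A) : LinearMap.mul' k A (T.rTensor A (Δ x * W)) =
          algebraMap k A (ε x) * LinearMap.mul' k A (T.rTensor A W) := by
        induction W with
        | zero => simp
        | add a b ha hb => simp only [mul_add, map_add, ha, hb]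
        | tmul a b =>
          rw [h1, hx, ← Algebra.commutes]
          simp [mul_assoc]
      rw [map_mul, h2, hy, map_mul, map_mul]
  have right (x : A) : LinearMap.mul' k A (T.lTensor A (Δ x)) = algebraMap k A (ε x) := by
    induction x using hA.induction with
    | hE i =>
      simp [hΔE, hεE, hTone, hT, hSE, ← mul_assoc, hA.K_mul_Kinv]
    | hK i => simp [hΔK, hεK, hT, hSK, hA.K_mul_Kinv]
    | hKinv i => simp [hΔKinv, hεKinv, hT, hSKinv, hA.Kinv_mul_K]
    | smul c => simp [Algebra.TensorProduct.algebraMap_apply, hT]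
    | add x y hx hy => simp only [map_add, hx, hy]
    | mul x y hx hy =>
      have h1 (c e : A) (Z : A ⊗[k] A) : LinearMap.mul' k A (T.lTensor A ((c ⊗ₜ e) * Z)) =
          c * LinearMap.mul' k A (T.lTensor A Z) * T e := by
        induction Z with
        | zero => simp
        | add a b ha hb => simp only [add_mul, mul_add, map_add, ha, hb]
        | tmul a b => simp [hTmul, mul_assoc]
      have h2 (W : A ⊗[k] A) : LinearMap.mul' k A (T.lTensor A (W * Δ y)) =
          LinearMap.mul' k A (T.lTensor A W) * algebraMap k A (ε y) := by
        induction W with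
        | zero => simp
        | add a b ha hb => simp only [add_mul, map_add, ha, hb]
        | tmul a b =>
          rw [h1, hy, mul_assoc, Algebra.commutes]
          simp [mul_assoc]
      rw [map_mul, h2, hx, map_mul, map_mul]
  let hopf : HopfAlgebra k A :=
    { bialg with
      antipode := T
      mul_antipode_rTensor_comul := LinearMap.ext left
      mul_antipode_lTensor_comul := LinearMap.ext right }
  exact ⟨hopf, rfl, ⟨hΔK, hΔE, hεK, hεE⟩⟩

/-- Evaluation of polynomials at a scalar. -/
def evalScalar (c : k) : Polynomial A →ₐ[k] A :=
  { Polynomial.eval₂RingHom' (RingHom.id A) (algebraMap k A c)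
      (fun a => (Algebra.commutes c a).symm) with
    commutes' := fun r => by
      change Polynomial.eval₂ _ _ (algebraMap k (Polynomial A) r) = _
      rw [Polynomial.algebraMap_apply, Polynomial.eval₂_C]
      rfl }

theorem evalScalar_C (c : k) (a : A) : evalScalar c (Polynomial.C a) = a :=
  Polynomial.eval₂_C _ _

theorem evalScalar_X (c : k) : evalScalar c (Polynomial.X : Polynomial A) = algebraMap k A c :=
  Polynomial.eval₂_X _ _

/-- Evaluating the grading at `X = c`. The value `c = 0` yields the projection and `c = q ^ 2` the
inverse of the squared antipode. -/
theorem IsPositivePart.exists_scale (hA : IsPositivePart q d E K Kinv) (c : k) :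
    ∃ f : A →ₐ[k] A, (∀ i, f (E i) = c ^ d i • E i) ∧ ∀ i, f (K i) = K i := by
  obtain ⟨γ, hγE, hγK⟩ := hA.grading
  refine ⟨(evalScalar c).comp γ, fun i => ?_, fun i => ?_⟩
  · rw [AlgHom.comp_apply, hγE, map_mul, map_pow, evalScalar_C, evalScalar_X, ← map_pow,
      ← Algebra.commutes, Algebra.smul_def]
  · rw [AlgHom.comp_apply, hγK, evalScalar_C]

end

section

variable [HopfAlgebra k A] {q : k} {d : ι → ℕ} {E K Kinv : ι → A}

theorem IsPositivePart.antipode_K (hA : IsPositivePart q d E K Kinv) (hs : IsStandardHopf k E K)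
    (i : ι) : HopfAlgebra.antipode k (K i) = Kinv i := by
  have h := HopfAlgebra.mul_antipode_rTensor_comul_apply (R := k) (K i)
  rw [hs.comul_K, hs.counit_K] at h
  exact left_inv_eq_right_inv (by simpa using h) (hA.K_mul_Kinv i)

theorem IsPositivePart.antipode_Kinv (hA : IsPositivePart q d E K Kinv)
    (hs : IsStandardHopf k E K) (i : ι) : HopfAlgebra.antipode k (Kinv i) = K i := by
  have h := congrArg (HopfAlgebra.antipode k) (hA.Kinv_mul_K i)
  rw [HopfAlgebra.antipode_mul_antidistrib, hA.antipode_K hs, HopfAlgebra.antipode_one] at h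
  exact (left_inv_eq_right_inv (hA.K_mul_Kinv i) h).symm

theorem IsPositivePart.antipode_E (hA : IsPositivePart q d E K Kinv) (hs : IsStandardHopf k E K)
    (i : ι) : HopfAlgebra.antipode k (E i) = -(Kinv i * E i) := by
  have h := HopfAlgebra.mul_antipode_rTensor_comul_apply (R := k) (E i)
  rw [hs.comul_E, hs.counit_E] at h
  simp only [map_add, LinearMap.rTensor_tmul, LinearMap.mul'_apply, mul_one, map_zero,
    hA.antipode_K hs] at h
  exact eq_neg_of_add_eq_zero_left h

/-- The square of the antipode is an algebra map that fixes `K i` and sends `E i` to `Kinv i * E i *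
K i`, which is `E i` divided by `(q ^ 2) ^ d i`. So it is inverse to a scaling. -/
theorem IsPositivePart.antipode_bijective (hA : IsPositivePart q d E K Kinv)
    (hs : IsStandardHopf k E K) (hq : q ≠ 0) :
    Function.Bijective (HopfAlgebra.antipode k (A := A)) := by
  obtain ⟨f, hfE, hfK⟩ := hA.exists_scale (q ^ 2)
  let S₂ : A →ₐ[k] A := AlgHom.ofLinearMap (HopfAlgebra.antipode k ∘ₗ HopfAlgebra.antipode k)
    (by simp) (by simp [HopfAlgebra.antipode_mul_antidistrib])
  have hS₂ (x : A) : S₂ x = HopfAlgebra.antipode k (HopfAlgebra.antipode k x) := rfl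
  have hK (i : ι) : S₂ (K i) = K i := by
    rw [hS₂, hA.antipode_K hs, hA.antipode_Kinv hs]
  have hE (i : ι) : (q ^ 2) ^ d i • S₂ (E i) = E i := by
    rw [hS₂, hA.antipode_E hs, map_neg, HopfAlgebra.antipode_mul_antidistrib, hA.antipode_E hs,
      hA.antipode_Kinv hs, neg_mul, neg_neg, mul_assoc, ← mul_smul_comm, ← hA.K_E, ← mul_assoc,
      hA.Kinv_mul_K, one_mul]
  have h1 : S₂.comp f = AlgHom.id k A :=
    hA.algHom_ext (fun i => by simp [hfE, hE]) (fun i => by simp [hfK, hK])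
  have h2 : f.comp S₂ = AlgHom.id k A := by
    refine hA.algHom_ext (fun i => ?_) (fun i => by simp [hfK, hK])
    have hne : (q ^ 2) ^ d i ≠ 0 := pow_ne_zero _ (pow_ne_zero _ hq)
    have : S₂ (E i) = ((q ^ 2) ^ d i)⁻¹ • E i := by rw [eq_inv_smul_iff₀ hne, hE]
    simp [this, hfE, smul_smul, inv_mul_cancel₀ hne]
  constructor
  · refine Function.LeftInverse.injective (g := fun x => f (HopfAlgebra.antipode k x)) fun x => ?_
    exact DFunLike.congr_fun h2 x
  · intro x
    exact ⟨HopfAlgebra.antipode k (f x), DFunLike.congr_fun h1 x⟩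

/-- The scaling by `0`; it kills `E i` because the degree `d i` is positive. -/
theorem IsPositivePart.exists_proj (hA : IsPositivePart q d E K Kinv)
    (hs : IsStandardHopf k E K) (hd : ∀ i, 0 < d i) :
    ∃ p : A →ₐc[k] A, (∀ i, p (K i) = K i) ∧ ∀ i, p (E i) = 0 := by
  obtain ⟨f, hfE, hfK⟩ := hA.exists_scale 0
  have hfE (i : ι) : f (E i) = 0 := by rw [hfE, zero_pow (hd i).ne', zero_smul]
  refine ⟨BialgHom.ofAlgHom f (hA.algHom_ext ?_ ?_) (hA.algHom_ext ?_ ?_), hfK, hfE⟩ <;> intro i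
  · simp [hfE, hs.counit_E]
  · simp [hfK]
  · simp [hfE, hs.comul_E]
  · simp [hfK, hs.comul_K]

theorem IsPositivePart.hasYBStructures (hA : IsPositivePart q d E K Kinv)
    (hs : IsStandardHopf k E K) (hq : q ≠ 0) {p : A →ₐc[k] A} (hpK : ∀ i, p (K i) = K i)
    (hpE : ∀ i, p (E i) = 0) : HasYBStructures k E K p := by
  have hS := hA.antipode_bijective hs hq
  have hpKinv (i : ι) : p (Kinv i) = Kinv i := hA.map_Kinv p (by rw [hpK, hA.K_mul_Kinv])
  have hp (x : A) : p (p x) = p x := by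
    have : (p : A →ₐ[k] A).comp (p : A →ₐ[k] A) = p :=
      hA.algHom_ext (fun i => by simp [hpE]) (fun i => by simp [hpK])
    exact DFunLike.congr_fun this x
  have hKK (i j : ι) : Commute (K i) (K j) := hA.K_comm i j
  have inv {x : A} {i : ι} (h : Commute x (K i)) : Commute x (Kinv i) := by
    let u : Aˣ := ⟨K i, Kinv i, hA.K_mul_Kinv i, hA.Kinv_mul_K i⟩
    exact (show Commute x u from h).units_inv_right
  have hcomm (x y : A) : Commute (p x) (p y) := by
    -- Commuting with every `K i` is enough to commute with the image of `p`. This is applied twice,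
    -- once for each factor.
    have aux {z : A} (hz : ∀ i, Commute z (K i)) (y : A) : Commute z (p y) := by
      induction y using hA.induction with
      | hE i => simp [hpE]
      | hK i => rw [hpK]; exact hz i
      | hKinv i => rw [hpKinv]; exact inv (hz i)
      | smul c => rw [AlgHomClass.commutes]; exact (Algebra.commutes c z).symm
      | add x y hx hy => rw [map_add]; exact hx.add_right hy
      | mul x y hx hy => rw [map_mul]; exact hx.mul_right hy
    refine aux (fun i => ?_) y
    exact (aux (fun j => hKK i j) x).symm
  have grouplike (i : ι) : IsGroupLikeElem k (K i) := ⟨hs.counit_K i, hs.comul_K i⟩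
  have span : Submodule.span k {x : A | ∃ g h, IsHomogeneous p g h x} = ⊤ := by
    -- Homogeneous elements form a submonoid containing the generators, and the algebra is the
    -- linear span of the monoid they generate.
    let M : Submonoid A :=
      { carrier := {x : A | ∃ g h, IsHomogeneous p g h x}
        one_mem' := ⟨1, 1, isHomogeneous_one⟩
        mul_mem' := by
          rintro x y ⟨g, h, hx⟩ ⟨g', h', hy⟩
          exact ⟨_, _, hx.mul hy⟩ }
    have hle : Set.range E ∪ Set.range K ∪ Set.range Kinv ⊆ M := by
      rintro _ ((⟨i, rfl⟩ | ⟨i, rfl⟩) | ⟨i, rfl⟩)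
      · exact ⟨⟨K i, grouplike i⟩, 1, isHomogeneous_primitive (hpK i) (hpE i) (hs.comul_E i)⟩
      · exact ⟨_, _, isHomogeneous_groupLike (g := ⟨K i, grouplike i⟩) (hpK i)⟩
      · exact ⟨_, _, isHomogeneous_groupLike (g := ⟨Kinv i, (grouplike i).of_mul_eq_one
          (hA.K_mul_Kinv i) (hA.Kinv_mul_K i)⟩) (hpKinv i)⟩
    rw [eq_top_iff, ← Algebra.top_toSubmodule, ← hA.adjoin, Algebra.adjoin_eq_span]
    exact Submodule.span_mono (Submonoid.closure_le.mpr hle)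
  have both := isYB_biproductBraiding (fun x y => hcomm x y) span
  refine ⟨hpK, hpE, ?_, ?_, isYBAlgebra_biproductBraidingAlg hp hS,
    isYBCoalgebra_biproductBraidingCoalg hp hS, both.1, both.2⟩
  · have h := isYBAlgebra_biproductBraidingAlg (p := BialgHom.id k A) (fun _ => rfl) hS
    have e : biproductBraidingAlg (BialgHom.id k A) = woronowiczF' k A := by
      rw [biproductBraidingAlg, woronowiczF']
      congr 1
      exact (congrArg (· ∘ₗ Coalgebra.comul) (LinearMap.rTensor_id A A)).trans
        (LinearMap.id_comp _)
    rwa [e] at h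
  · have h := isYBCoalgebra_biproductBraidingCoalg (p := BialgHom.id k A) (fun _ => rfl) hS
    have e : biproductBraidingCoalg (BialgHom.id k A) = woronowiczF k A := by
      rw [biproductBraidingCoalg, woronowiczF]
      congr 1
      exact (congrArg (· ∘ₗ adjointCoaction k A) (LinearMap.rTensor_id A A)).trans
        (LinearMap.id_comp _)
    rwa [e] at h

end

theorem IsPositivePart.isYBHopf [alg : Algebra k A] {q : k} {d : ι → ℕ} {E K Kinv : ι → A}
    (hA : IsPositivePart q d E K Kinv) (hq : q ≠ 0) (hd : ∀ i, 0 < d i) : IsYBHopf k E K := by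
  obtain ⟨hopf, rfl, hs⟩ := hA.exists_hopfAlgebra
  obtain ⟨p, hpK, hpE⟩ := hA.exists_proj hs hd
  exact ⟨hopf, rfl, hs, p, hA.hasYBStructures hs hq hpK hpE⟩

end Positive

/-! ### Gaussian binomials, the q-binomial theorem and iterated q-commutators -/

section QuantumCombinatorics

variable {F : Type*} [Field F]

/-- The product `(1 - T) (1 - T ^ 2) ⋯ (1 - T ^ n)`. -/
def qPoch (T : F) (n : ℕ) : F := ∏ j ∈ Finset.range n, (1 - T ^ (j + 1))

/-- The Gaussian binomial coefficient `r + s` choose `s`. -/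
def gauss (T : F) (s r : ℕ) : F := qPoch T (s + r) / (qPoch T s * qPoch T r)

theorem qPoch_succ (T : F) (n : ℕ) : qPoch T (n + 1) = qPoch T n * (1 - T ^ (n + 1)) :=
  Finset.prod_range_succ _ _

section

variable {T : F} (hT : ∀ n : ℕ, 0 < n → T ^ n ≠ 1)
include hT

theorem one_sub_pow_ne_zero (n : ℕ) : 1 - T ^ (n + 1) ≠ 0 :=
  sub_ne_zero.mpr (hT (n + 1) n.succ_pos).symm

theorem qPoch_ne_zero (n : ℕ) : qPoch T n ≠ 0 :=
  Finset.prod_ne_zero_iff.mpr fun j _ => one_sub_pow_ne_zero hT j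

theorem gauss_zero_left (r : ℕ) : gauss T 0 r = 1 := by
  have := qPoch_ne_zero hT r
  rw [gauss, zero_add, show qPoch T 0 = 1 from rfl, one_mul, div_self this]

theorem gauss_zero_right (s : ℕ) : gauss T s 0 = 1 := by
  have := qPoch_ne_zero hT s
  rw [gauss, add_zero, show qPoch T 0 = 1 from rfl, mul_one, div_self this]

/-- Both Pascal rules, this one and `gauss_succ_succ'`, are needed: the recursion for `comulCoeff`
is a combination of the two. -/
theorem gauss_succ_succ (s r : ℕ) : gauss T (s + 1) (r + 1) =
    gauss T (s + 1) r + T ^ (r + 1) * gauss T s (r + 1) := by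
  have h1 := qPoch_ne_zero hT s
  have h2 := qPoch_ne_zero hT r
  have h3 := one_sub_pow_ne_zero hT s
  have h4 := one_sub_pow_ne_zero hT r
  have e1 : s + 1 + (r + 1) = (s + r + 1) + 1 := by ring
  have e2 : s + 1 + r = s + r + 1 := by ring
  have e3 : s + (r + 1) = s + r + 1 := by ring
  simp only [gauss, e1, e2, e3, qPoch_succ _ s, qPoch_succ _ r, qPoch_succ _ (s + r + 1)]
  field_simp
  ring

theorem gauss_succ_succ' (s r : ℕ) : gauss T (s + 1) (r + 1) =
    T ^ (s + 1) * gauss T (s + 1) r + gauss T s (r + 1) := by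
  have h1 := qPoch_ne_zero hT s
  have h2 := qPoch_ne_zero hT r
  have h3 := one_sub_pow_ne_zero hT s
  have h4 := one_sub_pow_ne_zero hT r
  have e1 : s + 1 + (r + 1) = (s + r + 1) + 1 := by ring
  have e2 : s + 1 + r = s + r + 1 := by ring
  have e3 : s + (r + 1) = s + r + 1 := by ring
  simp only [gauss, e1, e2, e3, qPoch_succ _ s, qPoch_succ _ r, qPoch_succ _ (s + r + 1)]
  field_simp
  ring

end

/-- Reversing the sum makes it geometric. This links the symmetric quantum integers to the factors
`1 - T ^ (n + 1)` with `T = t ^ 2`. -/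
theorem qInt_succ_mul {t : F} (ht : t ≠ 0) (n : ℕ) :
    qInt t (n + 1) * t ^ n * (1 - t ^ 2) = 1 - (t ^ 2) ^ (n + 1) := by
  rw [qInt, Finset.sum_mul, ← Finset.sum_range_reflect]
  have : ∀ j ∈ Finset.range (n + 1), t ^ (((n + 1 : ℕ) : ℤ) - 1 - 2 * ((n + 1 - 1 - j : ℕ) : ℤ)) *
      t ^ n = (t ^ 2) ^ j := by
    intro j hj
    have hj : j ≤ n := Nat.lt_succ_iff.mp (Finset.mem_range.mp hj)
    rw [← zpow_natCast t n, ← zpow_add₀ ht, ← pow_mul, ← zpow_natCast t (2 * j)]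
    congr 1
    omega
  rw [Finset.sum_congr rfl this, mul_comm, mul_neg_geom_sum]

section

variable {t : F} (ht : t ≠ 0) (hT : ∀ n : ℕ, 0 < n → (t ^ 2) ^ n ≠ 1)
include ht

theorem qFact_mul (n : ℕ) :
    qFact t n * (∏ j ∈ Finset.range n, t ^ j) * (1 - t ^ 2) ^ n = qPoch (t ^ 2) n := by
  rw [qFact, qPoch, ← Finset.prod_mul_distrib, ← Finset.card_range n, ← Finset.prod_const,
    Finset.card_range, ← Finset.prod_mul_distrib]
  exact Finset.prod_congr rfl fun j _ => qInt_succ_mul ht j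

include hT

theorem qFact_ne_zero (n : ℕ) : qFact t n ≠ 0 := by
  have := qPoch_ne_zero hT n
  rw [← qFact_mul ht] at this
  exact left_ne_zero_of_mul (left_ne_zero_of_mul this)

/-- The power `t ^ (s * r)` is what is left when the normalizing product of `t ^ j` over `j < s + r`
is split into those for `s` and `r`. -/
theorem gauss_mul_qFact (s r : ℕ) :
    gauss (t ^ 2) s r * (qFact t s * qFact t r) = t ^ (s * r) * qFact t (s + r) := by
  have h1 := qFact_ne_zero ht hT s
  have h2 := qFact_ne_zero ht hT r
  have h0 : 1 - t ^ 2 ≠ 0 := by simpa using one_sub_pow_ne_zero hT 0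
  have hw (n : ℕ) : ∏ j ∈ Finset.range n, t ^ j ≠ 0 :=
    Finset.prod_ne_zero_iff.mpr fun j _ => pow_ne_zero j ht
  have e : ∏ j ∈ Finset.range (s + r), t ^ j =
      (∏ j ∈ Finset.range s, t ^ j) * (t ^ (s * r) * ∏ j ∈ Finset.range r, t ^ j) := by
    rw [Finset.prod_range_add]
    simp only [pow_add, Finset.prod_mul_distrib, Finset.prod_const, Finset.card_range, pow_mul]
  rw [gauss, ← qFact_mul ht s, ← qFact_mul ht r, ← qFact_mul ht (s + r), e, pow_add]
  have := hw s
  have := hw r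
  field_simp

theorem qBinom_eq (s r : ℕ) :
    qBinom t (s + r) s = t ^ (-((s * r : ℕ) : ℤ)) * gauss (t ^ 2) s r := by
  have h1 := qFact_ne_zero ht hT s
  have h2 := qFact_ne_zero ht hT r
  have h := gauss_mul_qFact ht hT s r
  rw [qBinom, Nat.add_sub_cancel_left, div_eq_iff (mul_ne_zero h1 h2), mul_assoc, h, ← mul_assoc,
    zpow_neg, zpow_natCast, inv_mul_cancel₀ (pow_ne_zero _ ht), one_mul]

end

theorem qInt_inv (t : F) (n : ℕ) : qInt t⁻¹ n = qInt t n := by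
  rw [qInt, qInt, ← Finset.sum_range_reflect]
  refine Finset.sum_congr rfl fun j hj => ?_
  have hj := Finset.mem_range.mp hj
  rw [inv_zpow, ← zpow_neg]
  congr 1
  omega

theorem qSerre_inv {B : Type*} [Ring B] [Algebra F B] (t : F) (n : ℕ) (x y : B) :
    qSerre t⁻¹ n x y = qSerre t n x y := by
  simp only [qSerre, qBinom, qFact, qInt_inv]

/-- A sum over an antidiagonal whose terms satisfy a recursion of Pascal's type. -/
theorem sum_antidiagonal_pascal {V : Type*} [AddCommMonoid V] {h α β : ℕ → ℕ → V}
    (h0 : ∀ r, h 0 (r + 1) = α 0 r) (h1 : ∀ s, h (s + 1) 0 = β s 0)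
    (h2 : ∀ s r, h (s + 1) (r + 1) = α (s + 1) r + β s (r + 1)) (m : ℕ) :
    ∑ p ∈ Finset.HasAntidiagonal.antidiagonal (m + 1), h p.1 p.2 =
      ∑ p ∈ Finset.HasAntidiagonal.antidiagonal m, α p.1 p.2 +
        ∑ p ∈ Finset.HasAntidiagonal.antidiagonal m, β p.1 p.2 := by
  cases m with
  | zero => simp [Finset.Nat.antidiagonal_succ, h0, h1]
  | succ m =>
    rw [Finset.Nat.sum_antidiagonal_succ (f := fun p => h p.1 p.2),
      Finset.Nat.sum_antidiagonal_succ' (f := fun p => h (p.1 + 1) p.2),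
      Finset.Nat.sum_antidiagonal_succ (f := fun p => α p.1 p.2),
      Finset.Nat.sum_antidiagonal_succ' (f := fun p => β p.1 p.2)]
    simp only [h0, h1, h2, Finset.sum_add_distrib]
    abel

variable {B : Type*} [Ring B] [Algebra F B]

/-- The `q`-binomial theorem. -/
theorem add_pow_of_qComm {T : F} (hT : ∀ n : ℕ, 0 < n → T ^ n ≠ 1) {x z : B}
    (hxz : z * x = T • (x * z)) (m : ℕ) :
    (x + z) ^ m =
      ∑ p ∈ Finset.HasAntidiagonal.antidiagonal m, gauss T p.1 p.2 • (x ^ p.2 * z ^ p.1) := by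
  have hz (r : ℕ) : z * x ^ r = T ^ r • (x ^ r * z) := by
    induction r with
    | zero => simp
    | succ r ih =>
      rw [pow_succ, ← mul_assoc, ih, smul_mul_assoc, mul_assoc, hxz, mul_smul_comm, smul_smul,
        ← pow_succ, mul_assoc]
  induction m with
  | zero => simp [gauss_zero_left hT]
  | succ m ih =>
    rw [sum_antidiagonal_pascal (h := fun s r => gauss T s r • (x ^ r * z ^ s))
      (α := fun s r => gauss T s r • (x ^ (r + 1) * z ^ s))
      (β := fun s r => (T ^ r * gauss T s r) • (x ^ r * z ^ (s + 1))), pow_succ', ih, add_mul,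
      Finset.mul_sum, Finset.mul_sum]
    · congr 1
      · refine Finset.sum_congr rfl fun p _ => ?_
        rw [mul_smul_comm, ← mul_assoc, ← pow_succ']
      · refine Finset.sum_congr rfl fun p _ => ?_
        rw [mul_smul_comm, ← mul_assoc, hz, smul_mul_assoc, smul_smul, mul_assoc, ← pow_succ',
          mul_comm]
    · intro r
      simp [gauss_zero_left hT]
    · intro s
      simp [gauss_zero_right hT]
    · intro s r
      rw [gauss_succ_succ hT, add_smul]

/-- The iterated `q`-commutators of `x` with `y`. -/
def serreIter (t : F) (e : ℤ) (x y : B) : ℕ → B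
  | 0 => y
  | m + 1 => x * serreIter t e x y m - t ^ (e + 2 * m) • (serreIter t e x y m * x)

theorem serreIter_eq {t : F} (ht : t ≠ 0) (hT : ∀ n : ℕ, 0 < n → (t ^ 2) ^ n ≠ 1) (e : ℤ)
    (x y : B) (m : ℕ) : serreIter t e x y m = ∑ p ∈ Finset.HasAntidiagonal.antidiagonal m,
      ((-1) ^ p.1 * t ^ (p.1 * (e + p.1 - 1)) * gauss (t ^ 2) p.1 p.2) •
        (x ^ p.2 * y * x ^ p.1) := by
  induction m with
  | zero => simp [serreIter, gauss_zero_left hT]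
  | succ m ih =>
    rw [sum_antidiagonal_pascal
      (h := fun s r => ((-1) ^ s * t ^ (s * (e + s - 1)) * gauss (t ^ 2) s r) •
        (x ^ r * y * x ^ s))
      (α := fun s r => ((-1) ^ s * t ^ (s * (e + s - 1)) * gauss (t ^ 2) s r) •
        (x ^ (r + 1) * y * x ^ s))
      (β := fun s r => -((t ^ (e + 2 * (s + r : ℕ)) *
        ((-1) ^ s * t ^ (s * (e + s - 1)) * gauss (t ^ 2) s r)) •
        (x ^ r * y * x ^ (s + 1)))),
      serreIter, ih, Finset.mul_sum, Finset.sum_mul, Finset.smul_sum, Finset.sum_neg_distrib,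
      sub_eq_add_neg]
    · congr 1
      · refine Finset.sum_congr rfl fun p _ => ?_
        rw [mul_smul_comm, ← mul_assoc, ← mul_assoc, ← pow_succ']
      · congr 1
        refine Finset.sum_congr rfl fun p hp => ?_
        rw [Finset.HasAntidiagonal.mem_antidiagonal.mp hp, smul_mul_assoc, smul_smul,
          mul_assoc _ (x ^ p.1),
          ← pow_succ]
    · intro r
      simp [gauss_zero_left hT]
    · intro s
      simp only [gauss_zero_right hT, mul_one, add_zero, ← neg_smul]
      congr 1
      rw [pow_succ, mul_left_comm, ← zpow_add₀ ht, mul_neg_one, neg_mul]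
      congr 3
      push_cast
      ring
    · intro s r
      rw [← neg_smul, ← add_smul]
      congr 1
      rw [gauss_succ_succ hT]
      have e1 : t ^ (e + 2 * ((s + (r + 1) : ℕ) : ℤ)) * t ^ ((s : ℤ) * (e + s - 1)) =
          t ^ (((s + 1 : ℕ) : ℤ) * (e + ((s + 1 : ℕ) : ℤ) - 1)) * (t ^ 2) ^ (r + 1) := by
        rw [← pow_mul, ← zpow_natCast, ← zpow_add₀ ht, ← zpow_add₀ ht]
        congr 1
        push_cast
        ring
      rw [pow_succ (-1 : F)]
      linear_combination ((-1) ^ s * gauss (t ^ 2) s (r + 1)) * e1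

/-- At `n = 1 - e` the exponent `s (e + s - 1)` equals `-s r` for `s + r = n`, exactly the factor
between symmetric and Gaussian binomials. Hence the Serre expression is an iterated q-commutator,
and can be treated by induction. -/
theorem qSerre_eq {t : F} (ht : t ≠ 0) (hT : ∀ n : ℕ, 0 < n → (t ^ 2) ^ n ≠ 1) {e : ℤ} {n : ℕ}
    (hn : (n : ℤ) = 1 - e) (x y : B) : qSerre t n x y = serreIter t e x y n := by
  rw [serreIter_eq ht hT, qSerre, ← Finset.Nat.sum_antidiagonal_eq_sum_range_succ
    (fun s r => ((-1) ^ s * qBinom t n s) • (x ^ r * y * x ^ s))]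
  refine Finset.sum_congr rfl fun p hp => ?_
  have hp := Finset.HasAntidiagonal.mem_antidiagonal.mp hp
  have he : (p.1 : ℤ) * (e + p.1 - 1) = -((p.1 * p.2 : ℕ) : ℤ) := by
    rw [show e = 1 - ((p.1 + p.2 : ℕ) : ℤ) by rw [hp, hn]; ring]
    push_cast
    ring
  rw [he, ← hp, qBinom_eq ht hT, ← mul_assoc ((-1 : F) ^ p.1)]

theorem map_qSerre {C : Type*} [Ring C] [Algebra F C] (f : B →ₐ[F] C) (t : F) (n : ℕ) (x y : B) :
    f (qSerre t n x y) = qSerre t n (f x) (f y) := by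
  simp [qSerre, map_sum]

theorem qSerre_smul_smul (t : F) (n : ℕ) (c c' : F) (x y : B) :
    qSerre t n (c • x) (c' • y) = (c ^ n * c') • qSerre t n x y := by
  rw [qSerre, qSerre, Finset.smul_sum]
  refine Finset.sum_congr rfl fun s hs => ?_
  have hs : s ≤ n := Nat.lt_succ_iff.mp (Finset.mem_range.mp hs)
  simp only [smul_pow, smul_mul_assoc, mul_smul_comm, smul_smul]
  congr 1
  rw [← Nat.sub_add_cancel hs, pow_add, Nat.sub_add_cancel hs]
  ring

section

variable {t : F} {e : ℤ} {x y κ : B}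

/-- The scalar by which `κ` moves past the iterated q-commutator is the coefficient used in its next
step, which is why the terms in `κ ⊗ x` cancel in `serreIter_comul`. -/
theorem mul_serreIter (ht : t ≠ 0) (hx : κ * x = t ^ 2 • (x * κ)) (hy : κ * y = t ^ e • (y * κ))
    (m : ℕ) : κ * serreIter t e x y m = t ^ (e + 2 * m) • (serreIter t e x y m * κ) := by
  induction m with
  | zero => simpa [serreIter] using hy
  | succ m ih =>
    have e1 : t ^ (e + 2 * ((m + 1 : ℕ) : ℤ)) = t ^ 2 * t ^ (e + 2 * (m : ℤ)) := by
      rw [← zpow_natCast t 2, ← zpow_add₀ ht]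
      congr 1
      push_cast
      ring
    rw [serreIter, mul_sub, sub_mul, smul_sub, e1]
    congr 1
    · rw [← mul_assoc, hx, smul_mul_assoc, mul_assoc, ih, mul_smul_comm, smul_smul, mul_assoc]
    · rw [mul_smul_comm, ← mul_assoc, ih]
      simp only [smul_mul_assoc, mul_assoc, hx, mul_smul_comm, smul_smul]
      congr 1
      ring

end

end QuantumCombinatorics

/-! ### Quantum Serre relations under coproduct and antipode -/

section SerreComul

variable {F : Type*} [Field F] {B : Type*} [Ring B] [Algebra F B]
  {t : F} {e : ℤ} {x y κ l : B}

theorem qComm_pow {c : F} {x κ : B} (h : κ * x = c • (x * κ)) (m : ℕ) :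
    κ * x ^ m = c ^ m • (x ^ m * κ) := by
  induction m with
  | zero => simp
  | succ m ih =>
    rw [pow_succ, ← mul_assoc, ih, smul_mul_assoc, mul_assoc, h, mul_smul_comm, smul_smul,
      ← pow_succ, mul_assoc]

theorem pow_qComm {c : F} {x κ : B} (h : κ * x = c • (x * κ)) (m : ℕ) :
    κ ^ m * x = c ^ m • (x * κ ^ m) := by
  induction m with
  | zero => simp
  | succ m ih =>
    rw [pow_succ, mul_assoc, h, mul_smul_comm, ← mul_assoc, ih, smul_mul_assoc, smul_smul,
      mul_comm c, ← pow_succ, mul_assoc]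

/-- The coefficients in the coproduct of an iterated `q`-commutator. -/
def comulCoeff (t : F) (e : ℤ) (s r : ℕ) : F :=
  gauss (t ^ 2) s r * ∏ j ∈ Finset.range r, (1 - t ^ (2 * (e + s + j)))

theorem comulCoeff_zero_right (hT : ∀ n : ℕ, 0 < n → (t ^ 2) ^ n ≠ 1) (s : ℕ) :
    comulCoeff t e s 0 = 1 := by
  simp [comulCoeff, gauss_zero_right hT]

theorem comulCoeff_zero_left (hT : ∀ n : ℕ, 0 < n → (t ^ 2) ^ n ≠ 1) (r : ℕ) :
    comulCoeff t e 0 (r + 1) = (1 - t ^ (2 * (e + r))) * comulCoeff t e 0 r := by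
  simp [comulCoeff, gauss_zero_left hT, Finset.prod_range_succ, mul_comm]

theorem comulCoeff_succ_succ (ht : t ≠ 0) (hT : ∀ n : ℕ, 0 < n → (t ^ 2) ^ n ≠ 1) (s r : ℕ) :
    comulCoeff t e (s + 1) (r + 1) =
      (1 - t ^ (2 * (e + r + 2 * ((s + 1 : ℕ) : ℤ)))) * comulCoeff t e (s + 1) r +
      (t ^ 2) ^ (r + 1) * comulCoeff t e s (r + 1) := by
  have e1 : ∏ j ∈ Finset.range (r + 1), (1 - t ^ (2 * (e + s + j))) =
      (1 - t ^ (2 * (e + s))) * ∏ j ∈ Finset.range r, (1 - t ^ (2 * (e + (s + 1 : ℕ) + j))) := by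
    rw [Finset.prod_range_succ', mul_comm]
    congr 1
    · simp
    · refine Finset.prod_congr rfl fun j _ => ?_
      congr 3
      push_cast
      ring
  have e2 : t ^ (2 * (e + r + 2 * ((s + 1 : ℕ) : ℤ))) =
      t ^ (2 * (e + s)) * ((t ^ 2) ^ (s + 1) * (t ^ 2) ^ (r + 1)) := by
    rw [← pow_add, ← pow_mul, ← zpow_natCast, ← zpow_add₀ ht]
    congr 1
    push_cast
    ring
  have e3 : t ^ (2 * (e + (s + 1 : ℕ) + r)) =
      t ^ (2 * (e + s)) * (t ^ 2) ^ (r + 1) := by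
    rw [← pow_mul, ← zpow_natCast, ← zpow_add₀ ht]
    congr 1
    push_cast
    ring
  rw [comulCoeff, comulCoeff, comulCoeff, e1, Finset.prod_range_succ, e2, e3]
  have g1 := gauss_succ_succ hT s r
  have g2 := gauss_succ_succ' hT s r
  set Q := ∏ j ∈ Finset.range r, (1 - t ^ (2 * (e + (s + 1 : ℕ) + j)))
  -- With the products reduced to the common factor `Q`, the recursion is the first Pascal rule
  -- minus a multiple of the second.
  linear_combination Q * g1 - t ^ (2 * (e + s)) * (t ^ 2) ^ (r + 1) * Q * g2

/-- A closed form for every number of commutators, not only for the Serre exponent, since only the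
general form is accessible to induction. -/
theorem serreIter_comul (ht : t ≠ 0) (hT : ∀ n : ℕ, 0 < n → (t ^ 2) ^ n ≠ 1)
    (hx : κ * x = t ^ 2 • (x * κ)) (hy : κ * y = t ^ e • (y * κ)) (hlx : l * x = t ^ e • (x * l))
    (hκl : κ * l = l * κ) (m : ℕ) :
    serreIter t e (x ⊗ₜ[F] (1 : B) + κ ⊗ₜ[F] x) (y ⊗ₜ[F] (1 : B) + l ⊗ₜ[F] y) m =
      serreIter t e x y m ⊗ₜ[F] (1 : B) +
      ∑ p ∈ Finset.HasAntidiagonal.antidiagonal m,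
        comulCoeff t e p.1 p.2 • ((x ^ p.2 * κ ^ p.1 * l) ⊗ₜ[F] serreIter t e x y p.1) := by
  induction m with
  | zero => simp [serreIter, comulCoeff_zero_right hT]
  | succ m ih =>
    have hκl' (s : ℕ) : κ ^ s * l = l * κ ^ s := ((show Commute κ l from hκl).pow_left s).eq
    rw [serreIter, ih, sum_antidiagonal_pascal
      (h := fun s r => comulCoeff t e s r • ((x ^ r * κ ^ s * l) ⊗ₜ[F] serreIter t e x y s))
      (α := fun s r => ((1 - t ^ (2 * (e + r + 2 * (s : ℤ)))) * comulCoeff t e s r) •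
        ((x ^ (r + 1) * κ ^ s * l) ⊗ₜ[F] serreIter t e x y s))
      (β := fun s r => ((t ^ 2) ^ r * comulCoeff t e s r) •
        ((x ^ r * κ ^ (s + 1) * l) ⊗ₜ[F] serreIter t e x y (s + 1)))]
    · have main : (x ⊗ₜ[F] (1 : B) + κ ⊗ₜ[F] x) * (serreIter t e x y m ⊗ₜ[F] (1 : B)) -
          t ^ (e + 2 * m) • ((serreIter t e x y m ⊗ₜ[F] (1 : B)) *
            (x ⊗ₜ[F] (1 : B) + κ ⊗ₜ[F] x)) = serreIter t e x y (m + 1) ⊗ₜ[F] (1 : B) := by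
        rw [add_mul, mul_add]
        simp only [Algebra.TensorProduct.tmul_mul_tmul, mul_one, one_mul]
        rw [mul_serreIter ht hx hy, serreIter, TensorProduct.sub_tmul, smul_add,
          TensorProduct.smul_tmul', TensorProduct.smul_tmul']
        abel
      -- A further q-commutator sends the term with indices `(s, r)` to the terms with indices `(s,
      -- r + 1)` and `(s + 1, r)`, which is a recursion of Pascal's type.
      have side (s r : ℕ) : (x ⊗ₜ[F] (1 : B) + κ ⊗ₜ[F] x) *
          ((x ^ r * κ ^ s * l) ⊗ₜ[F] serreIter t e x y s) -
          t ^ (e + 2 * (s + r : ℕ)) • (((x ^ r * κ ^ s * l) ⊗ₜ[F] serreIter t e x y s) *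
            (x ⊗ₜ[F] (1 : B) + κ ⊗ₜ[F] x)) =
          (1 - t ^ (2 * (e + r + 2 * (s : ℤ)))) •
            ((x ^ (r + 1) * κ ^ s * l) ⊗ₜ[F] serreIter t e x y s) +
          (t ^ 2) ^ r • ((x ^ r * κ ^ (s + 1) * l) ⊗ₜ[F] serreIter t e x y (s + 1)) := by
        have f1 : x ^ r * κ ^ s * l * x = (t ^ e * (t ^ 2) ^ s) • (x ^ (r + 1) * κ ^ s * l) := by
          rw [mul_assoc, hlx, mul_smul_comm, mul_assoc, ← mul_assoc (κ ^ s), pow_qComm hx,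
            smul_mul_assoc, mul_smul_comm, smul_smul, pow_succ x r]
          simp only [mul_assoc]
        have f2 : κ * (x ^ r * κ ^ s * l) = (t ^ 2) ^ r • (x ^ r * κ ^ (s + 1) * l) := by
          rw [← mul_assoc, ← mul_assoc, qComm_pow hx, smul_mul_assoc, smul_mul_assoc,
            mul_assoc (x ^ r), ← pow_succ']
        have f3 : x ^ r * κ ^ s * l * κ = x ^ r * κ ^ (s + 1) * l := by
          rw [mul_assoc, ← hκl, pow_succ, mul_assoc, mul_assoc, mul_assoc]
        have e1 : t ^ (e + 2 * ((s + r : ℕ) : ℤ)) * (t ^ e * (t ^ 2) ^ s) =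
            t ^ (2 * (e + r + 2 * (s : ℤ))) := by
          rw [← pow_mul, ← zpow_natCast, ← zpow_add₀ ht, ← zpow_add₀ ht]
          congr 1
          push_cast
          ring
        have e2 : t ^ (e + 2 * ((s + r : ℕ) : ℤ)) = (t ^ 2) ^ r * t ^ (e + 2 * (s : ℤ)) := by
          rw [← pow_mul, ← zpow_natCast, ← zpow_add₀ ht]
          congr 1
          push_cast
          ring
        have f4 : x * (x ^ r * κ ^ s * l) = x ^ (r + 1) * κ ^ s * l := by
          rw [← mul_assoc, ← mul_assoc, ← pow_succ']
        rw [add_mul, mul_add]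
        simp only [Algebra.TensorProduct.tmul_mul_tmul, mul_one, one_mul]
        rw [f1, f2, f3, f4, serreIter, TensorProduct.tmul_sub, TensorProduct.tmul_smul,
          ← TensorProduct.smul_tmul', ← TensorProduct.smul_tmul', smul_add, smul_smul, e1, sub_smul,
          one_smul, smul_sub, smul_smul, e2]
        abel
      rw [mul_add (x ⊗ₜ[F] (1 : B) + κ ⊗ₜ[F] x), add_mul (serreIter t e x y m ⊗ₜ[F] (1 : B)),
        smul_add,
        add_sub_add_comm, main, Finset.mul_sum, Finset.sum_mul,
        Finset.smul_sum, ← Finset.sum_sub_distrib, ← Finset.sum_add_distrib]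
      congr 1
      refine Finset.sum_congr rfl fun p hp => ?_
      have h := side p.1 p.2
      rw [Finset.HasAntidiagonal.mem_antidiagonal.mp hp] at h
      rw [mul_smul_comm, smul_mul_assoc, smul_comm, ← smul_sub, h, smul_add, smul_smul, smul_smul,
        mul_comm (comulCoeff t e p.1 p.2), mul_comm (comulCoeff t e p.1 p.2)]
    · intro r
      rw [comulCoeff_zero_left hT]
      simp
    · intro s
      simp [comulCoeff_zero_right hT]
    · intro s r
      rw [comulCoeff_succ_succ ht hT, add_smul]

/-- At the Serre exponent the last factor of the product is `1 - t ^ 0`. -/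
theorem comulCoeff_eq_zero {n s r : ℕ} (hn : (n : ℤ) = 1 - e) (hsr : s + (r + 1) = n) :
    comulCoeff t e s (r + 1) = 0 := by
  rw [comulCoeff, Finset.prod_range_succ, show e + s + r = 0 by omega]
  simp

/-- The coproduct respects the quantum Serre relations. -/
theorem qSerre_comul (ht : t ≠ 0) (hT : ∀ n : ℕ, 0 < n → (t ^ 2) ^ n ≠ 1)
    (hx : κ * x = t ^ 2 • (x * κ)) (hy : κ * y = t ^ e • (y * κ)) (hlx : l * x = t ^ e • (x * l))
    (hκl : κ * l = l * κ) {n : ℕ} (hn : (n : ℤ) = 1 - e) (h0 : qSerre t n x y = 0) :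
    qSerre t n (x ⊗ₜ[F] (1 : B) + κ ⊗ₜ[F] x) (y ⊗ₜ[F] (1 : B) + l ⊗ₜ[F] y) = 0 := by
  rw [qSerre_eq ht hT hn] at h0 ⊢
  rw [serreIter_comul ht hT hx hy hlx hκl, h0, TensorProduct.zero_tmul, zero_add]
  -- For `r = 0` the second leg is the Serre element itself; for `r > 0` the coefficient vanishes.
  refine Finset.sum_eq_zero fun p hp => ?_
  obtain ⟨s, r⟩ := p
  have hp := Finset.HasAntidiagonal.mem_antidiagonal.mp hp
  cases r with
  | zero =>
    obtain rfl : s = n := hp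
    simp [h0]
  | succ r => rw [comulCoeff_eq_zero hn hp, zero_smul]

variable {κ' l' : B}

theorem qComm_inv {c : F} {x κ κ' : B} (hκ : κ * κ' = 1) (hκ' : κ' * κ = 1)
    (h : κ * x = c • (x * κ)) : x * κ' = c • (κ' * x) := by
  calc x * κ' = κ' * (κ * x) * κ' := by rw [← mul_assoc κ', hκ', one_mul]
    _ = c • (κ' * x) := by
      rw [h, mul_smul_comm, smul_mul_assoc, ← mul_assoc, mul_assoc, hκ, mul_one]

/-- Passing to the opposite algebra reverses the q-commutators, so `t` becomes `t⁻¹`; moving `κ'`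
and `l'` to the left supplies the compensating powers of `t`. -/
theorem serreIter_antipode (ht : t ≠ 0) (hκ : κ * κ' = 1) (hκ' : κ' * κ = 1) (hl : l * l' = 1)
    (hl' : l' * l = 1) (hx : κ * x = t ^ 2 • (x * κ)) (hy : κ * y = t ^ e • (y * κ))
    (hlx : l * x = t ^ e • (x * l)) (hκl : κ' * l' = l' * κ') (m : ℕ) :
    serreIter t⁻¹ e (MulOpposite.op (κ' * x)) (MulOpposite.op (l' * y)) m =
      (-1 : F) ^ m • MulOpposite.op (l' * κ' ^ m * serreIter t e x y m) := by
  induction m with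
  | zero => simp [serreIter]
  | succ m ih =>
    have h1 := qComm_inv hκ hκ' (mul_serreIter ht hx hy m)
    have h2 := qComm_inv hl hl' hlx
    have h3 := qComm_inv hκ hκ' hx
    have h4 : x * κ' ^ m = (t ^ 2) ^ m • (κ' ^ m * x) := by
      have := pow_qComm (F := F) (c := (t ^ 2)⁻¹) (x := x) (κ := κ')
        (by rw [h3, smul_smul, inv_mul_cancel₀ (pow_ne_zero 2 ht), one_smul]) m
      rw [this, smul_smul, ← mul_pow, mul_inv_cancel₀ (pow_ne_zero 2 ht), one_pow, one_smul]
    have hκlm : κ' * (l' * κ' ^ m) = l' * κ' ^ (m + 1) := by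
      rw [← mul_assoc, hκl, mul_assoc, ← pow_succ']
    set u := serreIter t e x y m with hu
    have f1 : l' * κ' ^ m * u * (κ' * x) =
        t ^ (e + 2 * (m : ℤ)) • (l' * κ' ^ (m + 1) * (u * x)) := by
      rw [← mul_assoc, mul_assoc _ u, h1, mul_smul_comm, smul_mul_assoc, pow_succ]
      simp only [mul_assoc]
    have f2 : κ' * x * (l' * κ' ^ m * u) =
        t ^ (e + 2 * (m : ℤ)) • (l' * κ' ^ (m + 1) * (x * u)) := by
      have : x * (l' * κ' ^ m * u) = t ^ (e + 2 * (m : ℤ)) • (l' * κ' ^ m * (x * u)) := by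
        rw [← mul_assoc, ← mul_assoc, h2, smul_mul_assoc, mul_assoc l', h4, mul_smul_comm,
          smul_smul, smul_mul_assoc]
        congr 1
        · rw [← pow_mul, ← zpow_natCast, ← zpow_add₀ ht]
          congr 1
        · simp only [mul_assoc]
      rw [mul_assoc, this, mul_smul_comm, ← mul_assoc, hκlm]
    rw [serreIter, ih, mul_smul_comm, smul_mul_assoc, ← MulOpposite.op_mul, ← MulOpposite.op_mul,
      f1, f2, serreIter, ← hu, MulOpposite.op_smul, MulOpposite.op_smul, smul_comm _ ((-1 : F) ^ m),
      ← smul_sub, smul_smul, inv_zpow, inv_mul_cancel₀ (zpow_ne_zero _ ht), one_smul,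
      pow_succ (-1 : F), mul_smul, neg_one_smul, mul_sub, mul_smul_comm,
        MulOpposite.op_sub, neg_sub,
      MulOpposite.op_smul]

/-- The antipode respects the quantum Serre relations. -/
theorem qSerre_antipode (ht : t ≠ 0) (hT : ∀ n : ℕ, 0 < n → (t ^ 2) ^ n ≠ 1) (hκ : κ * κ' = 1)
    (hκ' : κ' * κ = 1) (hl : l * l' = 1)
    (hl' : l' * l = 1) (hx : κ * x = t ^ 2 • (x * κ)) (hy : κ * y = t ^ e • (y * κ))
    (hlx : l * x = t ^ e • (x * l)) (hκl : κ' * l' = l' * κ') {n : ℕ} (hn : (n : ℤ) = 1 - e)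
    (h0 : qSerre t n x y = 0) :
    qSerre t n (MulOpposite.op (κ' * x)) (MulOpposite.op (l' * y)) = 0 := by
  have hT' (n : ℕ) (hn : 0 < n) : (t⁻¹ ^ 2) ^ n ≠ 1 := by
    rw [inv_pow, inv_pow, Ne, inv_eq_one]
    exact hT n hn
  rw [qSerre_eq ht hT hn] at h0
  -- The quantum binomials are invariant under `t ↦ t⁻¹`, hence so is the Serre expression.
  rw [← qSerre_inv, qSerre_eq (inv_ne_zero ht) hT' hn,
    serreIter_antipode ht hκ hκ' hl hl' hx hy hlx hκl, h0]
  simp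

end SerreComul

/-! ### Coproduct, counit and antipode on the presentation of U_q -/

section UqMaps

variable {F : Type*} [Field F] {ι : Type*}

/-- The family `φ` of elements of `B` satisfies the relations of the quantized enveloping
algebra. -/
structure SatisfiesRel (q : F) (a : Matrix ι ι ℤ) (d : ι → ℕ) {B : Type*} [Ring B] [Algebra F B]
    (φ : Gen ι → B) : Prop where
  K_mul_Kinv (i : ι) : φ (.K i) * φ (.Kinv i) = 1
  Kinv_mul_K (i : ι) : φ (.Kinv i) * φ (.K i) = 1
  K_comm (i j : ι) : φ (.K i) * φ (.K j) = φ (.K j) * φ (.K i)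
  K_E (i j : ι) : φ (.K i) * φ (.E j) = q ^ ((d i : ℤ) * a i j) • (φ (.E j) * φ (.K i))
  K_F (i j : ι) : φ (.K i) * φ (.F j) = q ^ (-((d i : ℤ) * a i j)) • (φ (.F j) * φ (.K i))
  E_F_self (i : ι) : φ (.E i) * φ (.F i) - φ (.F i) * φ (.E i) =
    (q ^ d i - (q ^ d i)⁻¹)⁻¹ • (φ (.K i) - φ (.Kinv i))
  E_F_ne (i j : ι) (h : i ≠ j) : φ (.E i) * φ (.F j) = φ (.F j) * φ (.E i)
  serre_E (i j : ι) (h : i ≠ j) : qSerre (q ^ d i) (1 - a i j).toNat (φ (.E i)) (φ (.E j)) = 0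
  serre_F (i j : ι) (h : i ≠ j) : qSerre (q ^ d i) (1 - a i j).toNat (φ (.F i)) (φ (.F j)) = 0

variable {q : F} {a : Matrix ι ι ℤ} {d : ι → ℕ} {B : Type*} [Ring B] [Algebra F B] {φ : Gen ι → B}

theorem SatisfiesRel.lift_eq (h : SatisfiesRel q a d φ) ⦃x y : FreeAlgebra F (Gen ι)⦄
    (hxy : Rel q a d x y) : FreeAlgebra.lift F φ x = FreeAlgebra.lift F φ y := by
  induction hxy with
  | K_mul_Kinv i => simpa using h.K_mul_Kinv i
  | Kinv_mul_K i => simpa using h.Kinv_mul_K i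
  | K_comm i j => simpa using h.K_comm i j
  | K_E i j => simpa using h.K_E i j
  | K_F i j => simpa using h.K_F i j
  | E_F_self i => simpa using h.E_F_self i
  | E_F_ne i j hij => simpa using h.E_F_ne i j hij
  | serre_E i j hij => simpa [map_qSerre] using h.serre_E i j hij
  | serre_F i j hij => simpa [map_qSerre] using h.serre_F i j hij

/-- The algebra map on the quantized enveloping algebra with prescribed values on the generators. -/
def Uq.lift (h : SatisfiesRel q a d φ) : Uq q a d →ₐ[F] B :=
  RingQuot.liftAlgHom F ⟨FreeAlgebra.lift F φ, h.lift_eq⟩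

theorem Uq.lift_gen (h : SatisfiesRel q a d φ) (x : Gen ι) :
    Uq.lift h (gen q a d x) = φ x := by
  have := RingQuot.liftAlgHom_mkAlgHom_apply (S := F) (FreeAlgebra.lift F φ)
    (s := Rel q a d) h.lift_eq (FreeAlgebra.ι F x)
  rw [FreeAlgebra.lift_ι_apply] at this
  exact this

theorem satisfiesRel_gen : SatisfiesRel q a d (gen q a d) := by
  have rel {x y : FreeAlgebra F (Gen ι)} (h : Rel q a d x y) : Uq.mk q a d x = Uq.mk q a d y :=
    RingQuot.mkAlgHom_rel F h
  constructor
  · intro i; simpa [gen] using rel (.K_mul_Kinv i)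
  · intro i; simpa [gen] using rel (.Kinv_mul_K i)
  · intro i j; simpa [gen] using rel (.K_comm i j)
  · intro i j; simpa [gen] using rel (.K_E i j)
  · intro i j; simpa [gen] using rel (.K_F i j)
  · intro i; simpa [gen] using rel (.E_F_self i)
  · intro i j h; simpa [gen] using rel (.E_F_ne i j h)
  · intro i j h; simpa [gen, map_qSerre] using rel (.serre_E i j h)
  · intro i j h; simpa [gen, map_qSerre] using rel (.serre_F i j h)

namespace SatisfiesRel

variable (h : SatisfiesRel q a d φ)
include h

theorem commute_Kinv {x : B} {i : ι} (hx : x * φ (.K i) = φ (.K i) * x) :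
    x * φ (.Kinv i) = φ (.Kinv i) * x := by
  have := qComm_inv (F := F) (c := 1) (h.K_mul_Kinv i) (h.Kinv_mul_K i) (x := x)
    (by rw [one_smul, hx])
  rwa [one_smul] at this

theorem Kinv_comm (i j : ι) : φ (.Kinv i) * φ (.Kinv j) = φ (.Kinv j) * φ (.Kinv i) :=
  h.commute_Kinv (h.commute_Kinv (h.K_comm j i)).symm

theorem Kinv_F (hq : q ≠ 0) (i j : ι) :
    φ (.Kinv i) * φ (.F j) = q ^ ((d i : ℤ) * a i j) • (φ (.F j) * φ (.Kinv i)) := by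
  rw [qComm_inv (h.K_mul_Kinv i) (h.Kinv_mul_K i) (h.K_F i j), smul_smul, ← zpow_add₀ hq,
    add_neg_cancel, zpow_zero, one_smul]

theorem Kinv_E (hq : q ≠ 0) (i j : ι) :
    φ (.Kinv i) * φ (.E j) = q ^ (-((d i : ℤ) * a i j)) • (φ (.E j) * φ (.Kinv i)) := by
  rw [qComm_inv (h.K_mul_Kinv i) (h.Kinv_mul_K i) (h.K_E i j), smul_smul, ← zpow_add₀ hq,
    neg_add_cancel, zpow_zero, one_smul]

omit h

theorem pow_eq (i j : ι) : q ^ ((d i : ℤ) * a i j) = (q ^ d i) ^ a i j := by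
  rw [zpow_mul, zpow_natCast]

theorem pow_eq_symm (ha : IsSymmetrizedCartan a d) (i j : ι) :
    q ^ ((d j : ℤ) * a j i) = (q ^ d i) ^ a i j := by
  rw [← ha.symm, zpow_mul, zpow_natCast]

theorem pow_eq_diag (ha : IsSymmetrizedCartan a d) (i : ι) :
    q ^ ((d i : ℤ) * a i i) = (q ^ d i) ^ 2 := by
  rw [pow_eq, ha.diag]
  exact zpow_ofNat _ 2

theorem not_root (ha : IsSymmetrizedCartan a d) (hr : ∀ n : ℕ, 0 < n → q ^ n ≠ 1) (i : ι) (n : ℕ)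
    (hn : 0 < n) : ((q ^ d i) ^ 2) ^ n ≠ 1 := by
  have := ha.d_pos i
  rw [← pow_mul, ← pow_mul]
  exact hr _ (by positivity)

theorem serre_degree (ha : IsSymmetrizedCartan a d) {i j : ι} (hij : i ≠ j) :
    ((1 - a i j).toNat : ℤ) = 1 - a i j :=
  Int.toNat_of_nonneg (by have := ha.offDiag_nonpos i j hij; omega)

end SatisfiesRel

/-- The coproducts of the generators. -/
def comulGen (φ : Gen ι → B) : Gen ι → B ⊗[F] B
  | .E i => φ (.E i) ⊗ₜ 1 + φ (.K i) ⊗ₜ φ (.E i)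
  | .F i => φ (.F i) ⊗ₜ φ (.Kinv i) + 1 ⊗ₜ φ (.F i)
  | .K i => φ (.K i) ⊗ₜ φ (.K i)
  | .Kinv i => φ (.Kinv i) ⊗ₜ φ (.Kinv i)

theorem SatisfiesRel.comul (h : SatisfiesRel q a d φ) (ha : IsSymmetrizedCartan a d) (hq : q ≠ 0)
    (hr : ∀ n : ℕ, 0 < n → q ^ n ≠ 1) : SatisfiesRel q a d (comulGen (F := F) φ) where
  K_mul_Kinv i := by simp [comulGen, h.K_mul_Kinv, Algebra.TensorProduct.one_def]
  Kinv_mul_K i := by simp [comulGen, h.Kinv_mul_K, Algebra.TensorProduct.one_def]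
  K_comm i j := by simp [comulGen, h.K_comm i j]
  K_E i j := by
    simp [comulGen, mul_add, add_mul, h.K_E i j, h.K_comm i j, TensorProduct.smul_tmul']
  K_F i j := by
    simp [comulGen, mul_add, add_mul, h.K_F i j, h.commute_Kinv (h.K_comm i j),
      TensorProduct.smul_tmul']
  E_F_self i := by
    have h1 : φ (.E i) * φ (.F i) = φ (.F i) * φ (.E i) +
        (q ^ d i - (q ^ d i)⁻¹)⁻¹ • (φ (.K i) - φ (.Kinv i)) := by
      rw [← h.E_F_self i]; abel
    simp only [comulGen, mul_add, add_mul, Algebra.TensorProduct.tmul_mul_tmul, one_mul, mul_one,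
      h1, h.K_F i i, h.Kinv_E hq i i, TensorProduct.add_tmul, TensorProduct.tmul_add,
      ← TensorProduct.smul_tmul', TensorProduct.tmul_smul, TensorProduct.sub_tmul,
      TensorProduct.tmul_sub, smul_sub]
    abel
  E_F_ne i j hij := by
    have e : q ^ ((d j : ℤ) * a j i) = q ^ ((d i : ℤ) * a i j) := by rw [ha.symm]
    simp only [comulGen, mul_add, add_mul, Algebra.TensorProduct.tmul_mul_tmul, one_mul, mul_one,
      h.E_F_ne i j hij, h.K_F i j, h.Kinv_E hq j i, ← TensorProduct.smul_tmul',
      TensorProduct.tmul_smul, zpow_neg, e]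
    abel
  serre_E i j hij := by
    refine qSerre_comul (pow_ne_zero _ hq) (SatisfiesRel.not_root ha hr i) ?_ ?_ ?_
      (h.K_comm i j) (SatisfiesRel.serre_degree ha hij) (h.serre_E i j hij)
    · rw [h.K_E, SatisfiesRel.pow_eq_diag ha]
    · rw [h.K_E, SatisfiesRel.pow_eq]
    · rw [h.K_E, SatisfiesRel.pow_eq_symm ha]
  serre_F i j hij := by
    -- With its tensor factors exchanged, the coproduct of `F i` has the shape of that of `E i` with
    -- `Kinv i` in the place of `K i`.
    have := qSerre_comul (pow_ne_zero _ hq) (SatisfiesRel.not_root ha hr i)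
      (x := φ (.F i)) (y := φ (.F j)) (κ := φ (.Kinv i)) (l := φ (.Kinv j)) ?_ ?_ ?_
      (h.Kinv_comm i j) (SatisfiesRel.serre_degree ha hij) (h.serre_F i j hij)
    · have := congrArg (Algebra.TensorProduct.comm F B B) this
      rw [← AlgEquiv.coe_toAlgHom, map_qSerre] at this
      simpa [comulGen, add_comm] using this
    · rw [h.Kinv_F hq, SatisfiesRel.pow_eq_diag ha]
    · rw [h.Kinv_F hq, SatisfiesRel.pow_eq]
    · rw [h.Kinv_F hq, SatisfiesRel.pow_eq_symm ha]

/-- The counits of the generators. -/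
def counitGen (F : Type*) [Field F] : Gen ι → F
  | .E _ => 0
  | .F _ => 0
  | .K _ => 1
  | .Kinv _ => 1

theorem qSerre_zero_right (t : F) (n : ℕ) (x : B) : qSerre t n x 0 = 0 := by
  simp [qSerre]

theorem satisfiesRel_counit : SatisfiesRel q a d (counitGen (ι := ι) F) where
  K_mul_Kinv i := by simp [counitGen]
  Kinv_mul_K i := by simp [counitGen]
  K_comm i j := by simp [counitGen]
  K_E i j := by simp [counitGen]
  K_F i j := by simp [counitGen]
  E_F_self i := by simp [counitGen]
  E_F_ne i j hij := by simp [counitGen]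
  serre_E i j hij := qSerre_zero_right _ _ _
  serre_F i j hij := qSerre_zero_right _ _ _

/-- The antipodes of the generators. -/
def antipodeGen (φ : Gen ι → B) : Gen ι → Bᵐᵒᵖ
  | .E i => .op (-(φ (.Kinv i) * φ (.E i)))
  | .F i => .op (-(φ (.F i) * φ (.K i)))
  | .K i => .op (φ (.Kinv i))
  | .Kinv i => .op (φ (.K i))

theorem SatisfiesRel.antipode (h : SatisfiesRel q a d φ) (ha : IsSymmetrizedCartan a d)
    (hq : q ≠ 0) (hr : ∀ n : ℕ, 0 < n → q ^ n ≠ 1) : SatisfiesRel q a d (antipodeGen φ) where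
  K_mul_Kinv i := by simp [antipodeGen, ← MulOpposite.op_mul, h.K_mul_Kinv]
  Kinv_mul_K i := by simp [antipodeGen, ← MulOpposite.op_mul, h.Kinv_mul_K]
  K_comm i j := by simp [antipodeGen, ← MulOpposite.op_mul, h.Kinv_comm i j]
  K_E i j := by
    rw [antipodeGen, antipodeGen, ← MulOpposite.op_mul, ← MulOpposite.op_mul, ← MulOpposite.op_smul]
    rw [neg_mul, mul_neg, smul_neg, mul_assoc, qComm_inv (h.K_mul_Kinv i) (h.Kinv_mul_K i)
      (h.K_E i j), mul_smul_comm, ← mul_assoc, h.Kinv_comm, mul_assoc]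
  K_F i j := by
    rw [antipodeGen, antipodeGen, ← MulOpposite.op_mul, ← MulOpposite.op_mul, ← MulOpposite.op_smul]
    rw [neg_mul, mul_neg, smul_neg, mul_assoc, h.commute_Kinv (h.K_comm j i), ← mul_assoc,
      qComm_inv (h.K_mul_Kinv i) (h.Kinv_mul_K i) (h.K_F i j), smul_mul_assoc, mul_assoc]
  E_F_self i := by
    rw [antipodeGen, antipodeGen, ← MulOpposite.op_mul, ← MulOpposite.op_mul, antipodeGen,
      antipodeGen, ← MulOpposite.op_sub, ← MulOpposite.op_sub, ← MulOpposite.op_smul]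
    congr 1
    have e1 : φ (.F i) * φ (.K i) * (φ (.Kinv i) * φ (.E i)) = φ (.F i) * φ (.E i) := by
      rw [mul_assoc, ← mul_assoc (φ (.K i)), h.K_mul_Kinv, one_mul]
    have e2 : φ (.Kinv i) * φ (.E i) * (φ (.F i) * φ (.K i)) = φ (.E i) * φ (.F i) := by
      rw [h.Kinv_E hq, smul_mul_assoc, mul_assoc, ← mul_assoc (φ (.Kinv i)), h.Kinv_F hq,
        smul_mul_assoc, mul_smul_comm, smul_smul, ← zpow_add₀ hq, neg_add_cancel, zpow_zero,
        one_smul, mul_assoc (φ (.F i)), h.Kinv_mul_K, mul_one]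
    rw [neg_mul_neg, neg_mul_neg, e1, e2, ← neg_sub, h.E_F_self, ← smul_neg, neg_sub]
  E_F_ne i j hij := by
    rw [antipodeGen, antipodeGen, ← MulOpposite.op_mul, ← MulOpposite.op_mul, neg_mul_neg,
      neg_mul_neg]
    congr 1
    have e : q ^ ((d j : ℤ) * a j i) = q ^ ((d i : ℤ) * a i j) := by rw [ha.symm]
    have e1 : φ (.E i) * (φ (.F j) * φ (.K j)) =
        q ^ (-((d i : ℤ) * a i j)) • (φ (.F j) * (φ (.K j) * φ (.E i))) := by
      rw [h.K_E, mul_smul_comm, smul_smul, e, ← zpow_add₀ hq, neg_add_cancel, zpow_zero, one_smul,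
        ← mul_assoc, ← mul_assoc, h.E_F_ne i j hij]
    have e2 : φ (.Kinv i) * (φ (.F j) * (φ (.K j) * φ (.E i))) =
        q ^ ((d i : ℤ) * a i j) • (φ (.F j) * φ (.K j) * (φ (.Kinv i) * φ (.E i))) := by
      rw [← mul_assoc, h.Kinv_F hq, smul_mul_assoc, mul_assoc, ← mul_assoc (φ (.Kinv i)),
        ← h.commute_Kinv (h.K_comm j i), mul_assoc, mul_assoc]
    rw [mul_assoc (φ (.Kinv i)), e1, mul_smul_comm, e2, smul_smul, ← zpow_add₀ hq, neg_add_cancel,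
      zpow_zero, one_smul]
  serre_E i j hij := by
    have := qSerre_antipode (pow_ne_zero _ hq) (SatisfiesRel.not_root ha hr i)
      (x := φ (.E i)) (y := φ (.E j)) (κ := φ (.K i)) (l := φ (.K j)) (κ' := φ (.Kinv i))
      (l' := φ (.Kinv j)) (h.K_mul_Kinv i) (h.Kinv_mul_K i) (h.K_mul_Kinv j) (h.Kinv_mul_K j)
      ?_ ?_ ?_ (h.Kinv_comm i j) (SatisfiesRel.serre_degree ha hij) (h.serre_E i j hij)
    · have e (i : ι) : antipodeGen φ (.E i) =
          (-1 : F) • MulOpposite.op (φ (.Kinv i) * φ (.E i)) := by simp [antipodeGen]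
      rw [e, e, qSerre_smul_smul, this, smul_zero]
    · rw [h.K_E, SatisfiesRel.pow_eq_diag ha]
    · rw [h.K_E, SatisfiesRel.pow_eq]
    · rw [h.K_E, SatisfiesRel.pow_eq_symm ha]
  serre_F i j hij := by
    have := qSerre_antipode (pow_ne_zero _ hq) (SatisfiesRel.not_root ha hr i)
      (x := φ (.F i)) (y := φ (.F j)) (κ := φ (.Kinv i)) (l := φ (.Kinv j)) (κ' := φ (.K i))
      (l' := φ (.K j)) (h.Kinv_mul_K i) (h.K_mul_Kinv i) (h.Kinv_mul_K j) (h.K_mul_Kinv j)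
      ?_ ?_ ?_ (h.K_comm i j) (SatisfiesRel.serre_degree ha hij) (h.serre_F i j hij)
    -- The element `F i * K i` is brought into the form `κ' * x` at the cost of a scalar, which
    -- factors out of the Serre expression.
    · have e (i : ι) : antipodeGen φ (.F i) =
          (-q ^ ((d i : ℤ) * a i i)) • MulOpposite.op (φ (.K i) * φ (.F i)) := by
        rw [h.K_F, ← MulOpposite.op_smul, smul_smul, neg_mul, ← zpow_add₀ hq, add_neg_cancel,
          zpow_zero, neg_one_smul]
        rfl
      rw [e, e, qSerre_smul_smul, this, smul_zero]
    · rw [h.Kinv_F hq, SatisfiesRel.pow_eq_diag ha]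
    · rw [h.Kinv_F hq, SatisfiesRel.pow_eq]
    · rw [h.Kinv_F hq, SatisfiesRel.pow_eq_symm ha]

end UqMaps

/-! ### The grading by Laurent monomials -/

section Grading

variable {F : Type*} [Field F] {B : Type*} [Ring B] [Algebra F B]

theorem qSerre_mul_central (t : F) (n : ℕ) (x y : B) {z w : B} (hz : ∀ b, Commute z b)
    (hw : ∀ b, Commute w b) : qSerre t n (x * z) (y * w) = qSerre t n x y * (z ^ n * w) := by
  rw [qSerre, qSerre, Finset.sum_mul]
  refine Finset.sum_congr rfl fun s hs => ?_
  have hs : s ≤ n := Nat.lt_succ_iff.mp (Finset.mem_range.mp hs)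
  rw [smul_mul_assoc]
  congr 1
  rw [(hz x).symm.mul_pow, (hz x).symm.mul_pow]
  calc x ^ (n - s) * z ^ (n - s) * (y * w) * (x ^ s * z ^ s)
      = x ^ (n - s) * (z ^ (n - s) * y) * (w * (x ^ s * z ^ s)) := by simp only [mul_assoc]
    _ = x ^ (n - s) * y * (z ^ (n - s) * (x ^ s * (z ^ s * w))) := by
      rw [((hz y).pow_left _).eq, (hw _).eq]; simp only [mul_assoc]
    _ = x ^ (n - s) * y * x ^ s * (z ^ (n - s) * z ^ s * w) := by
      rw [← mul_assoc (z ^ (n - s)), ((hz _).pow_left _).eq]; simp only [mul_assoc]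
    _ = x ^ (n - s) * y * x ^ s * (z ^ n * w) := by rw [← pow_add, Nat.sub_add_cancel hs]

variable (F B) in
/-- The inclusion of the constant Laurent polynomials. -/
def laurentC : B →ₐ[F] LaurentPolynomial B := AddMonoidAlgebra.singleZeroAlgHom

theorem laurentC_apply (b : B) : laurentC F B b = LaurentPolynomial.C b := rfl

variable {ι : Type*} {q : F} {a : Matrix ι ι ℤ} {d : ι → ℕ} {φ : Gen ι → B}

/-- The generators as homogeneous Laurent polynomials. -/
def gradingGen (d : ι → ℕ) (φ : Gen ι → B) : Gen ι → LaurentPolynomial B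
  | .E i => LaurentPolynomial.C (φ (.E i)) * LaurentPolynomial.T (d i)
  | .F i => LaurentPolynomial.C (φ (.F i)) * LaurentPolynomial.T (-d i)
  | .K i => LaurentPolynomial.C (φ (.K i))
  | .Kinv i => LaurentPolynomial.C (φ (.Kinv i))

theorem mul_T_mul_T (f g : LaurentPolynomial B) (m n : ℤ) :
    f * LaurentPolynomial.T m * (g * LaurentPolynomial.T n) =
      f * g * LaurentPolynomial.T (m + n) := by
  rw [LaurentPolynomial.T_add, mul_assoc, ← mul_assoc _ g, (LaurentPolynomial.commute_T m g).eq]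
  simp only [mul_assoc]

/-- Every relation is homogeneous when `E i` and `F i` have degrees `d i` and `-d i`. The negative
degrees call for Laurent polynomials; on the positive part ordinary polynomials remain. -/
theorem SatisfiesRel.grading (h : SatisfiesRel q a d φ) : SatisfiesRel q a d (gradingGen d φ) where
  K_mul_Kinv i := by simp [gradingGen, ← map_mul, h.K_mul_Kinv]
  Kinv_mul_K i := by simp [gradingGen, ← map_mul, h.Kinv_mul_K]
  K_comm i j := by simp [gradingGen, ← map_mul, h.K_comm i j]
  K_E i j := by
    simp only [gradingGen]
    rw [mul_assoc (LaurentPolynomial.C _) (LaurentPolynomial.T _),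
      (LaurentPolynomial.commute_T _ _).eq, ← mul_assoc, ← mul_assoc, ← smul_mul_assoc]
    simp only [← laurentC_apply (F := F), ← map_mul, ← map_smul, h.K_E i j]
  K_F i j := by
    simp only [gradingGen]
    rw [mul_assoc (LaurentPolynomial.C _) (LaurentPolynomial.T _),
      (LaurentPolynomial.commute_T _ _).eq, ← mul_assoc, ← mul_assoc, ← smul_mul_assoc]
    simp only [← laurentC_apply (F := F), ← map_mul, ← map_smul, h.K_F i j]
  E_F_self i := by
    simp only [gradingGen, mul_T_mul_T, add_neg_cancel, neg_add_cancel, LaurentPolynomial.T_zero,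
      mul_one]
    simp only [← laurentC_apply (F := F), ← map_mul, ← map_sub, ← map_smul, h.E_F_self i]
  E_F_ne i j hij := by
    simp only [gradingGen, mul_T_mul_T, ← map_mul, h.E_F_ne i j hij]
    rw [add_comm]
  serre_E i j hij := by
    simp only [gradingGen]
    rw [qSerre_mul_central _ _ _ _ (LaurentPolynomial.commute_T _) (LaurentPolynomial.commute_T _),
      ← laurentC_apply (F := F), ← laurentC_apply (F := F), ← map_qSerre, h.serre_E i j hij,
      map_zero, zero_mul]
  serre_F i j hij := by
    simp only [gradingGen]
    rw [qSerre_mul_central _ _ _ _ (LaurentPolynomial.commute_T _) (LaurentPolynomial.commute_T _),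
      ← laurentC_apply (F := F), ← laurentC_apply (F := F), ← map_qSerre, h.serre_F i j hij,
      map_zero, zero_mul]

end Grading

/-! ### Restriction to the positive part -/

section Restriction

variable {k : Type*} [Field k] {U : Type*} [Ring U] [Algebra k U] {ι : Type*}

/-- An algebra map with prescribed image on generators of a subalgebra factors over that
subalgebra. -/
theorem exists_algHom_of_adjoin {R C C₀ : Type*} [CommRing R] [Algebra R U] [Ring C] [Algebra R C]
    [Ring C₀] [Algebra R C₀] (f : U →ₐ[R] C) {j : C₀ →ₐ[R] C} (hj : Function.Injective j)
    {s : Set U} {A : Subalgebra R U} (hA : A = Algebra.adjoin R s)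
    (hs : ∀ x ∈ s, f x ∈ j.range) : ∃ g : A →ₐ[R] C₀, ∀ x, j (g x) = f x := by
  have hle : A ≤ j.range.comap f := by
    rw [hA]
    exact Algebra.adjoin_le hs
  let e := AlgEquiv.ofInjective j hj
  let f' : A →ₐ[R] j.range := (f.comp A.val).codRestrict j.range fun x => hle x.2
  refine ⟨e.symm.toAlgHom.comp f', fun x => ?_⟩
  have h : ((e (e.symm (f' x)) : j.range) : C) = f x := by
    rw [e.apply_symm_apply]
    rfl
  exact h

/-- The inclusion of the polynomials over a subalgebra into the Laurent polynomials. -/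
def polynomialInclusion (A : Subalgebra k U) : Polynomial A →ₐ[k] LaurentPolynomial U :=
  { Polynomial.toLaurent.comp (Polynomial.mapRingHom (A.val : A →+* U)) with
    commutes' := fun c => by
      change Polynomial.toLaurent (Polynomial.map _ (algebraMap k (Polynomial A) c)) = _
      rw [Polynomial.algebraMap_apply, Polynomial.map_C, Polynomial.toLaurent_C]
      rfl }

theorem polynomialInclusion_apply (A : Subalgebra k U) (f : Polynomial A) :
    polynomialInclusion A f = Polynomial.toLaurent (f.map (A.val : A →+* U)) := rfl

theorem polynomialInclusion_injective (A : Subalgebra k U) :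
    Function.Injective (polynomialInclusion A) :=
  Polynomial.toLaurent_injective.comp (Polynomial.map_injective _ Subtype.val_injective)

/-- The elements `E i` and `K i ^ ±1` of the algebra `U` have commutation relations as in a quantum
group, and `U` admits algebra maps which are the standard coproduct, counit and antipode on these
elements and a grading with the `E i` in degree `d i`. -/
structure HasPositiveMaps (q : k) (d : ι → ℕ) (E K Kinv : ι → U) : Prop where
  K_mul_Kinv : ∀ i, K i * Kinv i = 1
  Kinv_mul_K : ∀ i, Kinv i * K i = 1
  K_comm : ∀ i j, K i * K j = K j * K i
  K_E : ∀ i, K i * E i = (q ^ 2) ^ d i • (E i * K i)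
  comul : ∃ Δ : U →ₐ[k] U ⊗[k] U, (∀ i, Δ (E i) = E i ⊗ₜ 1 + K i ⊗ₜ E i) ∧
    (∀ i, Δ (K i) = K i ⊗ₜ K i) ∧ ∀ i, Δ (Kinv i) = Kinv i ⊗ₜ Kinv i
  counit : ∃ ε : U →ₐ[k] k, (∀ i, ε (E i) = 0) ∧ ∀ i, ε (K i) = 1
  antipode : ∃ S : U →ₐ[k] Uᵐᵒᵖ, (∀ i, S (E i) = .op (-(Kinv i * E i))) ∧
    (∀ i, S (K i) = .op (Kinv i)) ∧ ∀ i, S (Kinv i) = .op (K i)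
  grading : ∃ γ : U →ₐ[k] LaurentPolynomial U,
    (∀ i, γ (E i) = LaurentPolynomial.C (E i) * LaurentPolynomial.T (d i)) ∧
    (∀ i, γ (K i) = LaurentPolynomial.C (K i)) ∧ ∀ i, γ (Kinv i) = LaurentPolynomial.C (Kinv i)

/-- Each map restricts to the subalgebra as soon as the images of the generators lie in a subobject
of the target. Over a field the tensor square of a subalgebra is such a subobject, and the absence
of the `F i` keeps the grading polynomial. -/
theorem HasPositiveMaps.isPositivePart {q : k} {d : ι → ℕ} {A : Subalgebra k U}
    {E K Kinv : ι → A} (h : HasPositiveMaps q d (fun i => (E i : U)) (fun i => (K i : U))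
      (fun i => (Kinv i : U)))
    (hA : A = Algebra.adjoin k (Set.range (fun i => (E i : U)) ∪ Set.range (fun i => (K i : U)) ∪
      Set.range (fun i => (Kinv i : U)))) : IsPositivePart q d E K Kinv where
  K_mul_Kinv i := Subtype.ext (h.K_mul_Kinv i)
  Kinv_mul_K i := Subtype.ext (h.Kinv_mul_K i)
  K_comm i j := Subtype.ext (h.K_comm i j)
  K_E i := Subtype.ext (h.K_E i)
  adjoin := by
    apply Subalgebra.map_injective (f := A.val) Subtype.val_injective
    rw [AlgHom.map_adjoin, Algebra.map_top, Subalgebra.range_val, Set.image_union, Set.image_union,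
      ← Set.range_comp, ← Set.range_comp, ← Set.range_comp]
    exact hA.symm
  comul := by
    obtain ⟨Δ, hE, hK, hKinv⟩ := h.comul
    have hj : Function.Injective (Algebra.TensorProduct.map A.val A.val) :=
      TensorProduct.map_injective_of_flat_flat A.val.toLinearMap A.val.toLinearMap
        Subtype.val_injective Subtype.val_injective
    obtain ⟨g, hg⟩ := exists_algHom_of_adjoin Δ hj hA (by
      rintro _ ((⟨i, rfl⟩ | ⟨i, rfl⟩) | ⟨i, rfl⟩)
      · exact ⟨E i ⊗ₜ 1 + K i ⊗ₜ E i, by simp [hE]⟩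
      · exact ⟨K i ⊗ₜ K i, by simp [hK]⟩
      · exact ⟨Kinv i ⊗ₜ Kinv i, by simp [hKinv]⟩)
    exact ⟨g, fun i => hj (by simp [hg, hE]), fun i => hj (by simp [hg, hK])⟩
  counit := by
    obtain ⟨ε, hE, hK⟩ := h.counit
    exact ⟨ε.comp A.val, hE, hK⟩
  antipode := by
    obtain ⟨S, hE, hK, hKinv⟩ := h.antipode
    have hj : Function.Injective (AlgHom.op A.val) :=
      MulOpposite.op_injective.comp (Subtype.val_injective.comp MulOpposite.unop_injective)
    obtain ⟨g, hg⟩ := exists_algHom_of_adjoin S hj hA (by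
      rintro _ ((⟨i, rfl⟩ | ⟨i, rfl⟩) | ⟨i, rfl⟩)
      · exact ⟨.op (-(Kinv i * E i)), by simp [hE]⟩
      · exact ⟨.op (Kinv i), by simp [hK]⟩
      · exact ⟨.op (K i), by simp [hKinv]⟩)
    exact ⟨g, fun i => hj (by simp [hg, hE]), fun i => hj (by simp [hg, hK])⟩
  grading := by
    obtain ⟨γ, hE, hK, hKinv⟩ := h.grading
    have hj := polynomialInclusion_injective A
    obtain ⟨g, hg⟩ := exists_algHom_of_adjoin γ hj hA (by
      rintro _ ((⟨i, rfl⟩ | ⟨i, rfl⟩) | ⟨i, rfl⟩)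
      · exact ⟨Polynomial.C (E i) * Polynomial.X ^ d i, by simp [polynomialInclusion_apply, hE]⟩
      · exact ⟨Polynomial.C (K i), by simp [polynomialInclusion_apply, hK]⟩
      · exact ⟨Polynomial.C (Kinv i), by simp [polynomialInclusion_apply, hKinv]⟩)
    exact ⟨g, fun i => hj (by simp [hg, polynomialInclusion_apply, hE]),
      fun i => hj (by simp [hg, polynomialInclusion_apply, hK])⟩

variable {q : k} {a : Matrix ι ι ℤ} {d : ι → ℕ}

theorem pow_diag (ha : IsSymmetrizedCartan a d) (q : k) (i : ι) :
    q ^ ((d i : ℤ) * a i i) = (q ^ 2) ^ d i := by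
  rw [SatisfiesRel.pow_eq_diag ha, pow_right_comm]

theorem Uq.hasPositiveMaps (ha : IsSymmetrizedCartan a d) (hq : q ≠ 0)
    (hr : ∀ n : ℕ, 0 < n → q ^ n ≠ 1) :
    HasPositiveMaps q d (fun i => gen q a d (.E i)) (fun i => gen q a d (.K i))
      (fun i => gen q a d (.Kinv i)) := by
  have h := satisfiesRel_gen (q := q) (a := a) (d := d)
  refine ⟨h.K_mul_Kinv, h.Kinv_mul_K, h.K_comm, fun i => ?_, ?_, ?_, ?_, ?_⟩
  · rw [h.K_E, pow_diag ha]
  · exact ⟨Uq.lift (h.comul ha hq hr), fun i => Uq.lift_gen _ _, fun i => Uq.lift_gen _ _,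
      fun i => Uq.lift_gen _ _⟩
  · exact ⟨Uq.lift satisfiesRel_counit, fun i => Uq.lift_gen _ _, fun i => Uq.lift_gen _ _⟩
  · exact ⟨Uq.lift (h.antipode ha hq hr), fun i => Uq.lift_gen _ _, fun i => Uq.lift_gen _ _,
      fun i => Uq.lift_gen _ _⟩
  · exact ⟨Uq.lift h.grading, fun i => Uq.lift_gen _ _, fun i => Uq.lift_gen _ _,
      fun i => Uq.lift_gen _ _⟩

theorem UqPlus.isYBHopf (ha : IsSymmetrizedCartan a d) (hq : q ≠ 0)
    (hr : ∀ n : ℕ, 0 < n → q ^ n ≠ 1) : IsYBHopf k (UqPlus.E q a d) (UqPlus.K q a d) :=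
  (HasPositiveMaps.isPositivePart (A := UqPlus q a d) (E := UqPlus.E q a d) (K := UqPlus.K q a d)
    (Kinv := fun i => ⟨gen q a d (.Kinv i), Algebra.subset_adjoin (.inr ⟨i, rfl⟩)⟩)
    (Uq.hasPositiveMaps ha hq hr) rfl).isYBHopf hq ha.d_pos

end Restriction

/-! ### Lattices, specialization and divided powers -/

section Descent

/-- The tensor square of a lattice embeds in the tensor square of the ambient vector space. -/
theorem tensor_lattice_injective {R K U S : Type*} [CommRing R] [IsDedekindDomain R] [Field K]
    [Algebra R K] [IsFractionRing R K] [Ring U] [Algebra K U] [Algebra R U] [IsScalarTower R K U]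
    [Ring S] [Algebra R S] {i : S →ₐ[R] U} (hi : Function.Injective i) :
    Function.Injective ((Algebra.TensorProduct.mapOfCompatibleSMul K R R U U).comp
      (Algebra.TensorProduct.map i i)) := by
  -- Torsion-free modules over a Dedekind domain are flat, so the tensor squares over `R` embed; and
  -- over the fraction field nothing changes in the tensor square of `U`.
  have : Module.IsTorsionFree R U := Module.IsTorsionFree.trans_faithfulSMul R K U
  have : Module.IsTorsionFree R S := hi.moduleIsTorsionFree i (map_smul i)
  have : TensorProduct.CompatibleSMul R K U U :=
    IsLocalization.tensorProduct_compatibleSMul (nonZeroDivisors R) K U U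
  exact (Algebra.TensorProduct.equivOfCompatibleSMul K R R U U).injective.comp
    (TensorProduct.map_injective_of_flat_flat i.toLinearMap i.toLinearMap hi hi)

/-- The tensor square of a specialization. -/
theorem exists_tensor_specialization {R k S B : Type*} [CommRing R] [Field k] [Algebra k R]
    [Ring S] [Algebra R S] [Algebra k S] [IsScalarTower k R S] [Ring B] [Algebra k B]
    (χ : R →ₐ[k] k) (π : S →ₐ[k] B) (hπ : ∀ r, π (algebraMap R S r) = algebraMap k B (χ r)) :
    ∃ e : S ⊗[R] S →ₐ[k] B ⊗[k] B, ∀ x y, e (x ⊗ₜ y) = π x ⊗ₜ π y := by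
  -- `R` acts through `χ`, so that the universal property of the tensor product over `R` applies to
  -- this target.
  let : Algebra R (B ⊗[k] B) :=
    ((algebraMap k (B ⊗[k] B)).comp (χ : R →+* k)).toAlgebra' fun c x =>
      Algebra.commutes (χ c) x
  have key (r : R) : algebraMap R (B ⊗[k] B) r = algebraMap k (B ⊗[k] B) (χ r) := rfl
  have : IsScalarTower k R (B ⊗[k] B) := IsScalarTower.of_algebraMap_eq fun c => by
    rw [key, AlgHom.commutes]
    rfl
  let f : S →ₐ[R] B ⊗[k] B :=
    { Algebra.TensorProduct.includeLeft.comp π with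
      commutes' := fun r => by
        change π (algebraMap R S r) ⊗ₜ[k] (1 : B) = _
        rw [hπ, key, Algebra.TensorProduct.algebraMap_apply] }
  let g : S →ₐ[R] B ⊗[k] B :=
    { Algebra.TensorProduct.includeRight.comp π with
      commutes' := fun r => by
        change (1 : B) ⊗ₜ[k] π (algebraMap R S r) = _
        rw [hπ, key, Algebra.TensorProduct.algebraMap_apply'] }
  let e := Algebra.TensorProduct.lift f g fun x y => by
    change π x ⊗ₜ[k] (1 : B) * (1 : B) ⊗ₜ[k] π y = (1 : B) ⊗ₜ[k] π y * π x ⊗ₜ[k] (1 : B)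
    simp
  refine ⟨e.restrictScalars k, fun x y => ?_⟩
  change f x * g y = _
  change π x ⊗ₜ[k] (1 : B) * (1 : B) ⊗ₜ[k] π y = _
  simp

/-- The divided powers of a sum. -/
theorem dividedPow_add {F B : Type*} [Field F] [Ring B] [Algebra F B] {t : F} (ht : t ≠ 0)
    (hT : ∀ n : ℕ, 0 < n → (t ^ 2) ^ n ≠ 1) {x z : B} (hxz : z * x = t ^ 2 • (x * z)) (n : ℕ) :
    (qFact t n)⁻¹ • (x + z) ^ n = ∑ p ∈ Finset.HasAntidiagonal.antidiagonal n,
      t ^ (p.1 * p.2) • (((qFact t p.2)⁻¹ • x ^ p.2) * ((qFact t p.1)⁻¹ • z ^ p.1)) := by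
  rw [add_pow_of_qComm hT hxz, Finset.smul_sum]
  refine Finset.sum_congr rfl fun p hp => ?_
  have h1 := qFact_ne_zero ht hT p.1
  have h2 := qFact_ne_zero ht hT p.2
  have h3 := qFact_ne_zero ht hT n
  have h := gauss_mul_qFact ht hT p.1 p.2
  rw [Finset.HasAntidiagonal.mem_antidiagonal.mp hp] at h
  simp only [smul_mul_assoc, mul_smul_comm, smul_smul]
  congr 1
  field_simp
  linear_combination h

/-- Only the existence of the exponent matters: in the applications `c` is a power of `v` or of
`v⁻¹`, so that the scalar is harmless in the integral form. -/
theorem mul_pow_of_qComm {F B : Type*} [Field F] [Ring B] [Algebra F B] {c : F} {x κ : B}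
    (h : κ * x = c • (x * κ)) (n : ℕ) :
    ∃ m : ℕ, (x * κ) ^ n = c ^ m • (x ^ n * κ ^ n) := by
  induction n with
  | zero => exact ⟨0, by simp⟩
  | succ n ih =>
    obtain ⟨m, hm⟩ := ih
    refine ⟨m + n, ?_⟩
    rw [pow_succ, hm, smul_mul_assoc, mul_assoc, ← mul_assoc (κ ^ n), pow_qComm h, smul_mul_assoc,
      mul_smul_comm, smul_smul, ← pow_add, pow_succ, pow_succ]
    simp only [mul_assoc]

section RatFunc

variable {k : Type*} [Field k]

variable (k) in
theorem ratFunc_X_pow_ne_one (n : ℕ) (hn : 0 < n) : (RatFunc.X : RatFunc k) ^ n ≠ 1 := by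
  intro h
  have h' : algebraMap (Polynomial k) (RatFunc k) (Polynomial.X ^ n) =
      algebraMap (Polynomial k) (RatFunc k) 1 := by
    rw [map_pow, RatFunc.algebraMap_X, h, map_one]
  have := congrArg Polynomial.natDegree (RatFunc.algebraMap_injective k h')
  simp at this
  omega

/-- The rational functions without a pole at `q`. -/
def regularAt (q : k) : Subalgebra k (RatFunc k) where
  carrier := {f | f.denom.eval q ≠ 0}
  mul_mem' {x y} hx hy := by
    obtain ⟨r, hr⟩ := RatFunc.denom_mul_dvd x y
    refine fun h => mul_ne_zero hx hy ?_
    rw [← Polynomial.eval_mul, hr, Polynomial.eval_mul, h, zero_mul]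
  add_mem' {x y} hx hy := by
    obtain ⟨r, hr⟩ := RatFunc.denom_add_dvd x y
    refine fun h => mul_ne_zero hx hy ?_
    rw [← Polynomial.eval_mul, hr, Polynomial.eval_mul, h, zero_mul]
  algebraMap_mem' c := by simp

theorem X_mem_regularAt (q : k) : RatFunc.X ∈ regularAt q := by
  change Polynomial.eval q (RatFunc.denom RatFunc.X) ≠ 0
  simp

theorem X_inv_mem_regularAt {q : k} (hq : q ≠ 0) : (RatFunc.X)⁻¹ ∈ regularAt q := by
  obtain ⟨r, hr⟩ := RatFunc.denom_inv_dvd (RatFunc.X_ne_zero (K := k))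
  rw [RatFunc.num_X] at hr
  intro h
  apply hq
  simpa [h] using congrArg (Polynomial.eval q) hr

/-- The value at `q` of a rational function. -/
def evalAt (q : k) : regularAt q →ₐ[k] k where
  toFun f := RatFunc.eval (RingHom.id k) q (f : RatFunc k)
  map_one' := RatFunc.eval_one (f := RingHom.id k) (a := q)
  map_mul' x y := RatFunc.eval_mul (f := RingHom.id k) (a := q) x.2 y.2
  map_zero' := RatFunc.eval_zero (f := RingHom.id k) (a := q)
  map_add' x y := RatFunc.eval_add (f := RingHom.id k) (a := q) x.2 y.2
  commutes' _ := RatFunc.eval_C (f := RingHom.id k) (a := q)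

end RatFunc

end Descent

/-! ### Maps out of the specialized integral form -/

section IntegralForm

instance {R S F ι : Type*} [CommSemiring R] [CommSemiring S] [Field F] [Algebra R S] [Algebra S F]
    [Algebra R F] [IsScalarTower R S F] (q : F) (a : Matrix ι ι ℤ) (d : ι → ℕ) :
    IsScalarTower R S (Uq q a d) :=
  IsScalarTower.of_algebraMap_eq fun r =>
    congrArg (algebraMap F (Uq q a d)) (IsScalarTower.algebraMap_apply R S F r)

variable {k : Type*} [Field k] {ι : Type*} (a : Matrix ι ι ℤ) (d : ι → ℕ)

variable (k) in
/-- The element `E i` of the integral form. -/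
def intE (i : ι) : integralForm k a d := ⟨_, E_mem_integralForm a d i⟩

variable (k) in
/-- The element `K i` of the integral form. -/
def intK (i : ι) : integralForm k a d := ⟨_, K_mem_integralForm a d i⟩

variable (k) in
/-- The element `K i ^ -1` of the integral form. -/
def intKinv (i : ι) : integralForm k a d := ⟨_, Kinv_mem_integralForm a d i⟩

variable (k) in
/-- The element `v` of the integral form. -/
def intV : integralForm k a d := ⟨_, v_mem_integralForm a d⟩

variable (k) in
/-- The element `v⁻¹` of the integral form. -/
def intVinv : integralForm k a d :=
  ⟨algebraMap (RatFunc k) (Uv k a d) (RatFunc.X)⁻¹,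
    Algebra.subset_adjoin (.inl (.inl (.inl (.inl (.inr rfl)))))⟩

variable (k) in
/-- The divided powers of `E i` in the integral form. -/
def intEdiv (i : ι) (n : ℕ) : integralForm k a d :=
  ⟨(qFact ((RatFunc.X : RatFunc k) ^ d i) n)⁻¹ • gen (RatFunc.X : RatFunc k) a d (.E i) ^ n,
    Algebra.subset_adjoin (.inl (.inr ⟨(i, n), rfl⟩))⟩

variable (k) in
/-- The divided powers of `F i` in the integral form. -/
def intFdiv (i : ι) (n : ℕ) : integralForm k a d :=
  ⟨(qFact ((RatFunc.X : RatFunc k) ^ d i) n)⁻¹ • gen (RatFunc.X : RatFunc k) a d (.F i) ^ n,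
    Algebra.subset_adjoin (.inr ⟨(i, n), rfl⟩)⟩

theorem Ures.mk_intV (q : k) : Ures.mk a d q (intV k a d) = algebraMap k _ q := by
  rw [← AlgHom.commutes (Ures.mk a d q)]
  exact RingQuot.mkAlgHom_rel k SpecRel.v_eq

variable {a d}

theorem Ures.exists_lift {q : k} {D : Type*} [Ring D] [Algebra k D] (f : integralForm k a d →ₐ[k] D)
    (hf : f (intV k a d) = algebraMap k D q) :
    ∃ g : Ures a d q →ₐ[k] D, ∀ x, g (Ures.mk a d q x) = f x := by
  have h ⦃x y : integralForm k a d⦄ (hxy : SpecRel a d q x y) : f x = f y := by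
    cases hxy
    rw [AlgHom.commutes]
    exact hf
  exact ⟨RingQuot.liftAlgHom k ⟨f, h⟩, RingQuot.liftAlgHom_mkAlgHom_apply k f h⟩

section

variable {C C₀ : Type*} [Ring C] [Algebra (RatFunc k) C] [Algebra k C] [Ring C₀] [Algebra k C₀]
  {j : C₀ →ₐ[k] C}

theorem smul_mem_range {c : RatFunc k} (hc : algebraMap (RatFunc k) C c ∈ j.range) (n : ℕ) {x : C}
    (hx : x ∈ j.range) : c ^ n • x ∈ j.range := by
  rw [Algebra.smul_def, map_pow]
  exact mul_mem (pow_mem hc n) hx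

/-- A map on the quantized enveloping algebra over `k(v)` that maps the integral form into a
subring `C₀` induces a map from the specialization of the integral form to any specialization of
`C₀`. -/
theorem Ures.exists_algHom [IsScalarTower k (RatFunc k) C] {q : k} {D : Type*} [Ring D]
    [Algebra k D] (f : Uv k a d →ₐ[RatFunc k] C) (hj : Function.Injective j) (e : C₀ →ₐ[k] D)
    {v : C₀} (hv : j v = algebraMap (RatFunc k) C RatFunc.X) (he : e v = algebraMap k D q)
    (hv' : algebraMap (RatFunc k) C (RatFunc.X)⁻¹ ∈ j.range)
    (hK : ∀ i, f (intK k a d i) ∈ j.range) (hKinv : ∀ i, f (intKinv k a d i) ∈ j.range)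
    (hE : ∀ i n, f (intEdiv k a d i n) ∈ j.range) (hF : ∀ i n, f (intFdiv k a d i n) ∈ j.range) :
    ∃ g : Ures a d q →ₐ[k] D, ∀ (x : integralForm k a d) c,
      j c = f x → g (Ures.mk a d q x) = e c := by
  obtain ⟨g, hg⟩ := exists_algHom_of_adjoin (f.restrictScalars k) hj
    (A := integralForm k a d) rfl (by
      rintro _ (((((rfl | rfl) | ⟨i, rfl⟩) | ⟨i, rfl⟩) | ⟨⟨i, n⟩, rfl⟩) | ⟨⟨i, n⟩, rfl⟩)
      · exact ⟨v, hv.trans (f.commutes _).symm⟩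
      · rw [AlgHom.restrictScalars_apply, AlgHom.commutes]
        exact hv'
      · exact hK i
      · exact hKinv i
      · exact hE i n
      · exact hF i n)
  obtain ⟨g', hg'⟩ := Ures.exists_lift (q := q) (e.comp g) (by
    rw [AlgHom.comp_apply, ← he]
    congr 1
    refine hj ?_
    rw [hg, hv]
    exact f.commutes _)
  refine ⟨g', fun x c hc => ?_⟩
  rw [hg', AlgHom.comp_apply]
  congr 1
  refine hj ?_
  rw [hg, hc]
  rfl

end

end IntegralForm

/-! ### Hopf maps at a root of unity -/

section Specialization

variable {k : Type*} [Field k] {ι : Type*} {a : Matrix ι ι ℤ} {d : ι → ℕ}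

/-- The lattice is viewed over `k[X]` with `X` acting as `v`. Invertibility of `v` is not needed for
flatness, and `v⁻¹` belongs to the lattice anyway. -/
instance (a : Matrix ι ι ℤ) (d : ι → ℕ) : Algebra (Polynomial k) (integralForm k a d) :=
  ((algebraMap (Polynomial k) (Uv k a d)).codRestrict (integralForm k a d) fun p => by
    have h : algebraMap (Polynomial k) (Uv k a d) Polynomial.X = intV k a d :=
      congrArg (algebraMap (RatFunc k) (Uv k a d)) RatFunc.algebraMap_X
    have h' : algebraMap (Polynomial k) (Uv k a d) p = Polynomial.aeval (intV k a d) p := by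
      rw [Polynomial.aeval_subalgebra_coe, ← h, Polynomial.aeval_algebraMap_apply,
        Polynomial.aeval_X_left_apply]
    rw [h']
    exact Subtype.property _).toAlgebra'
  fun _ _ => Subtype.ext (Algebra.commutes _ _)

theorem algebraMap_X_integralForm :
    algebraMap (Polynomial k) (integralForm k a d) Polynomial.X = intV k a d :=
  Subtype.ext (congrArg (algebraMap (RatFunc k) (Uv k a d)) RatFunc.algebraMap_X)

instance : IsScalarTower k (Polynomial k) (integralForm k a d) :=
  IsScalarTower.of_algebraMap_eq fun _ => Subtype.ext (IsScalarTower.algebraMap_apply _ _ _ _)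

variable (a d) in
/-- The inclusion of the integral form. -/
def intVal : integralForm k a d →ₐ[Polynomial k] Uv k a d :=
  { (integralForm k a d).val with commutes' := fun _ => rfl }

theorem Ures.mk_algebraMap (q : k) (p : Polynomial k) :
    Ures.mk a d q (algebraMap (Polynomial k) _ p) = algebraMap k _ (p.eval q) := by
  have h : (Ures.mk a d q).comp (IsScalarTower.toAlgHom k (Polynomial k) (integralForm k a d)) =
      (Algebra.ofId k _).comp (Polynomial.aeval q) := by
    refine Polynomial.algHom_ext ?_
    simp [algebraMap_X_integralForm, Ures.mk_intV]
  simpa [Polynomial.coe_aeval_eq_eval] using DFunLike.congr_fun h p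

theorem X_pow_ne_zero (i : ι) : (RatFunc.X : RatFunc k) ^ d i ≠ 0 :=
  pow_ne_zero _ RatFunc.X_ne_zero

variable (ha : IsSymmetrizedCartan a d) {q : k}
include ha

/-- By the `q`-binomial theorem the coproduct of a divided power of `E i` is a sum of products of
powers of `v`, divided powers and powers of `K i`, so it stays in the tensor square of the lattice;
likewise for `F i`. -/
theorem Ures.exists_comul : ∃ Δ : Ures a d q →ₐ[k] Ures a d q ⊗[k] Ures a d q,
    (∀ i, Δ (mk a d q (intE k a d i)) = mk a d q (intE k a d i) ⊗ₜ 1 +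
      mk a d q (intK k a d i) ⊗ₜ mk a d q (intE k a d i)) ∧
    (∀ i, Δ (mk a d q (intK k a d i)) = mk a d q (intK k a d i) ⊗ₜ mk a d q (intK k a d i)) ∧
    ∀ i, Δ (mk a d q (intKinv k a d i)) =
      mk a d q (intKinv k a d i) ⊗ₜ mk a d q (intKinv k a d i) := by
  have hU := satisfiesRel_gen (q := (RatFunc.X : RatFunc k)) (a := a) (d := d)
  have hr := ratFunc_X_pow_ne_one k
  let Δ := Uq.lift (hU.comul ha RatFunc.X_ne_zero hr)
  have hΔ (x : Gen ι) : Δ (gen _ a d x) = comulGen (gen _ a d) x := Uq.lift_gen _ x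
  have hj := tensor_lattice_injective (R := Polynomial k) (K := RatFunc k)
    (i := intVal (k := k) a d) Subtype.val_injective
  obtain ⟨e, he⟩ := exists_tensor_specialization (R := Polynomial k) (Polynomial.aeval q)
    (mk a d q) (mk_algebraMap q)
  let j := ((Algebra.TensorProduct.mapOfCompatibleSMul (RatFunc k) (Polynomial k) (Polynomial k)
    (Uv k a d) (Uv k a d)).comp
      (Algebra.TensorProduct.map (intVal a d) (intVal a d))).restrictScalars k
  have hjt (x y : integralForm k a d) :
      j (x ⊗ₜ y) = (x : Uv k a d) ⊗ₜ[RatFunc k] (y : Uv k a d) := rfl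
  have mem (x y : integralForm k a d) :
      (x : Uv k a d) ⊗ₜ[RatFunc k] (y : Uv k a d) ∈ j.range := ⟨_, hjt x y⟩
  have hv : algebraMap (RatFunc k) (Uv k a d ⊗[RatFunc k] Uv k a d) RatFunc.X ∈ j.range :=
    mem (intV k a d) 1
  have hE (i : ι) (n : ℕ) : Δ (intEdiv k a d i n) ∈ j.range := by
    rw [intEdiv, map_smul, map_pow, hΔ, comulGen, dividedPow_add (X_pow_ne_zero i)
      (SatisfiesRel.not_root ha hr i)]
    · refine sum_mem fun p _ => ?_
      rw [← pow_mul]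
      refine smul_mem_range hv _ ⟨(intEdiv k a d i p.2 * intK k a d i ^ p.1) ⊗ₜ
        intEdiv k a d i p.1, (hjt _ _).trans ?_⟩
      simp [intEdiv, intK, TensorProduct.smul_tmul']
    · simp [hU.K_E, SatisfiesRel.pow_eq_diag ha, TensorProduct.smul_tmul']
  have hF (i : ι) (n : ℕ) : Δ (intFdiv k a d i n) ∈ j.range := by
    rw [intFdiv, map_smul, map_pow, hΔ, comulGen, add_comm, dividedPow_add (X_pow_ne_zero i)
      (SatisfiesRel.not_root ha hr i)]
    · refine sum_mem fun p _ => ?_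
      rw [← pow_mul]
      refine smul_mem_range hv _ ⟨intFdiv k a d i p.1 ⊗ₜ
        (intFdiv k a d i p.2 * intKinv k a d i ^ p.1), (hjt _ _).trans ?_⟩
      simp only [intFdiv, intKinv, MulMemClass.coe_mul, SubmonoidClass.coe_pow,
        Algebra.TensorProduct.tmul_pow, one_pow, Algebra.TensorProduct.tmul_mul_tmul, one_mul,
        TensorProduct.smul_tmul', smul_mul_assoc, TensorProduct.tmul_smul, smul_smul]
    · simp [hU.Kinv_F RatFunc.X_ne_zero, SatisfiesRel.pow_eq_diag ha]
  obtain ⟨g, hg⟩ := exists_algHom (q := q) Δ hj e (v := intV k a d ⊗ₜ 1) rfl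
    (by rw [he, mk_intV, map_one, Algebra.TensorProduct.algebraMap_apply])
    (mem (intVinv k a d) 1)
    (fun i => ⟨intK k a d i ⊗ₜ intK k a d i, (hΔ (.K i)).symm⟩)
    (fun i => ⟨intKinv k a d i ⊗ₜ intKinv k a d i, (hΔ (.Kinv i)).symm⟩) hE hF
  refine ⟨g, fun i => ?_, fun i => ?_, fun i => ?_⟩
  · rw [hg (intE k a d i) (intE k a d i ⊗ₜ 1 + intK k a d i ⊗ₜ intE k a d i) (hΔ (.E i)).symm,
      map_add, he, he, map_one]
  · rw [hg (intK k a d i) (intK k a d i ⊗ₜ intK k a d i) (hΔ (.K i)).symm, he]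
  · rw [hg (intKinv k a d i) (intKinv k a d i ⊗ₜ intKinv k a d i) (hΔ (.Kinv i)).symm, he]

omit ha

/-- The lattice in `k(v)` is the ring of rational functions regular at `q`, which contains `v⁻¹`
because `q ≠ 0`. -/
theorem Ures.exists_counit (hq : q ≠ 0) : ∃ ε : Ures a d q →ₐ[k] k,
    (∀ i, ε (mk a d q (intE k a d i)) = 0) ∧ ∀ i, ε (mk a d q (intK k a d i)) = 1 := by
  let ε := Uq.lift (satisfiesRel_counit (q := (RatFunc.X : RatFunc k)) (a := a) (d := d))
  have hε (x : Gen ι) : ε (gen _ a d x) = counitGen _ x := Uq.lift_gen _ x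
  let j := (regularAt q).val
  have hj : Function.Injective j := Subtype.val_injective
  -- A divided power of `0` is `1` for `n = 0` and `0` otherwise, so its denominator never
  -- intervenes.
  have mem (n : ℕ) (c : RatFunc k) : (qFact c n)⁻¹ • (0 : RatFunc k) ^ n ∈ j.range := by
    rcases n with _ | n
    · simp [qFact, one_mem]
    · simp [zero_mem]
  obtain ⟨g, hg⟩ := exists_algHom (q := q) ε hj (evalAt q) (v := ⟨_, X_mem_regularAt q⟩) rfl
    (RatFunc.eval_X (f := RingHom.id k) (a := q))
    ⟨⟨_, X_inv_mem_regularAt hq⟩, rfl⟩ (fun i => ⟨1, (hε (.K i)).symm⟩)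
    (fun i => ⟨1, (hε (.Kinv i)).symm⟩)
    (fun i n => by
      rw [intEdiv, map_smul, map_pow, hε]
      exact mem n _)
    (fun i n => by
      rw [intFdiv, map_smul, map_pow, hε]
      exact mem n _)
  refine ⟨g, fun i => ?_, fun i => ?_⟩
  · rw [hg (intE k a d i) 0 (hε (.E i)).symm, map_zero]
  · rw [hg (intK k a d i) 1 (hε (.K i)).symm, map_one]

include ha

/-- The antipode of a divided power is, up to sign and a power of `v` or `v⁻¹`, a product of the
same divided power and a power of `K i` or its inverse. -/
theorem Ures.exists_antipode : ∃ S : Ures a d q →ₐ[k] (Ures a d q)ᵐᵒᵖ,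
    (∀ i, S (mk a d q (intE k a d i)) =
      .op (-(mk a d q (intKinv k a d i) * mk a d q (intE k a d i)))) ∧
    (∀ i, S (mk a d q (intK k a d i)) = .op (mk a d q (intKinv k a d i))) ∧
    ∀ i, S (mk a d q (intKinv k a d i)) = .op (mk a d q (intK k a d i)) := by
  have hU := satisfiesRel_gen (q := (RatFunc.X : RatFunc k)) (a := a) (d := d)
  have hX : (RatFunc.X : RatFunc k) ≠ 0 := RatFunc.X_ne_zero
  let S := Uq.lift (hU.antipode ha hX (ratFunc_X_pow_ne_one k))
  have hS (x : Gen ι) : S (gen _ a d x) = antipodeGen (gen _ a d) x := Uq.lift_gen _ x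
  let j := AlgHom.op (integralForm k a d).val
  have hj : Function.Injective j :=
    MulOpposite.op_injective.comp (Subtype.val_injective.comp MulOpposite.unop_injective)
  have mem (x : integralForm k a d) : MulOpposite.op (x : Uv k a d) ∈ j.range := ⟨.op x, rfl⟩
  have hv : algebraMap (RatFunc k) (Uv k a d)ᵐᵒᵖ RatFunc.X ∈ j.range := mem (intV k a d)
  have hv' : algebraMap (RatFunc k) (Uv k a d)ᵐᵒᵖ (RatFunc.X)⁻¹ ∈ j.range := mem (intVinv k a d)
  have hE (i : ι) (n : ℕ) : S (intEdiv k a d i n) ∈ j.range := by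
    obtain ⟨m, hm⟩ := mul_pow_of_qComm (x := gen (RatFunc.X : RatFunc k) a d (.Kinv i))
      (κ := gen _ a d (.E i)) (c := (RatFunc.X ^ d i) ^ 2) (by
        rw [hU.Kinv_E hX, smul_smul, zpow_neg, SatisfiesRel.pow_eq_diag ha, mul_inv_cancel₀
          (pow_ne_zero _ (X_pow_ne_zero i)), one_smul]) n
    rw [intEdiv, map_smul, map_pow, hS, antipodeGen, ← MulOpposite.op_pow, neg_pow, hm,
      ← MulOpposite.op_smul, ← pow_mul, ← pow_mul, mul_smul_comm, smul_comm, MulOpposite.op_smul]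
    refine smul_mem_range hv _ ?_
    have := mem ((-1) ^ n * (intKinv k a d i ^ n * intEdiv k a d i n))
    simpa [intEdiv, intKinv] using this
  have hF (i : ι) (n : ℕ) : S (intFdiv k a d i n) ∈ j.range := by
    obtain ⟨m, hm⟩ := mul_pow_of_qComm (x := gen (RatFunc.X : RatFunc k) a d (.F i))
      (κ := gen _ a d (.K i)) (c := ((RatFunc.X : RatFunc k)⁻¹ ^ d i) ^ 2) (by
        rw [hU.K_F, zpow_neg, SatisfiesRel.pow_eq_diag ha, inv_pow, inv_pow]) n
    rw [intFdiv, map_smul, map_pow, hS, antipodeGen, ← MulOpposite.op_pow, neg_pow, hm,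
      ← MulOpposite.op_smul, ← pow_mul, ← pow_mul, mul_smul_comm, smul_comm, MulOpposite.op_smul]
    refine smul_mem_range hv' _ ?_
    have := mem ((-1) ^ n * (intFdiv k a d i n * intK k a d i ^ n))
    simpa [intFdiv, intK] using this
  obtain ⟨g, hg⟩ := exists_algHom (q := q) S hj (AlgHom.op (mk a d q)) (v := .op (intV k a d)) rfl
    (congrArg MulOpposite.op (mk_intV a d q)) hv'
    (fun i => ⟨.op (intKinv k a d i), (hS (.K i)).symm⟩)
    (fun i => ⟨.op (intK k a d i), (hS (.Kinv i)).symm⟩) hE hF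
  refine ⟨g, fun i => ?_, fun i => ?_, fun i => ?_⟩
  · rw [hg (intE k a d i) (.op (-(intKinv k a d i * intE k a d i))) (hS (.E i)).symm]
    simp
  · exact hg (intK k a d i) (.op (intKinv k a d i)) (hS (.K i)).symm
  · exact hg (intKinv k a d i) (.op (intK k a d i)) (hS (.Kinv i)).symm

omit ha

/-- A divided power of exponent `n` is homogeneous, of degree `n` times that of its generator, so
the coefficients remain in the integral form. -/
theorem Ures.exists_grading : ∃ γ : Ures a d q →ₐ[k] LaurentPolynomial (Ures a d q),
    (∀ i, γ (mk a d q (intE k a d i)) =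
      LaurentPolynomial.C (mk a d q (intE k a d i)) * LaurentPolynomial.T (d i)) ∧
    (∀ i, γ (mk a d q (intK k a d i)) = LaurentPolynomial.C (mk a d q (intK k a d i))) ∧
    ∀ i, γ (mk a d q (intKinv k a d i)) = LaurentPolynomial.C (mk a d q (intKinv k a d i)) := by
  have hU := satisfiesRel_gen (q := (RatFunc.X : RatFunc k)) (a := a) (d := d)
  let γ := Uq.lift hU.grading
  have hγ (x : Gen ι) : γ (gen _ a d x) = gradingGen d (gen _ a d) x := Uq.lift_gen _ x
  let j : LaurentPolynomial (integralForm k a d) →ₐ[k] LaurentPolynomial (Uv k a d) :=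
    AddMonoidAlgebra.mapAlgHom ℤ (integralForm k a d).val
  have hj : Function.Injective j :=
    AddMonoidAlgebra.map_injective (integralForm k a d).val.toAddMonoidHom Subtype.val_injective
  have hjm (x : integralForm k a d) (n : ℤ) :
      j (AddMonoidAlgebra.single n x) = AddMonoidAlgebra.single n (x : Uv k a d) :=
    AddMonoidAlgebra.mapAlgHom_single _ _ _
  have mem (x : integralForm k a d) (n : ℤ) :
      LaurentPolynomial.C (x : Uv k a d) * LaurentPolynomial.T n ∈ j.range := by
    rw [← LaurentPolynomial.single_eq_C_mul_T]
    exact ⟨_, hjm x n⟩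
  have mem' (x : integralForm k a d) : LaurentPolynomial.C (x : Uv k a d) ∈ j.range := ⟨_, hjm x 0⟩
  have key (c : RatFunc k) (x : Uv k a d) (e : ℤ) (n : ℕ) :
      c • (LaurentPolynomial.C x * LaurentPolynomial.T e) ^ n =
        LaurentPolynomial.C (c • x ^ n) * LaurentPolynomial.T (n * e) := by
    rw [(LaurentPolynomial.commute_T e (LaurentPolynomial.C x)).symm.mul_pow,
      LaurentPolynomial.T_pow, ← smul_mul_assoc]
    simp only [← laurentC_apply (F := RatFunc k), map_smul, map_pow]
  obtain ⟨g, hg⟩ := exists_algHom (q := q) γ hj (AddMonoidAlgebra.mapAlgHom ℤ (mk a d q))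
    (v := LaurentPolynomial.C (intV k a d)) (hjm _ 0)
    ((AddMonoidAlgebra.mapAlgHom_single _ _ _).trans
      (congrArg (LaurentPolynomial.C (R := Ures a d q)) (mk_intV a d q)))
    (mem' (intVinv k a d)) (fun i => ⟨_, (hjm (intK k a d i) 0).trans (hγ (.K i)).symm⟩)
    (fun i => ⟨_, (hjm (intKinv k a d i) 0).trans (hγ (.Kinv i)).symm⟩)
    (fun i n => by
      rw [intEdiv, map_smul, map_pow, hγ, gradingGen, key]
      exact mem (intEdiv k a d i n) _)
    (fun i n => by
      rw [intFdiv, map_smul, map_pow, hγ, gradingGen, key]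
      exact mem (intFdiv k a d i n) _)
  refine ⟨g, fun i => ?_, fun i => ?_, fun i => ?_⟩
  · rw [hg (intE k a d i) (AddMonoidAlgebra.single (d i : ℤ) (intE k a d i)),
      AddMonoidAlgebra.mapAlgHom_single, LaurentPolynomial.single_eq_C_mul_T]
    exact (hjm _ _).trans ((LaurentPolynomial.single_eq_C_mul_T _ _).trans (hγ (.E i)).symm)
  · exact (hg (intK k a d i) (LaurentPolynomial.C (intK k a d i))
      ((hjm (intK k a d i) 0).trans (hγ (.K i)).symm)).trans
      (AddMonoidAlgebra.mapAlgHom_single _ _ _)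
  · exact (hg (intKinv k a d i) (LaurentPolynomial.C (intKinv k a d i))
      ((hjm (intKinv k a d i) 0).trans (hγ (.Kinv i)).symm)).trans
      (AddMonoidAlgebra.mapAlgHom_single _ _ _)

theorem Ures.hasPositiveMaps (ha : IsSymmetrizedCartan a d) (hq : q ≠ 0) :
    HasPositiveMaps q d (fun i => mk a d q (intE k a d i)) (fun i => mk a d q (intK k a d i))
      (fun i => mk a d q (intKinv k a d i)) where
  K_mul_Kinv i := by
    have h : intK k a d i * intKinv k a d i = 1 := Subtype.ext (satisfiesRel_gen.K_mul_Kinv i)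
    rw [← map_mul, h, map_one]
  Kinv_mul_K i := by
    have h : intKinv k a d i * intK k a d i = 1 := Subtype.ext (satisfiesRel_gen.Kinv_mul_K i)
    rw [← map_mul, h, map_one]
  K_comm i j := by
    have h : intK k a d i * intK k a d j = intK k a d j * intK k a d i :=
      Subtype.ext (satisfiesRel_gen.K_comm i j)
    rw [← map_mul, h, map_mul]
  K_E i := by
    have h : intK k a d i * intE k a d i =
        (intV k a d ^ 2) ^ d i * (intE k a d i * intK k a d i) := Subtype.ext (by
      have := satisfiesRel_gen (q := (RatFunc.X : RatFunc k)) (a := a) (d := d).K_E i i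
      rw [pow_diag ha, Algebra.smul_def, map_pow, map_pow] at this
      exact this)
    rw [← map_mul, h, map_mul, map_pow, map_pow, mk_intV, ← map_pow, ← map_pow, map_mul,
      ← Algebra.smul_def]
  comul := exists_comul ha
  counit := exists_counit hq
  antipode := exists_antipode ha
  grading := exists_grading

theorem uqPlus.isPositivePart (ha : IsSymmetrizedCartan a d) (hq : q ≠ 0) :
    IsPositivePart q d (uqPlus.E a d q) (uqPlus.K a d q) (fun i =>
      (⟨Ures.mk a d q (intKinv k a d i), Algebra.subset_adjoin (.inr ⟨i, rfl⟩)⟩ : uqPlus a d q)) :=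
  HasPositiveMaps.isPositivePart (Ures.hasPositiveMaps ha hq) rfl

end Specialization

/-! ### The quotient by the relations K i ^ l = 1 -/

section Torsion

variable {k : Type*} [Field k] {A : Type*} [Ring A] [Algebra k A] {ι : Type*}

/-- The structure of a positive part descends to the quotient by the relations `K i ^ l = 1`. -/
theorem IsPositivePart.quotient.{u} {q : k} {d : ι → ℕ} {E K Kinv : ι → A}
    (hA : IsPositivePart q d E K Kinv) {B : Type u} [Ring B] [Algebra k B] {l : ℕ} (π : A →ₐ[k] B)
    (hπ : Function.Surjective π) (hπK : ∀ i, π (K i) ^ l = 1)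
    (lift : ∀ {C : Type u} [Ring C] [Algebra k C] (f : A →ₐ[k] C), (∀ i, f (K i) ^ l = 1) →
      ∃ g : B →ₐ[k] C, ∀ x, g (π x) = f x)
    (lift' : ∀ f : A →ₐ[k] k, (∀ i, f (K i) ^ l = 1) → ∃ g : B →ₐ[k] k, ∀ x, g (π x) = f x) :
    IsPositivePart q d (fun i => π (E i)) (fun i => π (K i)) (fun i => π (Kinv i)) where
  K_mul_Kinv i := by rw [← map_mul, hA.K_mul_Kinv, map_one]
  Kinv_mul_K i := by rw [← map_mul, hA.Kinv_mul_K, map_one]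
  K_comm i j := by rw [← map_mul, hA.K_comm, map_mul]
  K_E i := by rw [← map_mul, hA.K_E, map_smul, map_mul]
  adjoin := by
    have h := congrArg (Subalgebra.map π) hA.adjoin
    rw [Algebra.map_top, (AlgHom.range_eq_top π).mpr hπ, AlgHom.map_adjoin, Set.image_union,
      Set.image_union, ← Set.range_comp, ← Set.range_comp, ← Set.range_comp] at h
    exact h
  comul := by
    obtain ⟨Δ, hE, hK⟩ := hA.comul
    obtain ⟨g, hg⟩ := lift ((Algebra.TensorProduct.map π π).comp Δ) fun i => by
      simp [hK, Algebra.TensorProduct.tmul_pow, hπK, Algebra.TensorProduct.one_def]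
    exact ⟨g, fun i => by simp [hg, hE], fun i => by simp [hg, hK]⟩
  counit := by
    obtain ⟨ε, hE, hK⟩ := hA.counit
    -- The counit has target `k`, which may lie in another universe than the quotient; hence the
    -- separate lifting property.
    obtain ⟨g, hg⟩ := lift' ε fun i => by rw [hK, one_pow]
    exact ⟨g, fun i => by rw [hg, hE], fun i => by rw [hg, hK]⟩
  antipode := by
    obtain ⟨S, hE, hK⟩ := hA.antipode
    have hπKinv (i : ι) : π (Kinv i) ^ l = 1 := by
      have h : π (K i) ^ l * π (Kinv i) ^ l = 1 := by
        have hc : Commute (K i) (Kinv i) := (hA.K_mul_Kinv i).trans (hA.Kinv_mul_K i).symm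
        rw [← map_pow, ← map_pow, ← map_mul, ← hc.mul_pow, hA.K_mul_Kinv, one_pow, map_one]
      rwa [hπK, one_mul] at h
    obtain ⟨g, hg⟩ := lift ((AlgHom.op π).comp S) fun i => by
      simp [hK, ← MulOpposite.op_pow, hπKinv]
    exact ⟨g, fun i => by simp [hg, hE], fun i => by simp [hg, hK]⟩
  grading := by
    obtain ⟨γ, hE, hK⟩ := hA.grading
    obtain ⟨g, hg⟩ := lift ((Polynomial.mapAlgHom π).comp γ) fun i => by
      simp [hK, ← Polynomial.C_pow, hπK]
    exact ⟨g, fun i => by simp [hg, hE], fun i => by simp [hg, hK]⟩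

theorem uqPlusQuot.exists_lift {a : Matrix ι ι ℤ} {d : ι → ℕ} {q : k} {l : ℕ} {C : Type*} [Ring C]
    [Algebra k C] (f : uqPlus a d q →ₐ[k] C) (hf : ∀ i, f (uqPlus.K a d q i) ^ l = 1) :
    ∃ g : uqPlusQuot a d q l →ₐ[k] C, ∀ x, g (uqPlusQuot.mk a d q l x) = f x := by
  have h ⦃x y : uqPlus a d q⦄ (hxy : TorsionRel a d q l x y) : f x = f y := by
    cases hxy with
    | K_pow i => rw [map_pow, hf, map_one]
  exact ⟨RingQuot.liftAlgHom k ⟨f, h⟩, RingQuot.liftAlgHom_mkAlgHom_apply k f h⟩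

theorem uqPlusQuot.isPositivePart {a : Matrix ι ι ℤ} {d : ι → ℕ} (ha : IsSymmetrizedCartan a d)
    {q : k} (hq : q ≠ 0) (l : ℕ) :
    IsPositivePart q d (fun i => uqPlusQuot.mk a d q l (uqPlus.E a d q i))
      (fun i => uqPlusQuot.mk a d q l (uqPlus.K a d q i))
      (fun i => uqPlusQuot.mk a d q l
        ⟨Ures.mk a d q (intKinv k a d i), Algebra.subset_adjoin (.inr ⟨i, rfl⟩)⟩) :=
  (uqPlus.isPositivePart ha hq).quotient (l := l) (uqPlusQuot.mk a d q l)
    (RingQuot.mkAlgHom_surjective k _) (fun i => by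
      rw [← map_pow]
      exact (RingQuot.mkAlgHom_rel k (TorsionRel.K_pow (l := l) i)).trans (map_one _))
    uqPlusQuot.exists_lift uqPlusQuot.exists_lift

end Torsion

end QuantumYB

end

theorem corollary3p6 {k : Type*} [Field k] [CharZero k] {N : ℕ}
    (a : Matrix (Fin N) (Fin N) ℤ) (d : Fin N → ℕ) (ha : QuantumYB.IsSymmetrizedCartan a d)
    (q : k) (hq : q ≠ 0) :
    ((∀ n : ℕ, 0 < n → q ^ n ≠ 1) →
      QuantumYB.IsYBHopf k (QuantumYB.UqPlus.E q a d) (QuantumYB.UqPlus.K q a d)) ∧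
    (∀ l : ℕ, 0 < l → IsPrimitiveRoot q l →
      QuantumYB.IsYBHopf k (QuantumYB.uqPlus.E a d q) (QuantumYB.uqPlus.K a d q) ∧
      QuantumYB.IsYBHopf k
        (fun i => QuantumYB.uqPlusQuot.mk a d q l (QuantumYB.uqPlus.E a d q i))
        (fun i => QuantumYB.uqPlusQuot.mk a d q l (QuantumYB.uqPlus.K a d q i))) :=
  ⟨QuantumYB.UqPlus.isYBHopf ha hq, fun l _ _ =>
    ⟨(QuantumYB.uqPlus.isPositivePart ha hq).isYBHopf hq ha.d_pos,
      (QuantumYB.uqPlusQuot.isPositivePart ha hq l).isYBHopf hq ha.d_pos⟩⟩
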